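/- **Setting.** Let $\Omega\subset\mathbb R^2$ be a bounded polygonal open set (open, equal to the interior of its closure, and such that it can be triangulated), with points $(x,y)$ and outward unit normal $\mathbf n=(n_1,n_2)$ a.e. on $\partial\Omega$. Put $$\partial_0\Omega=\{n_1\neq0\},\quad \partial_-\Omega=\{n_1=0,\ xn_2<0\},\quad \partial_+\Omega=\{n_1=0,\ xn_2\ge0\},$$ and $H^1_{-,0}(\Omega)=\{v\in H^1(\Omega): v=0 \text{ on }\partial_-\Omega\cup\partial_0\Omega\}$. Write $(\cdot,\cdot)$, $\|\cdot\|$ for the inner product and norm of $L^2(\Omega)$. Let $\mathcal T$ be a triangulation of $\Omega$ into finitely many mutually disjoint open triangles $T$ whose closures cover $\overline\Omega$ exactly, shape-regular with constant $\sigma$ (each $T$ contains a disc of radius $\ge h_T/\sigma$, $h_T=\operatorname{diam}T$) and locally quasi-uniform with constant $\theta$ ($h_T\le\theta h_{T'}$ for adjacent $T,T'$). Let $\Gamma_{\rm int}=\bigcup_T\partial T\setminus\partial\Omega$, let $p\ge2$ and $$V_h=\{V\in H^1_{-,0}(\Omega): V|_T\in\mathbb P_p(T)\ \forall T\in\mathcal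 T\}.$$ On an interface of $T^+$ and $T^-$ put $\{w\}=(w^++w^-)/2$, $[\![w]\!]=w^+\mathbf n^++w^-\mathbf n^-$, $[w]_1=w^+n_1^++w^-n_1^-$; on $\partial\Omega$ put $\{w\}=w$, $[\![w]\!]=w\mathbf n$, $[w]_1=wn_1$; $\nabla_{\mathcal T}$ is the elementwise gradient. For $A=\begin{pmatrix}\alpha&\beta\\\beta&\gamma\end{pmatrix}$ symmetric nonnegative definite, parameters $\kappa,\lambda\ge0$ and the penalty $\tau=C_\tau p^2/\{h\}$, where $h|_T=h_T$, set $$s_{1,h}(w,v)=\int_{\Gamma_{\rm int}}\tfrac{|xn_2|}2\big(\kappa[\![w_x]\!]\cdot[\![v_x]\!]+\lambda[\![w_y]\!]\cdot[\![v_y]\!]\big)\,ds,$$ $$\begin{aligned}s_h(w,v)=&-\int_{\Gamma_{\rm int}\cup\partial_-\Omega}(0,x)^T\cdot\big(\alpha[\![w_x]\!]\{v_x\}+\beta[\![w_x]\!]\{v_y\}+\beta[\![w_y]\!]\{v_x\}+\gamma[\![w_y]\!]\{v_y\}\big)\,ds+s_{1,h}(w,v)\\&-\int_{\Gamma_{\rm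 int}\cup\partial_0\Omega}\big(\{A\nabla w_x\}\cdot[\nabla v]_1+\{A\nabla v_x\}\cdot[\nabla w]_1-\tau[\nabla w]_1\cdot A[\nabla v]_1\big)\,ds.\end{aligned}$$ For $u_0\in L^2(\Omega)$ and $f\in L^2(0,t_f;H^1(\Omega))$, the finite element solution is an absolutely continuous $U:[0,t_f]\to V_h$ with $U(0)=\Pi u_0$ ($\Pi$ the orthogonal $L^2$-projection onto $V_h$) such that, for a.e. $t\in(0,t_f]$ and all $V\in V_h$, $$(U_t,V)+(U_x,V_x)+(xU_y,V)+(\nabla U_t,A\nabla V)+(A\nabla_{\mathcal T}U_x,\nabla_{\mathcal T}V_x)+(\nabla_{\mathcal T}(xU_y),A\nabla V)+s_h(U,V)=(f,V)+(\nabla f,A\nabla V).$$ **Lemma 1.** Let $\Omega,\sigma,\theta$ be as above. There is $C_0>0$ (independent of $\mathcal T$, $h$, $p$ and $\alpha$) such that for every $0<\alpha<1/2$ there exist $0<\gamma<\beta<1$, with $A$ nonnegative definite, and $c_0>0$, all independent of $\mathcal T$, $p$, $C_\tau$, $\kappa$, $\lambda$, $t_f$, $u_0$, $f$ and $U$, such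 that the following holds. For every such $\mathcal T$, every $p\ge2$, $C_\tau\ge C_0$, $\kappa,\lambda\ge0$, $t_f>0$, $u_0\in L^2(\Omega)$, $f\in L^2(0,t_f;H^1(\Omega))$, every finite element solution $U$ and every $0<\zeta<1$, $$\begin{aligned} &\|U(t_f)\|^2+\|\sqrt A\nabla U(t_f)\|^2+(1-\zeta)\int_0^{t_f}\big(c_0\|U\|^2+\|\sqrt A\nabla U\|^2\big)\,dt\\ &+\int_0^{t_f}\Big(\|\sqrt{xn_2}\,U\|_{\partial_+\Omega}^2+\|\sqrt{xn_2A}\,\nabla U\|_{\partial_+\Omega}^2+\|\sqrt A\nabla_{\mathcal T}U_x\|^2+s_{1,h}(U,U)+\|\sqrt{\tau A}[\nabla U]_1\|_{\Gamma_{\rm int}\cup\partial_0\Omega}^2\Big)dt\\ &\le\frac4\zeta\int_0^{t_f}\big(c_0^{-1}\|f\|^2+\|\sqrt A\nabla f\|^2\big)\,dt+\|\Pi u_0\|^2+\|\sqrt A\nabla\Pi u_0\|^2. \end{aligned}$$ If $f\equiv0$, the bound also holds with $\zeta=0$ and without the term in $f$. -/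

import Mathlib

open MeasureTheory Set Topology
open scoped Matrix ContDiff

noncomputable section

namespace Kolmogorov

/-- The Euclidean plane; a point is `z = (x, y)` with `x = z 0` and `y = z 1`. -/
abbrev Plane := EuclideanSpace ℝ (Fin 2)

/-! ### Geometry of the domain -/

/-- `n` is the outward unit normal of the open set `S` at the point `z`: near `z`, the set `S`
is the open half-disc of the points `w` with `(w - z) · n < 0`. For a polygonal set this holds
for exactly one `n` at every boundary point other than the vertices. -/
def IsOuterNormal (S : Set Plane) (z n : Plane) : Prop :=
  ‖n‖ = 1 ∧ ∃ r > 0, ∀ w ∈ Metric.ball z r, w ∈ S ↔ inner ℝ (w - z) n < 0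

open Classical in
/-- The outward unit normal of `S` at `z` (with value `0` where there is none, that is, at the
finitely many vertices if `S` is polygonal and `z` is on its boundary). -/
def outerNormal (S : Set Plane) (z : Plane) : Plane :=
  if h : ∃ n, IsOuterNormal S z n then h.choose else 0

/-- A triangulation of `Ω`: finitely many mutually disjoint open (nondegenerate) triangles whose
closures cover the closure of `Ω` exactly. Hanging nodes are not excluded. -/
structure Triangulation (Ω : Set Plane) where
  /-- number of elements -/
  N : ℕ
  /-- vertices of the elements -/
  vert : Fin N → Fin 3 → Plane
  nondegenerate : ∀ i, AffineIndependent ℝ (vert i)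
  disjoint : ∀ i j, i ≠ j →
    Disjoint (interior (convexHull ℝ (range (vert i)))) (interior (convexHull ℝ (range (vert j))))
  cover : closure Ω = ⋃ i, closure (interior (convexHull ℝ (range (vert i))))

/-- A bounded polygonal open set: a bounded open set that is the interior of its closure (it has
no slits) and can be cut into finitely many triangles. -/
structure IsPolygonal (Ω : Set Plane) : Prop where
  isOpen : IsOpen Ω
  isBounded : Bornology.IsBounded Ω
  regular : interior (closure Ω) = Ω
  exists_triangulation : Nonempty (Triangulation Ω)

/-- The elliptic part of the boundary, `n₁ ≠ 0`. -/
def bdryEll (Ω : Set Plane) : Set Plane :=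
  {z ∈ frontier Ω | outerNormal Ω z 0 ≠ 0}

/-- The inflow part of the boundary, `n₁ = 0` and `x n₂ < 0`. -/
def bdryIn (Ω : Set Plane) : Set Plane :=
  {z ∈ frontier Ω | outerNormal Ω z 0 = 0 ∧ z 0 * outerNormal Ω z 1 < 0}

/-- The outflow part of the boundary, `n₁ = 0` and `x n₂ ≥ 0`. -/
def bdryOut (Ω : Set Plane) : Set Plane :=
  {z ∈ frontier Ω | outerNormal Ω z 0 = 0 ∧ 0 ≤ z 0 * outerNormal Ω z 1}

/-! ### Sobolev functions -/

/-- The partial derivative with respect to the `j`-th coordinate of a smooth function. -/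
def pd (j : Fin 2) (φ : Plane → ℝ) (z : Plane) : ℝ :=
  fderiv ℝ φ z (EuclideanSpace.single j 1)

/-- `v ∈ H¹(Ω)`, with weak gradient `g`. -/
def IsH1With (Ω : Set Plane) (v : Plane → ℝ) (g : Plane → Fin 2 → ℝ) : Prop :=
  MemLp v 2 (volume.restrict Ω) ∧ MemLp g 2 (volume.restrict Ω) ∧
  ∀ φ : Plane → ℝ, ContDiff ℝ ∞ φ → HasCompactSupport φ → tsupport φ ⊆ Ω →
    ∀ j, ∫ z in Ω, v z * pd j φ z = - ∫ z in Ω, g z j * φ z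

/-- `r ∈ L²(∂Ω)` is the trace on `∂Ω` of the function `v` with weak gradient `g`:
Green's formula `∫_Ω (v ∂ⱼφ + gⱼ φ) = ∫_∂Ω r φ nⱼ ds` holds for all smooth `φ`. -/
def IsTrace (Ω : Set Plane) (v : Plane → ℝ) (g : Plane → Fin 2 → ℝ) (r : Plane → ℝ) : Prop :=
  MemLp r 2 (μH[1].restrict (frontier Ω)) ∧
  ∀ φ : Plane → ℝ, ContDiff ℝ ∞ φ → HasCompactSupport φ → ∀ j,
    (∫ z in Ω, v z * pd j φ z) + ∫ z in Ω, g z j * φ z =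
      ∫ z in frontier Ω, r z * φ z * outerNormal Ω z j ∂μH[1]

/-- The space of the `v ∈ H¹(Ω)` whose trace vanishes (almost everywhere) on the inflow and
elliptic parts of the boundary. -/
def H1zero (Ω : Set Plane) : Set (Plane → ℝ) :=
  {v | ∃ g r, IsH1With Ω v g ∧ IsTrace Ω v g r ∧
    ∀ᵐ z ∂(μH[1].restrict (bdryIn Ω ∪ bdryEll Ω)), r z = 0}

/-- The inner product `(u, v)` of `L²(Ω)`. -/
def ip (Ω : Set Plane) (u v : Plane → ℝ) : ℝ := ∫ z in Ω, u z * v z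

/-- The product `(G, A H)` of vector fields in `L²(Ω)`. For `A` symmetric and nonnegative
definite, `ipA Ω A G G = ‖√A G‖²`, as `|√A v|² = v · A v`. -/
def ipA (Ω : Set Plane) (A : Matrix (Fin 2) (Fin 2) ℝ) (G H : Plane → Fin 2 → ℝ) : ℝ :=
  ∫ z in Ω, G z ⬝ᵥ (A *ᵥ H z)

/-- The matrix `A` with rows `(α, β)` and `(β, γ)`. -/
def matA (α β γ : ℝ) : Matrix (Fin 2) (Fin 2) ℝ := !![α, β; β, γ]

namespace Triangulation

variable {Ω : Set Plane} (M : Triangulation Ω)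

/-- The `i`-th element, an open triangle. -/
def elt (i : Fin M.N) : Set Plane := interior (convexHull ℝ (range (M.vert i)))

/-- The local meshsize, `h_T = diam T`. -/
def h (i : Fin M.N) : ℝ := Metric.diam (M.elt i)

/-- Shape-regularity with parameter `σ`: each element contains a disc of radius `≥ h_T / σ`. -/
def ShapeRegular (σ : ℝ) : Prop :=
  ∀ i, ∃ c ρ, 0 < ρ ∧ Metric.ball c ρ ⊆ M.elt i ∧ M.h i ≤ σ * ρ

/-- Local quasi-uniformity with parameter `θ`: the diameters of any two adjacent elements
(those that share a segment) are comparable. -/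
def LocallyQuasiUniform (θ : ℝ) : Prop :=
  ∀ i j, i ≠ j → (frontier (M.elt i) ∩ frontier (M.elt j)).Nontrivial → M.h i ≤ θ * M.h j

/-- The interior mesh skeleton: `Γ` (the union of the boundaries of the elements) without `∂Ω`. -/
def skelInt : Set Plane := (⋃ i, frontier (M.elt i)) \ frontier Ω

open Classical in
/-- The elements that have `z` on their boundary. Away from finitely many points, these are
`T⁺` and `T⁻` if `z` lies on an interface, and the single `T` if `z ∈ ∂Ω`. -/
def around (z : Plane) : Finset (Fin M.N) :=
  Finset.univ.filter fun i => z ∈ frontier (M.elt i)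

/-- Average at `z` of a quantity with one value per element: `(q⁺ + q⁻)/2` on an interface and
`q` on `∂Ω`. -/
def av (q : Fin M.N → ℝ) (z : Plane) : ℝ := (∑ i ∈ M.around z, q i) / (M.around z).card

/-- Broken polynomials: the polynomial on each of the elements, in the variables
`x = X 0` and `y = X 1`. -/
abbrev Broken := Fin M.N → MvPolynomial (Fin 2) ℝ

variable {M}

/-- The function on the union of the elements that a broken polynomial represents. -/
def toFun (w : M.Broken) (z : Plane) : ℝ :=
  ∑ i, (M.elt i).indicator (fun z => MvPolynomial.eval (fun k => z k) (w i)) z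

/-- Elementwise partial derivative. -/
def D (j : Fin 2) (w : M.Broken) : M.Broken := fun i => MvPolynomial.pderiv j (w i)

/-- `x w_y`, elementwise. -/
def xDy (w : M.Broken) : M.Broken := fun i => MvPolynomial.X 0 * D 1 w i

/-- The elementwise gradient as a function. -/
def grad (w : M.Broken) (z : Plane) : Fin 2 → ℝ := fun j => toFun (D j w) z

/-- The average `{w}` on the skeleton (the trace of `w` at the points of `∂Ω`). -/
def avg (w : M.Broken) (z : Plane) : ℝ :=
  M.av (fun i => MvPolynomial.eval (fun k => z k) (w i)) z

/-- The average of the elementwise gradient. -/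
def avgGrad (w : M.Broken) (z : Plane) : Fin 2 → ℝ := fun j => avg (D j w) z

/-- The jump `⟦w⟧ = w⁺ n⁺ + w⁻ n⁻` (and `w n` at the points of `∂Ω`). -/
def jump (w : M.Broken) (z : Plane) : Fin 2 → ℝ := fun k =>
  ∑ i ∈ M.around z, MvPolynomial.eval (fun k => z k) (w i) * outerNormal (M.elt i) z k

/-- `[∇w]₁ = (∇w)⁺ n₁⁺ + (∇w)⁻ n₁⁻` (and `∇w n₁` at the points of `∂Ω`). -/
def jumpGrad₁ (w : M.Broken) (z : Plane) : Fin 2 → ℝ := fun j => jump (D j w) z 0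

variable (M)

/-- The finite element space `V_h` of degree `p`. -/
def Vh (p : ℕ) : Set M.Broken :=
  {V | (∀ i, (V i).totalDegree ≤ p) ∧ toFun V ∈ H1zero Ω}

/-- The penalty `τ = C_τ p² / {h}`. -/
def tau (Cτ : ℝ) (p : ℕ) (z : Plane) : ℝ := Cτ * (p : ℝ) ^ 2 / M.av M.h z

variable {M}

/-- `s_{1,h}(w, v)`. -/
def s₁ (κ lam : ℝ) (w v : M.Broken) : ℝ :=
  ∫ z in M.skelInt, M.av (fun i => |z 0 * outerNormal (M.elt i) z 1|) z / 2 *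
    (κ * (jump (D 0 w) z ⬝ᵥ jump (D 0 v) z) + lam * (jump (D 1 w) z ⬝ᵥ jump (D 1 v) z)) ∂μH[1]

/-- The stabilisation `s_h(w, v)`. -/
def sh (α β γ κ lam Cτ : ℝ) (p : ℕ) (w v : M.Broken) : ℝ :=
  - (∫ z in M.skelInt ∪ bdryIn Ω, z 0 *
      (α * jump (D 0 w) z 1 * avg (D 0 v) z + β * jump (D 0 w) z 1 * avg (D 1 v) z +
        β * jump (D 1 w) z 1 * avg (D 0 v) z + γ * jump (D 1 w) z 1 * avg (D 1 v) z) ∂μH[1])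
  + s₁ κ lam w v
  - ∫ z in M.skelInt ∪ bdryEll Ω,
      ((matA α β γ *ᵥ avgGrad (D 0 w) z) ⬝ᵥ jumpGrad₁ v z +
        (matA α β γ *ᵥ avgGrad (D 0 v) z) ⬝ᵥ jumpGrad₁ w z -
        M.tau Cτ p z * (jumpGrad₁ w z ⬝ᵥ (matA α β γ *ᵥ jumpGrad₁ v z))) ∂μH[1]

variable (M)

/-- `U : [0, t_f] → V_h` is the finite element solution for the forcing `f` (with weak spatial
gradient `g`) and the initial value `u₀`. In time, `U` is absolutely continuous and the equation
holds almost everywhere; this is stated through the coefficients of `U`, with `Ut` the time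
derivative. The initial value is the orthogonal `L²`-projection of `u₀` onto `V_h`. -/
structure IsFESolution (p : ℕ) (α β γ κ lam Cτ tf : ℝ) (u₀ : Plane → ℝ) (f : ℝ → Plane → ℝ)
    (g : ℝ → Plane → Fin 2 → ℝ) (U : ℝ → M.Broken) : Prop where
  mem : ∀ t ∈ Icc 0 tf, U t ∈ M.Vh p
  absolutelyContinuous : ∀ i m,
    AbsolutelyContinuousOnInterval (fun t => MvPolynomial.coeff m (U t i)) 0 tf
  initial : ∀ V ∈ M.Vh p, ip Ω (toFun (U 0)) (toFun V) = ip Ω u₀ (toFun V)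
  equation : ∀ᵐ t ∂(volume.restrict (Ioc 0 tf)), ∃ Ut : M.Broken,
    (∀ i m, HasDerivAt (fun s => MvPolynomial.coeff m (U s i)) (MvPolynomial.coeff m (Ut i)) t) ∧
    ∀ V ∈ M.Vh p,
      ip Ω (toFun Ut) (toFun V) + ip Ω (toFun (D 0 (U t))) (toFun (D 0 V)) +
        ip Ω (toFun (xDy (U t))) (toFun V) +
        ipA Ω (matA α β γ) (grad Ut) (grad V) +
        ipA Ω (matA α β γ) (grad (D 0 (U t))) (grad (D 0 V)) +
        ipA Ω (matA α β γ) (grad (xDy (U t))) (grad V) +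
        sh α β γ κ lam Cτ p (U t) V
      = ip Ω (f t) (toFun V) + ipA Ω (matA α β γ) (g t) (grad V)

variable {M}

/-- `‖w‖² + ‖√A ∇w‖²`. -/
def energy (A : Matrix (Fin 2) (Fin 2) ℝ) (w : M.Broken) : ℝ :=
  ip Ω (toFun w) (toFun w) + ipA Ω A (grad w) (grad w)

/-- `‖√(x n₂) w‖²_{∂₊Ω} + ‖√(x n₂ A) ∇w‖²_{∂₊Ω} + ‖√A ∇w_x‖² + s_{1,h}(w, w)
+ ‖√(τ A) [∇w]₁‖²_{Γ_int ∪ ∂₀Ω}`. -/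
def dissipation (A : Matrix (Fin 2) (Fin 2) ℝ) (κ lam Cτ : ℝ) (p : ℕ) (w : M.Broken) : ℝ :=
  (∫ z in bdryOut Ω, z 0 * outerNormal Ω z 1 * avg w z ^ 2 ∂μH[1]) +
  (∫ z in bdryOut Ω, z 0 * outerNormal Ω z 1 * (avgGrad w z ⬝ᵥ (A *ᵥ avgGrad w z)) ∂μH[1]) +
  ipA Ω A (grad (D 0 w)) (grad (D 0 w)) +
  s₁ κ lam w w +
  ∫ z in M.skelInt ∪ bdryEll Ω,
    M.tau Cτ p z * (jumpGrad₁ w z ⬝ᵥ (A *ᵥ jumpGrad₁ w z)) ∂μH[1]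

/-- The left-hand side of the stability bound. -/
def stabLHS (A : Matrix (Fin 2) (Fin 2) ℝ) (κ lam Cτ : ℝ) (p : ℕ) (c₀ ζ tf : ℝ)
    (U : ℝ → M.Broken) : ℝ :=
  energy A (U tf) +
  (1 - ζ) * (∫ t in (0 : ℝ)..tf,
    (c₀ * ip Ω (toFun (U t)) (toFun (U t)) + ipA Ω A (grad (U t)) (grad (U t)))) +
  ∫ t in (0 : ℝ)..tf, dissipation A κ lam Cτ p (U t)

end Triangulation

end Kolmogorov

end

noncomputable section

namespace Kolmogorov

/-! ### Triangles in the plane -/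

/-! The operator diffuses in `x` only, and the proof is a discrete hypocoercivity argument. As `∇(x
w_y) = x ∂_y ∇w + (w_y, 0)`, the product `2 (∇(x w_y), A∇w)` contains `2α (w_x, w_y) + 2β ‖w_y‖²`:
through the off-diagonal entry `β`, transport yields the missing control of `w_y`. Hence
(`coercivity`) twice the spatial form at `(w, w)` dominates `c₀ ‖w‖² + ‖√A ∇w‖²` plus the
dissipation. Testing with `V = U(t)`, the symmetry of `(w, v) + (∇w, A∇v)` turns the time derivative
into that of the energy; `stabLHS_le` integrates in time, and Young's inequality hides the forcing
in the share `ζ` of the coercive terms.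

For coercivity, put `β = α/2`, `γ = 3α/8`. After `‖√A ∇w‖²` is subtracted, the volume terms leave
`(2 - α) ‖w_x‖² + α (w_x, w_y) + (5α/8) ‖w_y‖²`. A part `‖w_x‖²/2` pays for `c₀ ‖w‖²` by the
Poincaré inequality in `x` (`poincare`), with `c₀ = 1/(8R²)` if `Ω` lies in the disc of radius `R`
about `0`; the rest is nonnegative for `α < 1/2`.

Integrating the transport terms by parts on each element creates skeleton terms. By
`trace_of_mem_H1zero`, `w` has no interior jumps and vanishes on the inflow and elliptic boundary.
`skeleton_balance` then compares integrands pointwise. On interfaces, the flux terms of `s_h` cancel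
the jump of `x ∇w · A∇w` exactly; on the inflow boundary they reverse its bad sign; on the outflow
boundary the sign is right. On the elliptic boundary the penalty absorbs it, as `|n₁| ≥ ν` there
with `ν` depending on `Ω` only.

The consistency terms are split by Young's inequality between the penalty and one of the two
available copies of `‖√A ∇w_x‖²`. This needs the trace inverse inequality with constant of order
`p²` (`integral_frontier_sq_le`), which follows from the one-dimensional `eval_zero_sq_le` on
segments parallel to the other sides of the triangle. -/

/-- The cross product of two plane vectors. -/
def cr (u v : Plane) : ℝ := u 0 * v 1 - u 1 * v 0

/-- Twice the signed area of the triangle with vertices `v`. -/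
def dtr (v : Fin 3 → Plane) : ℝ := cr (v 1 - v 0) (v 2 - v 0)

/-- The `k`-th barycentric coordinate. -/
def lam (v : Fin 3 → Plane) (k : Fin 3) (z : Plane) : ℝ :=
  cr (v (k + 1) - z) (v (k + 2) - z) / dtr v

/-- The edge vector opposite to the `k`-th vertex. -/
def edge (v : Fin 3 → Plane) (k : Fin 3) : Plane := v (k + 2) - v (k + 1)

/-- The outward unit normal on the edge opposite to the `k`-th vertex. -/
def nrm (v : Fin 3 → Plane) (k : Fin 3) : Plane :=
  (dtr v / |dtr v| * ‖edge v k‖⁻¹) • !₂[edge v k 1, - edge v k 0]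

/-- The closed edge opposite to the `k`-th vertex. -/
def side (v : Fin 3 → Plane) (k : Fin 3) : Set Plane := {z | lam v k z = 0 ∧ ∀ j, 0 ≤ lam v j z}

lemma inner_plane (u v : Plane) : inner ℝ u v = u 0 * v 0 + u 1 * v 1 := by
  simp [PiLp.inner_apply, Fin.sum_univ_two, mul_comm]

lemma norm_sq_plane (u : Plane) : ‖u‖ ^ 2 = u 0 ^ 2 + u 1 ^ 2 := by
  simp [EuclideanSpace.norm_sq_eq, Fin.sum_univ_two]

lemma plane_ext {u v : Plane} (h0 : u 0 = v 0) (h1 : u 1 = v 1) : u = v := by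
  ext i; fin_cases i <;> assumption

lemma dtr_ne_zero {v : Fin 3 → Plane} (hv : AffineIndependent ℝ v) : dtr v ≠ 0 := by
  intro h
  rw [affineIndependent_iff_linearIndependent_vsub ℝ v 0] at hv
  have h2 : LinearIndependent ℝ ![v 1 - v 0, v 2 - v 0] := by
    have := hv.comp (fun i : Fin 2 => (⟨i.succ, Fin.succ_ne_zero i⟩ : {x : Fin 3 // x ≠ 0}))
      (fun a b hab => by simpa using hab)
    have h3 : ![v 1 - v 0, v 2 - v 0] = (fun i : {x : Fin 3 // x ≠ 0} => v i -ᵥ v 0) ∘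
        fun i : Fin 2 => (⟨i.succ, Fin.succ_ne_zero i⟩ : {x : Fin 3 // x ≠ 0}) := by
      ext i j
      fin_cases i <;> rfl
    rw [h3]
    exact this
  rw [LinearIndependent.pair_iff] at h2
  unfold dtr cr at h
  have hu : v 1 - v 0 = 0 := by
    -- If the cross product vanishes, the exchanged first coordinates (one with its sign changed)
    -- are the coefficients of a vanishing combination of the two edge vectors; so are the second
    -- ones.
    have h0 := h2 ((v 2 - v 0) 0) (-(v 1 - v 0) 0) (plane_ext (by simp; ring) (by
      simp only [PiLp.add_apply, PiLp.smul_apply, smul_eq_mul, PiLp.zero_apply]; linarith))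
    have h1 := h2 ((v 2 - v 0) 1) (-(v 1 - v 0) 1) (plane_ext (by
      simp only [PiLp.add_apply, PiLp.smul_apply, smul_eq_mul, PiLp.zero_apply]; linarith)
      (by simp; ring))
    exact plane_ext (neg_eq_zero.1 h0.2) (neg_eq_zero.1 h1.2)
  have := h2 1 0 (by simp [hu])
  simp at this

lemma sum_lam {v : Fin 3 → Plane} (hv : AffineIndependent ℝ v) (z : Plane) :
    lam v 0 z + lam v 1 z + lam v 2 z = 1 := by
  have hD := dtr_ne_zero hv
  have e0 : (2 : Fin 3) + 1 = 0 := rfl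
  have e1 : (2 : Fin 3) + 2 = 1 := rfl
  have e2 : (1 : Fin 3) + 2 = 0 := rfl
  have e3 : (1 : Fin 3) + 1 = 2 := rfl
  simp only [lam, e0, e1, e2, e3, zero_add]
  rw [← add_div, ← add_div, div_eq_one_iff_eq hD]
  simp only [dtr, cr, PiLp.sub_apply]; ring

lemma sum_lam_smul {v : Fin 3 → Plane} (hv : AffineIndependent ℝ v) (z : Plane) :
    lam v 0 z • v 0 + lam v 1 z • v 1 + lam v 2 z • v 2 = z := by
  have hD := dtr_ne_zero hv
  have e0 : (2 : Fin 3) + 1 = 0 := rfl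
  have e1 : (2 : Fin 3) + 2 = 1 := rfl
  have e2 : (1 : Fin 3) + 2 = 0 := rfl
  have e3 : (1 : Fin 3) + 1 = 2 := rfl
  apply plane_ext <;>
  · simp only [lam, e0, e1, e2, e3, zero_add, PiLp.add_apply, PiLp.smul_apply, smul_eq_mul]
    field_simp
    simp only [dtr, cr, PiLp.sub_apply]; ring

lemma lam_combo (v : Fin 3 → Plane) (hv : AffineIndependent ℝ v) (c : Fin 3 → ℝ)
    (hc : c 0 + c 1 + c 2 = 1) (k : Fin 3) :
    lam v k (c 0 • v 0 + c 1 • v 1 + c 2 • v 2) = c k := by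
  have hD := dtr_ne_zero hv
  have e0 : (2 : Fin 3) + 1 = 0 := rfl
  have e1 : (2 : Fin 3) + 2 = 1 := rfl
  have e2 : (1 : Fin 3) + 2 = 0 := rfl
  have e3 : (1 : Fin 3) + 1 = 2 := rfl
  rw [lam, div_eq_iff hD]
  obtain rfl | rfl | rfl : k = 0 ∨ k = 1 ∨ k = 2 := by fin_cases k <;> simp
  · have : c 0 = 1 - c 1 - c 2 := by linarith
    simp only [dtr, cr, PiLp.sub_apply, PiLp.add_apply, PiLp.smul_apply, smul_eq_mul, zero_add, this]
    ring
  · have : c 0 = 1 - c 1 - c 2 := by linarith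
    simp only [e2, e3, dtr, cr, PiLp.sub_apply, PiLp.add_apply, PiLp.smul_apply, smul_eq_mul, this]
    ring
  · have : c 0 = 1 - c 1 - c 2 := by linarith
    simp only [e0, e1, dtr, cr, PiLp.sub_apply, PiLp.add_apply, PiLp.smul_apply, smul_eq_mul, this]
    ring

lemma edge_ne_zero {v : Fin 3 → Plane} (hv : AffineIndependent ℝ v) (k : Fin 3) :
    edge v k ≠ 0 := by
  intro h
  have := hv.injective (sub_eq_zero.1 h)
  clear h
  revert this; revert k; decide

lemma norm_nrm {v : Fin 3 → Plane} (hv : AffineIndependent ℝ v) (k : Fin 3) :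
    ‖nrm v k‖ = 1 := by
  have hD := dtr_ne_zero hv
  have he := norm_pos_iff.2 (edge_ne_zero hv k)
  have h1 : ‖(!₂[edge v k 1, - edge v k 0] : Plane)‖ = ‖edge v k‖ := by
    rw [← sq_eq_sq₀ (norm_nonneg _) (norm_nonneg _), norm_sq_plane, norm_sq_plane]
    simp; ring
  rw [nrm, norm_smul, h1, norm_mul, norm_div, norm_inv, norm_norm, Real.norm_eq_abs,
    Real.norm_eq_abs, abs_abs]
  field_simp

/-- A barycentric coordinate is affine with gradient `-(‖edge v k‖ / |dtr v|) • nrm v k`. This links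
the description of the triangle by inequalities to its normals; the orientation sign in `nrm` makes
it valid for both orders of the vertices. -/
lemma lam_sub (v : Fin 3 → Plane) (hv : AffineIndependent ℝ v) (k : Fin 3) (z w : Plane) :
    lam v k w - lam v k z = - (‖edge v k‖ / |dtr v| * inner ℝ (w - z) (nrm v k)) := by
  have hD := dtr_ne_zero hv
  have he := norm_pos_iff.2 (edge_ne_zero hv k)
  have : inner ℝ (w - z) (nrm v k) = dtr v / |dtr v| * ‖edge v k‖⁻¹ * cr (w - z) (edge v k) := by
    rw [nrm, inner_smul_right, inner_plane]; simp only [cr, Fin.isValue, Matrix.cons_val_zero, Matrix.cons_val_one]; ring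
  rw [this, lam, lam, ← sub_div]
  have h2 : dtr v / |dtr v| * (dtr v / |dtr v|) = 1 := by
    rw [div_mul_div_comm, abs_mul_abs_self, div_self (by positivity)]
  have h3 : ‖edge v k‖ / |dtr v| * (dtr v / |dtr v| * ‖edge v k‖⁻¹ * cr (w - z) (edge v k)) =
      cr (w - z) (edge v k) / dtr v := by
    have h4 : |dtr v| * |dtr v| = dtr v * dtr v := abs_mul_abs_self _
    have h5 : 0 < |dtr v| := abs_pos.2 hD
    field_simp
    rw [pow_two, pow_two, h4]
  rw [h3, ← neg_div]
  congr 1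
  simp only [cr, edge, PiLp.sub_apply]; ring

lemma lam_rate_pos {v : Fin 3 → Plane} (hv : AffineIndependent ℝ v) (k : Fin 3) :
    0 < ‖edge v k‖ / |dtr v| :=
  div_pos (norm_pos_iff.2 (edge_ne_zero hv k)) (abs_pos.2 (dtr_ne_zero hv))

lemma continuous_lam (v : Fin 3 → Plane) (k : Fin 3) : Continuous (lam v k) := by
  unfold lam cr; fun_prop

/-- The affine basis formed by the vertices. -/
def triBasis {v : Fin 3 → Plane} (hv : AffineIndependent ℝ v) : AffineBasis (Fin 3) ℝ Plane :=
  ⟨v, hv, by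
    rw [hv.affineSpan_eq_top_iff_card_eq_finrank_add_one]; simp⟩

lemma triBasis_coord {v : Fin 3 → Plane} (hv : AffineIndependent ℝ v) (k : Fin 3) (z : Plane) :
    (triBasis hv).coord k z = lam v k z := by
  have hs : ∑ i, (fun i => lam v i z) i = 1 := by
    rw [Fin.sum_univ_three]; exact sum_lam hv z
  have h := (triBasis hv).coord_apply_combination_of_mem (i := k) (s := Finset.univ)
    (Finset.mem_univ k) hs
  rw [Finset.affineCombination_eq_linear_combination _ _ _ hs, Fin.sum_univ_three] at h
  refine Eq.trans ?_ h
  congr 1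
  exact (sum_lam_smul hv z).symm

lemma mem_tri {v : Fin 3 → Plane} (hv : AffineIndependent ℝ v) {z : Plane} :
    z ∈ interior (convexHull ℝ (range v)) ↔ ∀ k, 0 < lam v k z := by
  have h := (triBasis hv).interior_convexHull
  have : (range (triBasis hv)) = range v := rfl
  rw [this] at h
  rw [h]; simp [triBasis_coord]

lemma mem_convexHull_tri {v : Fin 3 → Plane} (hv : AffineIndependent ℝ v) {z : Plane} :
    z ∈ convexHull ℝ (range v) ↔ ∀ k, 0 ≤ lam v k z := by
  have h := (triBasis hv).convexHull_eq_nonneg_coord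
  have : (range (triBasis hv)) = range v := rfl
  rw [this] at h
  rw [h]; simp [triBasis_coord]

lemma tri_nonempty {v : Fin 3 → Plane} (hv : AffineIndependent ℝ v) :
    (interior (convexHull ℝ (range v))).Nonempty := by
  refine ⟨(1/3 : ℝ) • v 0 + (1/3 : ℝ) • v 1 + (1/3 : ℝ) • v 2, (mem_tri hv).2 fun k => ?_⟩
  rw [lam_combo v hv (fun _ => 1/3) (by norm_num) k]; norm_num

lemma closure_tri {v : Fin 3 → Plane} (hv : AffineIndependent ℝ v) :
    closure (interior (convexHull ℝ (range v))) = convexHull ℝ (range v) := by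
  rw [(convex_convexHull ℝ _).closure_interior_eq_closure_of_nonempty_interior (tri_nonempty hv)]
  exact ((finite_range v).isClosed_convexHull (𝕜 := ℝ)).closure_eq

lemma mem_closure_tri {v : Fin 3 → Plane} (hv : AffineIndependent ℝ v) {z : Plane} :
    z ∈ closure (interior (convexHull ℝ (range v))) ↔ ∀ k, 0 ≤ lam v k z := by
  rw [closure_tri hv, mem_convexHull_tri hv]

lemma frontier_tri {v : Fin 3 → Plane} (hv : AffineIndependent ℝ v) :
    frontier (interior (convexHull ℝ (range v))) = ⋃ k, side v k := by
  ext z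
  rw [frontier, interior_interior, mem_sdiff, mem_closure_tri hv, mem_tri hv, mem_iUnion]
  constructor
  · rintro ⟨h1, h2⟩
    push Not at h2
    obtain ⟨k, hk⟩ := h2
    exact ⟨k, le_antisymm hk (h1 k), h1⟩
  · rintro ⟨k, hk, h⟩
    exact ⟨h, fun h2 => (h2 k).ne' hk⟩

lemma isClosed_side (v : Fin 3 → Plane) (k : Fin 3) : IsClosed (side v k) := by
  have : side v k = {z | lam v k z = 0} ∩ ⋂ j, {z | 0 ≤ lam v j z} := by
    ext z; simp [side]
  rw [this]
  exact (isClosed_eq (continuous_lam v k) continuous_const).inter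
    (isClosed_iInter fun j => isClosed_le continuous_const (continuous_lam v j))

/-- Two sides of a triangle meet only in a vertex. -/
lemma mem_range_of_mem_sides {v : Fin 3 → Plane} (hv : AffineIndependent ℝ v) {k l : Fin 3}
    (hkl : k ≠ l) {z : Plane} (hk : z ∈ side v k) (hl : z ∈ side v l) : z ∈ range v := by
  have h1 := sum_lam hv z
  have h2 := sum_lam_smul hv z
  have hk := hk.1
  have hl := hl.1
  fin_cases k <;> fin_cases l <;> simp at hkl hk hl <;> simp [hk, hl] at h1 h2
  · exact ⟨2, by simpa [h1] using h2⟩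
  · exact ⟨1, by simpa [h1] using h2⟩
  · exact ⟨2, by simpa [h1] using h2⟩
  · exact ⟨0, by simpa [h1] using h2⟩
  · exact ⟨1, by simpa [h1] using h2⟩
  · exact ⟨0, by simpa [h1] using h2⟩

/-- Near a point of a side that is no vertex, a triangle is a half-disc. -/
lemma exists_ball_side {v : Fin 3 → Plane} (hv : AffineIndependent ℝ v) {k : Fin 3} {z : Plane}
    (hz : z ∈ side v k) (hz' : z ∉ range v) :
    ∃ r > 0, ∀ w ∈ Metric.ball z r,
      (w ∈ interior (convexHull ℝ (range v)) ↔ inner ℝ (w - z) (nrm v k) < 0) ∧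
      (w ∈ closure (interior (convexHull ℝ (range v))) ↔ inner ℝ (w - z) (nrm v k) ≤ 0) := by
  -- Off the vertices only one coordinate vanishes. The others stay positive nearby, so the sign of
  -- `lam v k` alone decides membership.
  have hpos : ∀ j, j ≠ k → 0 < lam v j z := fun j hj => lt_of_le_of_ne (hz.2 j) fun h =>
    hz' (mem_range_of_mem_sides hv hj ⟨h.symm, hz.2⟩ hz)
  have hev : ∀ᶠ w in 𝓝 z, ∀ j, j ≠ k → 0 < lam v j w := by
    rw [Filter.eventually_all]
    intro j
    by_cases hj : j = k
    · simp [hj]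
    · filter_upwards [(continuous_lam v j).continuousAt.eventually (lt_mem_nhds (hpos j hj))]
        with w hw _ using hw
  obtain ⟨r, hr, hb⟩ := Metric.eventually_nhds_iff_ball.1 hev
  refine ⟨r, hr, fun w hw => ?_⟩
  have hk : lam v k w = - (‖edge v k‖ / |dtr v| * inner ℝ (w - z) (nrm v k)) := by
    rw [← lam_sub v hv, hz.1, sub_zero]
  have hc := lam_rate_pos hv k
  constructor
  · rw [mem_tri hv]
    constructor
    · intro h
      have := h k
      rw [hk] at this
      by_contra hn
      push Not at hn
      have := mul_nonneg hc.le hn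
      linarith
    · intro h j
      by_cases hj : j = k
      · rw [hj, hk]; have := mul_neg_of_pos_of_neg hc h; linarith
      · exact hb w hw j hj
  · rw [mem_closure_tri hv]
    constructor
    · intro h
      have := h k
      rw [hk] at this
      by_contra hn
      push Not at hn
      have := mul_pos hc hn
      linarith
    · intro h j
      by_cases hj : j = k
      · rw [hj, hk]; have := mul_nonpos_of_nonneg_of_nonpos hc.le h; linarith
      · exact (hb w hw j hj).le

/-! ### Outer normals -/

/-- If `n ≠ n'`, a small step from `z` in the direction `n' - n` enters the half-disc of `n` but
leaves that of `n'`. -/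
lemma IsOuterNormal.unique {S : Set Plane} {z n n' : Plane} (h : IsOuterNormal S z n)
    (h' : IsOuterNormal S z n') : n = n' := by
  obtain ⟨h1, r, hr, hb⟩ := h
  obtain ⟨h1', r', hr', hb'⟩ := h'
  by_contra hne
  have hc : inner ℝ n n' < 1 := (inner_lt_one_iff_real_of_norm_eq_one h1 h1').2 hne
  set d := n' - n with hd
  obtain ⟨ε, hε, hεr⟩ : ∃ ε > 0, ε * ‖d‖ < min r r' := by
    have : 0 < min r r' := lt_min hr hr'
    refine ⟨min r r' / (‖d‖ + 1), by positivity, ?_⟩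
    rw [div_mul_eq_mul_div, div_lt_iff₀ (by positivity)]
    nlinarith [norm_nonneg d]
  have hw : ‖(z + ε • d) - z‖ < min r r' := by
    rw [add_sub_cancel_left, norm_smul, Real.norm_of_nonneg hε.le]; exact hεr
  have e1 := hb (z + ε • d) (by rw [Metric.mem_ball, dist_eq_norm]; exact hw.trans_le (min_le_left _ _))
  have e2 := hb' (z + ε • d) (by rw [Metric.mem_ball, dist_eq_norm]; exact hw.trans_le (min_le_right _ _))
  rw [add_sub_cancel_left, inner_smul_left] at e1 e2
  have i1 : inner ℝ d n < 0 := by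
    rw [hd, inner_sub_left, real_inner_self_eq_norm_sq, h1, real_inner_comm]; linarith
  have i2 : 0 < inner ℝ d n' := by
    rw [hd, inner_sub_left, real_inner_self_eq_norm_sq, h1']; linarith
  have := e2.1 (e1.2 (by simpa using mul_neg_of_pos_of_neg hε i1))
  have h3 : 0 < ε * inner ℝ d n' := mul_pos hε i2
  simp at this
  linarith

lemma IsOuterNormal.outerNormal_eq {S : Set Plane} {z n : Plane} (h : IsOuterNormal S z n) :
    outerNormal S z = n := by
  have : ∃ n, IsOuterNormal S z n := ⟨n, h⟩
  rw [outerNormal, dif_pos this]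
  exact this.choose_spec.unique h

lemma IsOuterNormal.mem_frontier {S : Set Plane} {z n : Plane} (h : IsOuterNormal S z n) :
    z ∈ frontier S := by
  obtain ⟨h1, r, hr, hb⟩ := h
  have hz : z ∉ S := fun hz => by
    have := (hb z (Metric.mem_ball_self hr)).1 hz
    simp at this
  refine ⟨?_, fun h => hz (interior_subset h)⟩
  rw [Metric.mem_closure_iff]
  intro ε hε
  have hm : 0 < min ε r / 2 := by positivity
  have hd : dist z (z - (min ε r / 2) • n) = min ε r / 2 := by
    rw [dist_eq_norm, sub_sub_cancel, norm_smul, h1, mul_one, Real.norm_of_nonneg hm.le]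
  refine ⟨z - (min ε r / 2) • n, ?_, ?_⟩
  · rw [hb]
    · rw [sub_sub_cancel_left, inner_neg_left, inner_smul_left, real_inner_self_eq_norm_sq, h1]
      simpa using lt_min hε hr
    · rw [Metric.mem_ball, dist_comm, hd]
      have := min_le_right ε r
      linarith
  · rw [hd]
    have := min_le_left ε r
    linarith

/-- The default value `0` off the frontier lets sums over the elements at a point be extended to all
elements. -/
lemma outerNormal_of_notMem_frontier {S : Set Plane} {z : Plane} (h : z ∉ frontier S) :
    outerNormal S z = 0 := by
  rw [outerNormal, dif_neg]
  rintro ⟨n, hn⟩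
  exact h hn.mem_frontier

lemma norm_outerNormal_le (S : Set Plane) (z : Plane) : ‖outerNormal S z‖ ≤ 1 := by
  by_cases h : ∃ n, IsOuterNormal S z n
  · obtain ⟨n, hn⟩ := h
    rw [hn.outerNormal_eq, hn.1]
  · rw [outerNormal, dif_neg h]; simp

lemma isOuterNormal_tri {v : Fin 3 → Plane} (hv : AffineIndependent ℝ v) {k : Fin 3} {z : Plane}
    (hz : z ∈ side v k) (hz' : z ∉ range v) :
    IsOuterNormal (interior (convexHull ℝ (range v))) z (nrm v k) := by
  obtain ⟨r, hr, hb⟩ := exists_ball_side hv hz hz'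
  exact ⟨norm_nrm hv k, r, hr, fun w hw => (hb w hw).1⟩

/-- The points of a side are parametrised by `[0, 1]`. -/
lemma side_eq_image {v : Fin 3 → Plane} (hv : AffineIndependent ℝ v) (k : Fin 3) :
    side v k = (fun t : ℝ => v (k + 1) + t • edge v k) '' Icc 0 1 := by
  have e0 : (2 : Fin 3) + 1 = 0 := rfl
  have e1 : (2 : Fin 3) + 2 = 1 := rfl
  have e2 : (1 : Fin 3) + 2 = 0 := rfl
  have e3 : (1 : Fin 3) + 1 = 2 := rfl
  ext z
  constructor
  · rintro ⟨h1, h2⟩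
    have hs := sum_lam hv z
    have hss := sum_lam_smul hv z
    refine ⟨lam v (k + 2) z, ⟨h2 _, ?_⟩, ?_⟩
    · have a0 := h2 0
      have a1 := h2 1
      have a2 := h2 2
      fin_cases k <;> simp [e1, e2] at h1 ⊢ <;> linarith
    · obtain rfl | rfl | rfl : k = 0 ∨ k = 1 ∨ k = 2 := by fin_cases k <;> simp
      · have hl : lam v 1 z = 1 - lam v 2 z := by linarith
        conv_rhs => rw [← hss, h1, hl]
        simp only [edge, zero_add]; module
      · have hl : lam v 2 z = 1 - lam v 0 z := by linarith
        conv_rhs => rw [← hss, h1, hl]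
        simp only [edge, e2, e3]; module
      · have hl : lam v 0 z = 1 - lam v 1 z := by linarith
        conv_rhs => rw [← hss, h1, hl]
        simp only [edge, e0, e1]; module
  · rintro ⟨t, ⟨ht0, ht1⟩, rfl⟩
    obtain rfl | rfl | rfl : k = 0 ∨ k = 1 ∨ k = 2 := by fin_cases k <;> simp
    · have : (fun t : ℝ => v (0 + 1) + t • edge v 0) t =
          (![0, 1 - t, t] : Fin 3 → ℝ) 0 • v 0 + (![0, 1 - t, t] : Fin 3 → ℝ) 1 • v 1 +
          (![0, 1 - t, t] : Fin 3 → ℝ) 2 • v 2 := by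
        simp [edge]; module
      rw [this]
      refine ⟨?_, fun j => ?_⟩ <;> rw [lam_combo v hv _ (by simp)]
      · simp
      · fin_cases j <;> simp <;> linarith
    · have : (fun t : ℝ => v (1 + 1) + t • edge v 1) t =
          (![t, 0, 1 - t] : Fin 3 → ℝ) 0 • v 0 + (![t, 0, 1 - t] : Fin 3 → ℝ) 1 • v 1 +
          (![t, 0, 1 - t] : Fin 3 → ℝ) 2 • v 2 := by
        simp [edge, e2, e3]; module
      rw [this]
      refine ⟨?_, fun j => ?_⟩ <;> rw [lam_combo v hv _ (by simp)]
      · simp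
      · fin_cases j <;> simp <;> linarith
    · have : (fun t : ℝ => v (2 + 1) + t • edge v 2) t =
          (![1 - t, t, 0] : Fin 3 → ℝ) 0 • v 0 + (![1 - t, t, 0] : Fin 3 → ℝ) 1 • v 1 +
          (![1 - t, t, 0] : Fin 3 → ℝ) 2 • v 2 := by
        simp [edge, e0, e1]; module
      rw [this]
      refine ⟨?_, fun j => ?_⟩ <;> rw [lam_combo v hv _ (by simp)]
      · simp
      · fin_cases j <;> simp <;> linarith

/-! ### Integrals over triangles and their sides -/

lemma hasFDerivAt_affine (a u w q : Plane) :
    HasFDerivAt (fun q : Plane => a + q 0 • u + q 1 • w)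
      ((EuclideanSpace.proj (0 : Fin 2) : Plane →L[ℝ] ℝ).smulRight u +
        (EuclideanSpace.proj (1 : Fin 2) : Plane →L[ℝ] ℝ).smulRight w) q := by
  have h := (((EuclideanSpace.proj (0 : Fin 2) : Plane →L[ℝ] ℝ).smulRight u +
        (EuclideanSpace.proj (1 : Fin 2) : Plane →L[ℝ] ℝ).smulRight w).hasFDerivAt
        (x := q)).const_add a
  refine h.congr_of_eventuallyEq (Filter.Eventually.of_forall fun x => ?_)
  simp [add_assoc]

lemma det_affine (u w : Plane) :
    ((EuclideanSpace.proj (0 : Fin 2) : Plane →L[ℝ] ℝ).smulRight u +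
        (EuclideanSpace.proj (1 : Fin 2) : Plane →L[ℝ] ℝ).smulRight w).det = cr u w := by
  rw [ContinuousLinearMap.det, ← LinearMap.det_toMatrix (EuclideanSpace.basisFun (Fin 2) ℝ).toBasis,
    Matrix.det_fin_two]
  simp [LinearMap.toMatrix_apply, cr]
  ring

lemma integral_plane (G : Plane → ℝ) : ∫ z, G z = ∫ p : ℝ × ℝ, G !₂[p.1, p.2] := by
  have h := (PiLp.volume_preserving_toLp (Fin 2)).comp ((volume_preserving_finTwoArrow ℝ).symm _)
  have he : MeasurableEmbedding (fun p : ℝ × ℝ => (!₂[p.1, p.2] : Plane)) :=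
    (MeasurableEquiv.toLp 2 (Fin 2 → ℝ)).measurableEmbedding.comp
      (MeasurableEquiv.finTwoArrow (α := ℝ)).symm.measurableEmbedding
  exact (MeasurePreserving.integral_comp h he G).symm

lemma integral_affine (a : Plane) {u w : Plane} (h : cr u w ≠ 0) (G : Plane → ℝ) :
    ∫ z, G z = |cr u w| * ∫ p : ℝ × ℝ, G (a + p.1 • u + p.2 • w) := by
  have hi := integral_image_eq_integral_abs_det_fderiv_smul volume MeasurableSet.univ
    (fun x _ => (hasFDerivAt_affine a u w x).hasFDerivWithinAt) ?_ G
  · rw [show (fun q : Plane => a + q 0 • u + q 1 • w) '' univ = univ from ?_] at hi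
    · simp only [Measure.restrict_univ, det_affine, smul_eq_mul] at hi
      rw [hi, integral_const_mul, integral_plane]
      simp
    · rw [image_univ, Set.range_eq_univ]
      intro z
      -- Cramer's rule gives the preimage.
      refine ⟨!₂[cr (z - a) w / cr u w, cr u (z - a) / cr u w], ?_⟩
      apply plane_ext <;>
      · simp only [cr, PiLp.add_apply, PiLp.smul_apply, smul_eq_mul, Matrix.cons_val_zero,
          Matrix.cons_val_one, PiLp.sub_apply] at h ⊢
        generalize hD : u 0 * w 1 - u 1 * w 0 = D at h ⊢
        field_simp
        rw [← hD]
        ring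
  · intro x _ y _ hxy
    have e0 := congrArg (fun z : Plane => z 0) hxy
    have e1 := congrArg (fun z : Plane => z 1) hxy
    simp only [PiLp.add_apply, PiLp.smul_apply, smul_eq_mul] at e0 e1
    have k0 : cr u w * (x 0 - y 0) = 0 := by unfold cr; linear_combination w 1 * e0 - w 0 * e1
    have k1 : cr u w * (x 1 - y 1) = 0 := by unfold cr; linear_combination u 0 * e1 - u 1 * e0
    exact plane_ext (sub_eq_zero.1 ((mul_eq_zero.1 k0).resolve_left h))
      (sub_eq_zero.1 ((mul_eq_zero.1 k1).resolve_left h))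

/-- The open reference triangle. -/
def refTri : Set (ℝ × ℝ) := {p | 0 < p.1 ∧ 0 < p.2 ∧ p.1 + p.2 < 1}

lemma isOpen_refTri : IsOpen refTri := by
  have : refTri = {p : ℝ × ℝ | 0 < p.1} ∩ ({p | 0 < p.2} ∩ {p | p.1 + p.2 < 1}) := rfl
  rw [this]
  exact (isOpen_lt continuous_const continuous_fst).inter
    ((isOpen_lt continuous_const continuous_snd).inter
      (isOpen_lt (continuous_fst.add continuous_snd) continuous_const))

lemma integrableOn_refTri {H : ℝ × ℝ → ℝ} (hH : Continuous H) : IntegrableOn H refTri := by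
  refine (hH.continuousOn.integrableOn_compact (K := Icc 0 1 ×ˢ Icc 0 1)
    (isCompact_Icc.prod isCompact_Icc)).mono_set fun p hp => ?_
  obtain ⟨h1, h2, h3⟩ := hp
  exact ⟨⟨h1.le, by linarith⟩, ⟨h2.le, by linarith⟩⟩

lemma integral_refTri {H : ℝ × ℝ → ℝ} (hH : Continuous H) :
    ∫ p in refTri, H p = ∫ s in (0 : ℝ)..1, ∫ t in (0 : ℝ)..(1 - s), H (s, t) := by
  rw [← integral_indicator isOpen_refTri.measurableSet, Measure.volume_eq_prod, integral_prod]
  · rw [intervalIntegral.integral_of_le zero_le_one, integral_Ioc_eq_integral_Ioo,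
      ← integral_indicator measurableSet_Ioo]
    congr 1
    ext s
    by_cases hs : s ∈ Ioo (0 : ℝ) 1
    · rw [indicator_of_mem hs, intervalIntegral.integral_of_le (by linarith [hs.2]),
        integral_Ioc_eq_integral_Ioo, ← integral_indicator measurableSet_Ioo]
      congr 1
      ext t
      by_cases ht : t ∈ Ioo 0 (1 - s)
      · rw [indicator_of_mem ht, indicator_of_mem]
        exact ⟨hs.1, ht.1, by linarith [ht.2]⟩
      · rw [indicator_of_notMem ht, indicator_of_notMem]
        rintro ⟨h1, h2, h3⟩
        exact ht ⟨h2, by simp at h3; linarith⟩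
    · rw [indicator_of_notMem hs]
      rw [← integral_zero ℝ ℝ]
      congr 1
      ext t
      rw [indicator_of_notMem]
      rintro ⟨h1, h2, h3⟩
      exact hs ⟨h1, by simp at h1 h2 h3; linarith⟩
  · rw [← Measure.volume_eq_prod, integrable_indicator_iff isOpen_refTri.measurableSet]
    exact integrableOn_refTri hH

lemma abs_cr_edge (v : Fin 3 → Plane) (k : Fin 3) :
    |cr (v k - v (k + 1)) (edge v k)| = |dtr v| ∧
    |cr (v k - v (k + 2)) (- edge v k)| = |dtr v| := by
  have e0 : (2 : Fin 3) + 1 = 0 := rfl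
  have e1 : (2 : Fin 3) + 2 = 1 := rfl
  have e2 : (1 : Fin 3) + 2 = 0 := rfl
  have e3 : (1 : Fin 3) + 1 = 2 := rfl
  obtain rfl | rfl | rfl : k = 0 ∨ k = 1 ∨ k = 2 := by fin_cases k <;> simp
  all_goals
    simp only [edge, e0, e1, e2, e3, zero_add]
    constructor
    · rw [abs_eq_abs]; right
      simp only [dtr, cr, PiLp.sub_apply]; ring
    · rw [abs_eq_abs]; left
      simp only [dtr, cr, PiLp.sub_apply, PiLp.neg_apply]; ring

lemma mem_tri_param {v : Fin 3 → Plane} (hv : AffineIndependent ℝ v) (k : Fin 3) (p : ℝ × ℝ) :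
    (v (k + 1) + p.1 • (v k - v (k + 1)) + p.2 • edge v k ∈ interior (convexHull ℝ (range v)) ↔
      p ∈ refTri) ∧
    (v (k + 2) + p.1 • (v k - v (k + 2)) + p.2 • (- edge v k) ∈ interior (convexHull ℝ (range v)) ↔
      p ∈ refTri) := by
  obtain ⟨s, t⟩ := p
  have e0 : (2 : Fin 3) + 1 = 0 := rfl
  have e1 : (2 : Fin 3) + 2 = 1 := rfl
  have e2 : (1 : Fin 3) + 2 = 0 := rfl
  have e3 : (1 : Fin 3) + 1 = 2 := rfl
  have key : ∀ (z : Plane) (c : Fin 3 → ℝ), c 0 + c 1 + c 2 = 1 →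
      c 0 • v 0 + c 1 • v 1 + c 2 • v 2 = z →
      (z ∈ interior (convexHull ℝ (range v)) ↔ 0 < c 0 ∧ 0 < c 1 ∧ 0 < c 2) := by
    rintro z c hc rfl
    rw [mem_tri hv]
    simp only [lam_combo v hv c hc, Fin.forall_fin_succ]
    simp
  obtain rfl | rfl | rfl : k = 0 ∨ k = 1 ∨ k = 2 := by fin_cases k <;> simp
  all_goals simp only [edge, e0, e1, e2, e3, zero_add, refTri, mem_ofPred_eq]
  · constructor
    · rw [key _ ![s, 1 - s - t, t] (by simp; try ring) (by simp; module)]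
      exact ⟨fun ⟨h1, h2, h3⟩ => by simp at h1 h2 h3; exact ⟨by linarith, by linarith, by linarith⟩,
        fun ⟨h1, h2, h3⟩ => by simp; exact ⟨by linarith, by linarith, by linarith⟩⟩
    · rw [key _ ![s, t, 1 - s - t] (by simp; try ring) (by simp; module)]
      exact ⟨fun ⟨h1, h2, h3⟩ => by simp at h1 h2 h3; exact ⟨by linarith, by linarith, by linarith⟩,
        fun ⟨h1, h2, h3⟩ => by simp; exact ⟨by linarith, by linarith, by linarith⟩⟩
  · constructor
    · rw [key _ ![t, s, 1 - s - t] (by simp; try ring) (by simp; module)]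
      exact ⟨fun ⟨h1, h2, h3⟩ => by simp at h1 h2 h3; exact ⟨by linarith, by linarith, by linarith⟩,
        fun ⟨h1, h2, h3⟩ => by simp; exact ⟨by linarith, by linarith, by linarith⟩⟩
    · rw [key _ ![1 - s - t, s, t] (by simp; try ring) (by simp; module)]
      exact ⟨fun ⟨h1, h2, h3⟩ => by simp at h1 h2 h3; exact ⟨by linarith, by linarith, by linarith⟩,
        fun ⟨h1, h2, h3⟩ => by simp; exact ⟨by linarith, by linarith, by linarith⟩⟩
  · constructor
    · rw [key _ ![1 - s - t, t, s] (by simp; try ring) (by simp; module)]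
      exact ⟨fun ⟨h1, h2, h3⟩ => by simp at h1 h2 h3; exact ⟨by linarith, by linarith, by linarith⟩,
        fun ⟨h1, h2, h3⟩ => by simp; exact ⟨by linarith, by linarith, by linarith⟩⟩
    · rw [key _ ![t, 1 - s - t, s] (by simp; try ring) (by simp; module)]
      exact ⟨fun ⟨h1, h2, h3⟩ => by simp at h1 h2 h3; exact ⟨by linarith, by linarith, by linarith⟩,
        fun ⟨h1, h2, h3⟩ => by simp; exact ⟨by linarith, by linarith, by linarith⟩⟩

/-- Integration over a triangle in affine coordinates adapted to the side `k`. -/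
lemma integral_tri {v : Fin 3 → Plane} (hv : AffineIndependent ℝ v) (k : Fin 3) {F : Plane → ℝ}
    (hF : Continuous F) :
    ∫ z in interior (convexHull ℝ (range v)), F z = |dtr v| * ∫ s in (0 : ℝ)..1,
      ∫ t in (0 : ℝ)..(1 - s), F (v (k + 1) + s • (v k - v (k + 1)) + t • edge v k) := by
  have hD := abs_pos.2 (dtr_ne_zero hv)
  have hne : cr (v k - v (k + 1)) (edge v k) ≠ 0 := by
    rw [← abs_pos, (abs_cr_edge v k).1]; exact hD
  rw [← integral_indicator isOpen_interior.measurableSet, integral_affine (v (k + 1)) hne,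
    (abs_cr_edge v k).1,
    ← integral_refTri (H := fun p => F (v (k + 1) + p.1 • (v k - v (k + 1)) + p.2 • edge v k))
      (by fun_prop), ← integral_indicator isOpen_refTri.measurableSet]
  congr 2
  ext p
  by_cases hp : p ∈ refTri
  · rw [indicator_of_mem hp, indicator_of_mem ((mem_tri_param hv k p).1.2 hp)]
  · rw [indicator_of_notMem hp, indicator_of_notMem (mt (mem_tri_param hv k p).1.1 hp)]

/-- The same integral, swept from the other end point of the side. The trace inequality treats the
two halves of a side separately and needs both parametrisations. -/
lemma integral_tri' {v : Fin 3 → Plane} (hv : AffineIndependent ℝ v) (k : Fin 3) {F : Plane → ℝ}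
    (hF : Continuous F) :
    ∫ z in interior (convexHull ℝ (range v)), F z = |dtr v| * ∫ s in (0 : ℝ)..1,
      ∫ t in (0 : ℝ)..(1 - s), F (v (k + 2) + s • (v k - v (k + 2)) + t • (- edge v k)) := by
  have hD := abs_pos.2 (dtr_ne_zero hv)
  have hne : cr (v k - v (k + 2)) (- edge v k) ≠ 0 := by
    rw [← abs_pos, (abs_cr_edge v k).2]; exact hD
  rw [← integral_indicator isOpen_interior.measurableSet, integral_affine (v (k + 2)) hne,
    (abs_cr_edge v k).2,
    ← integral_refTri (H := fun p => F (v (k + 2) + p.1 • (v k - v (k + 2)) + p.2 • (- edge v k)))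
      (by fun_prop), ← integral_indicator isOpen_refTri.measurableSet]
  congr 2
  ext p
  by_cases hp : p ∈ refTri
  · rw [indicator_of_mem hp, indicator_of_mem ((mem_tri_param hv k p).2.2 hp)]
  · rw [indicator_of_notMem hp, indicator_of_notMem (mt (mem_tri_param hv k p).2.1 hp)]

/-- The mean value of a function on the `k`-th side. -/
def sideMean (v : Fin 3 → Plane) (k : Fin 3) (F : Plane → ℝ) : ℝ :=
  ∫ t in (0 : ℝ)..1, F (v (k + 1) + t • edge v k)

/-- The fundamental theorem of calculus on the segments parallel to the side `k`, which run from the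
side `k + 2` (`t = 0`) to the side `k + 1` (`t = 1 - s`). -/
lemma integral_fderiv_edge {v : Fin 3 → Plane} (hv : AffineIndependent ℝ v) (k : Fin 3)
    {F : Plane → ℝ} (hF : ContDiff ℝ 1 F) :
    ∫ z in interior (convexHull ℝ (range v)), fderiv ℝ F z (edge v k) =
      |dtr v| * (sideMean v (k + 1) F - sideMean v (k + 2) F) := by
  have hc : Continuous fun z => fderiv ℝ F z (edge v k) :=
    (hF.continuous_fderiv one_ne_zero).clm_apply continuous_const
  have hFc := hF.continuous
  rw [integral_tri hv k hc]
  congr 1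
  have hin : ∀ s : ℝ, ∫ t in (0 : ℝ)..(1 - s),
      fderiv ℝ F (v (k + 1) + s • (v k - v (k + 1)) + t • edge v k) (edge v k) =
      F (v (k + 1) + s • (v k - v (k + 1)) + (1 - s) • edge v k) -
        F (v (k + 1) + s • (v k - v (k + 1))) := by
    intro s
    have h := intervalIntegral.integral_eq_sub_of_hasDerivAt (a := 0) (b := 1 - s)
      (f := fun t : ℝ => F (v (k + 1) + s • (v k - v (k + 1)) + t • edge v k))
      (f' := fun t => fderiv ℝ F (v (k + 1) + s • (v k - v (k + 1)) + t • edge v k) (edge v k))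
      (fun t _ => ?_) ?_
    · rw [h]; simp
    · have h1 := (hF.differentiable one_ne_zero
        (v (k + 1) + s • (v k - v (k + 1)) + t • edge v k)).hasFDerivAt
      have h2 : HasDerivAt (fun t : ℝ => v (k + 1) + s • (v k - v (k + 1)) + t • edge v k)
          (edge v k) t := by
        simpa using ((hasDerivAt_id t).smul_const (edge v k)).const_add
            (v (k + 1) + s • (v k - v (k + 1)))
      exact h1.comp_hasDerivAt t h2
    · exact (hc.comp (by fun_prop)).intervalIntegrable _ _
  simp_rw [hin]
  rw [intervalIntegral.integral_sub]
  · have a1 : (k + 1 + 1 : Fin 3) = k + 2 := by rw [add_assoc]; rfl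
    have a2 : (k + 1 + 2 : Fin 3) = k := by rw [add_assoc]; exact add_zero k
    have a3 : (k + 2 + 1 : Fin 3) = k := by rw [add_assoc]; exact add_zero k
    have a4 : (k + 2 + 2 : Fin 3) = k + 1 := by rw [add_assoc]; rfl
    congr 1
    · have he : edge v (k + 1) = v k - v (k + 2) := by rw [edge, a1, a2]
      rw [sideMean, a1, he]
      congr 1
      ext s
      congr 1
      rw [edge]; module
    · have he : edge v (k + 2) = v (k + 1) - v k := by rw [edge, a3, a4]
      rw [sideMean, a3, he]
      have := intervalIntegral.integral_comp_sub_left (a := 0) (b := 1)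
        (fun t : ℝ => F (v k + t • (v (k + 1) - v k))) 1
      simp only [sub_self, sub_zero] at this
      rw [← this]
      congr 1
      ext s
      congr 1
      module
  · exact (hFc.comp (by fun_prop)).intervalIntegrable _ _
  · exact (hFc.comp (by fun_prop)).intervalIntegrable _ _

lemma nrm_inner_mul (v : Fin 3 → Plane) (hv : AffineIndependent ℝ v) (k : Fin 3) (d : Plane) :
    ‖edge v k‖ * inner ℝ d (nrm v k) = dtr v / |dtr v| * cr d (edge v k) := by
  have he := norm_pos_iff.2 (edge_ne_zero hv k)
  rw [nrm, inner_smul_right, inner_plane]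
  simp only [cr, Matrix.cons_val_zero, Matrix.cons_val_one]
  field_simp
  ring

/-- The divergence theorem on a triangle, in terms of means over the sides. -/
lemma integral_fderiv_tri {v : Fin 3 → Plane} (hv : AffineIndependent ℝ v) {F : Plane → ℝ}
    (hF : ContDiff ℝ 1 F) (d : Plane) :
    ∫ z in interior (convexHull ℝ (range v)), fderiv ℝ F z d =
      ∑ k, ‖edge v k‖ * inner ℝ d (nrm v k) * sideMean v k F := by
  have hD := dtr_ne_zero hv
  have hint : ∀ e : Plane, IntegrableOn (fun z => fderiv ℝ F z e)
      (interior (convexHull ℝ (range v))) := fun e => by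
    refine (((hF.continuous_fderiv one_ne_zero).clm_apply
      continuous_const).continuousOn.integrableOn_compact
      ((finite_range v).isCompact_convexHull ℝ)).mono_set interior_subset
  -- Every direction is a combination of two edges, so two instances of `integral_fderiv_edge`
  -- suffice.
  have hd : dtr v • d = cr d (edge v 2) • edge v 1 + cr (edge v 1) d • edge v 2 := by
    have e2 : (1 : Fin 3) + 2 = 0 := rfl
    have e3 : (1 : Fin 3) + 1 = 2 := rfl
    have e0 : (2 : Fin 3) + 1 = 0 := rfl
    have e1 : (2 : Fin 3) + 2 = 1 := rfl
    apply plane_ext <;>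
    · simp only [dtr, cr, edge, e0, e1, e2, e3, PiLp.sub_apply, PiLp.smul_apply, smul_eq_mul,
        PiLp.add_apply]
      ring
  have h1 : dtr v * ∫ z in interior (convexHull ℝ (range v)), fderiv ℝ F z d =
      cr d (edge v 2) * (|dtr v| * (sideMean v 2 F - sideMean v 0 F)) +
      cr (edge v 1) d * (|dtr v| * (sideMean v 0 F - sideMean v 1 F)) := by
    have i1 := integral_fderiv_edge hv 1 hF
    have i2 := integral_fderiv_edge hv 2 hF
    rw [show (1 : Fin 3) + 1 = 2 from rfl, show (1 : Fin 3) + 2 = 0 from rfl] at i1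
    rw [show (2 : Fin 3) + 1 = 0 from rfl, show (2 : Fin 3) + 2 = 1 from rfl] at i2
    rw [← i1, ← i2, ← integral_const_mul, ← integral_const_mul, ← integral_const_mul,
      ← integral_add ((hint _).const_mul _) ((hint _).const_mul _)]
    congr 1
    ext z
    have := congrArg (fderiv ℝ F z) hd
    simpa using this
  -- The edges sum to zero, so the two contributions of the side `0` merge into the flux through it.
  have h2 : cr (edge v 1) d - cr d (edge v 2) = cr d (edge v 0) := by
    have e2 : (1 : Fin 3) + 2 = 0 := rfl
    have e3 : (1 : Fin 3) + 1 = 2 := rfl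
    have e0 : (2 : Fin 3) + 1 = 0 := rfl
    have e1 : (2 : Fin 3) + 2 = 1 := rfl
    simp only [cr, edge, e0, e1, e2, e3, zero_add, PiLp.sub_apply]; ring
  have h3 : cr (edge v 1) d = - cr d (edge v 1) := by simp only [cr]; ring
  rw [← mul_right_inj' hD, h1, Fin.sum_univ_three]
  simp only [nrm_inner_mul v hv]
  have h4 : dtr v * (dtr v / |dtr v|) = |dtr v| := by
    rw [mul_div_assoc', ← abs_mul_abs_self (dtr v), mul_div_assoc,
      div_self (abs_pos.2 hD).ne', mul_one]
  have h6 : dtr v * (dtr v / |dtr v| * cr d (edge v 0) * sideMean v 0 F +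
      dtr v / |dtr v| * cr d (edge v 1) * sideMean v 1 F +
      dtr v / |dtr v| * cr d (edge v 2) * sideMean v 2 F) =
      (dtr v * (dtr v / |dtr v|)) * (cr d (edge v 0) * sideMean v 0 F +
      cr d (edge v 1) * sideMean v 1 F + cr d (edge v 2) * sideMean v 2 F) := by ring
  rw [h6, h4]
  linear_combination |dtr v| * sideMean v 0 F * h2 - |dtr v| * sideMean v 1 F * h3

/-- The measure `ds` on a segment. -/
lemma integral_segment (p e : Plane) (he : e ≠ 0) (F : Plane → ℝ) :
    ∫ z in (fun t : ℝ => p + t • e) '' Icc 0 1, F z ∂μH[1] =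
      ‖e‖ * ∫ t in (0 : ℝ)..1, F (p + t • e) := by
  have hn := norm_pos_iff.2 he
  -- Arc length parametrises the line isometrically, so it carries Lebesgue measure to the
  -- one-dimensional Hausdorff measure.
  set ψ : ℝ → Plane := fun s => p + s • (‖e‖⁻¹ • e) with hψ
  have hiso : Isometry ψ := Isometry.of_dist_eq fun s t => by
    rw [hψ, dist_add_left, dist_eq_norm, ← sub_smul, norm_smul, norm_smul, norm_inv, norm_norm,
      inv_mul_cancel₀ hn.ne', mul_one, dist_eq_norm]
  have himg : (fun t : ℝ => p + t • e) '' Icc 0 1 = ψ '' Icc 0 ‖e‖ := by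
    ext z
    constructor
    · rintro ⟨t, ht, rfl⟩
      refine ⟨t * ‖e‖, ⟨mul_nonneg ht.1 hn.le, by nlinarith [ht.2]⟩, ?_⟩
      simp only [hψ, smul_smul]
      rw [mul_assoc, mul_inv_cancel₀ hn.ne', mul_one]
    · rintro ⟨s, hs, rfl⟩
      refine ⟨s / ‖e‖, ⟨div_nonneg hs.1 hn.le, (div_le_one hn).2 hs.2⟩, ?_⟩
      simp only [hψ, smul_smul]
      rfl
  have hemb : MeasurableEmbedding ψ := hiso.isClosedEmbedding.measurableEmbedding
  have hmap : Measure.map ψ volume = μH[1].restrict (range ψ) := by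
    rw [← hausdorffMeasure_real, hiso.map_hausdorffMeasure (Or.inl zero_le_one)]
  have h1 : (μH[1] : Measure Plane).restrict (ψ '' Icc 0 ‖e‖) =
      (Measure.map ψ volume).restrict (ψ '' Icc 0 ‖e‖) := by
    rw [hmap, Measure.restrict_restrict (hemb.measurableSet_image.2 measurableSet_Icc),
      inter_eq_left.2 (image_subset_range _ _)]
  rw [himg, h1, hemb.setIntegral_map, preimage_image_eq _ hiso.injective,
    integral_Icc_eq_integral_Ioc, ← intervalIntegral.integral_of_le hn.le]
  have := intervalIntegral.smul_integral_comp_mul_right (a := 0) (b := 1)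
    (fun s => F (ψ s)) ‖e‖
  simp only [zero_mul, one_mul, smul_eq_mul] at this
  rw [← this]
  congr 2
  ext t
  simp only [hψ, smul_smul]
  rw [mul_assoc, mul_inv_cancel₀ hn.ne', mul_one]

lemma hausdorff_segment_lt_top (p e : Plane) :
    μH[1] ((fun t : ℝ => p + t • e) '' Icc 0 1) < ⊤ := by
  have : (fun t : ℝ => p + t • e) '' Icc 0 1 = segment ℝ p (p + e) := by
    rw [segment_eq_image']; simp
  rw [this, hausdorffMeasure_segment]
  exact edist_lt_top _ _

lemma integral_side {v : Fin 3 → Plane} (hv : AffineIndependent ℝ v) (k : Fin 3) (F : Plane → ℝ) :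
    ∫ z in side v k, F z ∂μH[1] = ‖edge v k‖ * sideMean v k F := by
  rw [side_eq_image hv, integral_segment _ _ (edge_ne_zero hv k)]; rfl

lemma hausdorff_side_lt_top {v : Fin 3 → Plane} (hv : AffineIndependent ℝ v) (k : Fin 3) :
    μH[1] (side v k) < ⊤ := by
  rw [side_eq_image hv]; exact hausdorff_segment_lt_top _ _

lemma hausdorff_frontier_tri_lt_top {v : Fin 3 → Plane} (hv : AffineIndependent ℝ v) :
    μH[1] (frontier (interior (convexHull ℝ (range v)))) < ⊤ := by
  rw [frontier_tri hv]
  exact (measure_iUnion_fintype_le _ _).trans_lt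
    (ENNReal.sum_lt_top.2 fun k _ => hausdorff_side_lt_top hv k)

/-- Since points are null, vertices and the other finitely many irregular points play no role in
skeleton integrals. -/
instance : NullSingletonClass (μH[1] : Measure Plane) :=
  Measure.nullSingletonClass_hausdorff _ one_pos

lemma integral_frontier_tri {v : Fin 3 → Plane} (hv : AffineIndependent ℝ v) {F : Plane → ℝ}
    (hF : IntegrableOn F (frontier (interior (convexHull ℝ (range v)))) μH[1]) :
    ∫ z in frontier (interior (convexHull ℝ (range v))), F z ∂μH[1] =
      ∑ k, ∫ z in side v k, F z ∂μH[1] := by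
  rw [frontier_tri hv] at hF ⊢
  rw [integral_iUnion_ae (fun k => (isClosed_side v k).measurableSet.nullMeasurableSet) _ hF,
    tsum_fintype]
  intro k l hkl
  refine measure_mono_null (fun z hz => mem_range_of_mem_sides hv hkl hz.1 hz.2) ?_
  exact (finite_range v).measure_zero _

lemma integrableOn_frontier_tri {v : Fin 3 → Plane} (hv : AffineIndependent ℝ v) {F : Plane → ℝ}
    (hF : Continuous F) :
    IntegrableOn F (frontier (interior (convexHull ℝ (range v)))) μH[1] := by
  have hK : IsCompact (frontier (interior (convexHull ℝ (range v)))) :=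
    ((finite_range v).isCompact_convexHull ℝ).of_isClosed_subset isClosed_frontier
      (frontier_subset_closure.trans (closure_tri hv).subset)
  obtain ⟨C, hC⟩ := hK.exists_bound_of_continuousOn hF.continuousOn
  exact Measure.integrableOn_of_bounded (hausdorff_frontier_tri_lt_top hv).ne
    hF.aestronglyMeasurable ((ae_restrict_iff' isClosed_frontier.measurableSet).2
      (Filter.Eventually.of_forall hC))

lemma outerNormal_tri_ae {v : Fin 3 → Plane} (hv : AffineIndependent ℝ v) (k : Fin 3) :
    ∀ᵐ z ∂((μH[1] : Measure Plane).restrict (side v k)),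
      outerNormal (interior (convexHull ℝ (range v))) z = nrm v k := by
  rw [ae_restrict_iff' (isClosed_side v k).measurableSet]
  have h0 : (μH[1] : Measure Plane) (range v) = 0 := (finite_range v).measure_zero _
  filter_upwards [measure_eq_zero_iff_ae_notMem.1 h0] with z hz hzk
  exact (isOuterNormal_tri hv hzk hz).outerNormal_eq

/-- The divergence theorem on a triangle. -/
theorem integral_pd_tri {v : Fin 3 → Plane} (hv : AffineIndependent ℝ v) {F : Plane → ℝ}
    (hF : ContDiff ℝ 1 F) (j : Fin 2)
    (hint : IntegrableOn (fun z => F z * outerNormal (interior (convexHull ℝ (range v))) z j)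
      (frontier (interior (convexHull ℝ (range v)))) μH[1]) :
    ∫ z in interior (convexHull ℝ (range v)), pd j F z =
      ∫ z in frontier (interior (convexHull ℝ (range v))),
        F z * outerNormal (interior (convexHull ℝ (range v))) z j ∂μH[1] := by
  rw [integral_frontier_tri hv hint]
  unfold pd
  rw [integral_fderiv_tri hv hF]
  refine Finset.sum_congr rfl fun k _ => ?_
  have : ∫ z in side v k, F z * outerNormal (interior (convexHull ℝ (range v))) z j ∂μH[1] =
      ∫ z in side v k, F z * nrm v k j ∂μH[1] := by
    refine integral_congr_ae ?_
    filter_upwards [outerNormal_tri_ae hv k] with z hz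
    rw [hz]
  rw [this, integral_mul_const, integral_side hv, EuclideanSpace.inner_single_left]
  simp; ring

/-! ### The trace inverse inequality for polynomials -/

section OneDim

open Polynomial

/-- The polynomial whose `n + 1`-st derivative represents evaluation at `0` on `P_n(0, 1)`. -/
def radau (n : ℕ) : ℝ[X] := X ^ n * (1 - X) ^ (n + 1)

lemma radau_eval_zero (n m : ℕ) (h : m < n) : (derivative^[m] (radau n)).eval 0 = 0 := by
  rw [← coeff_zero_eq_eval_zero, coeff_iterate_derivative, radau, coeff_X_pow_mul', if_neg (by omega)]
  simp

lemma radau_eval_zero' (n : ℕ) : (derivative^[n] (radau n)).eval 0 = n.factorial := by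
  rw [← coeff_zero_eq_eval_zero, coeff_iterate_derivative, radau, coeff_X_pow_mul',
    if_pos (by omega)]
  simp [Nat.descFactorial_self, coeff_zero_eq_eval_zero]

/-- The coefficient of `X ^ (n + 1)` in `radau n` is `-(n + 1)`. Up to the factor `-n!`, this value
is the squared norm of the kernel. -/
lemma radau_eval_zero'' (n : ℕ) :
    (derivative^[n + 1] (radau n)).eval 0 = - ((n + 1) * (n + 1) * n.factorial) := by
  rw [← coeff_zero_eq_eval_zero, coeff_iterate_derivative, radau, coeff_X_pow_mul',
    if_pos (by omega), show 0 + (n + 1) - n = 0 + 1 by omega]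
  have : ((1 - X : ℝ[X]) ^ (n + 1)).coeff (0 + 1) = - (n + 1) := by
    have := coeff_derivative ((1 - X : ℝ[X]) ^ (n + 1)) 0
    simp only [Nat.cast_zero, zero_add, mul_one] at this
    rw [zero_add, ← this, coeff_zero_eq_eval_zero, derivative_pow]
    simp
  rw [this, zero_add, Nat.descFactorial_self, Nat.factorial_succ]
  push_cast [nsmul_eq_mul]
  ring

lemma radau_eval_one (n m : ℕ) (h : m ≤ n) : (derivative^[m] (radau n)).eval 1 = 0 := by
  have h1 : (1 - X : ℝ[X]) ^ (n + 1) ∣ radau n := Dvd.intro_left _ rfl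
  have h2 := pow_sub_dvd_iterate_derivative_of_pow_dvd m h1
  obtain ⟨q, hq⟩ := (dvd_pow_self (1 - X : ℝ[X]) (by omega : n + 1 - m ≠ 0)).trans h2
  rw [hq]; simp

lemma integral_derivative_mul (f g : ℝ[X]) :
    ∫ x in (0 : ℝ)..1, f.derivative.eval x * g.eval x =
      f.eval 1 * g.eval 1 - f.eval 0 * g.eval 0 - ∫ x in (0 : ℝ)..1, f.eval x * g.derivative.eval x := by
  have := intervalIntegral.integral_mul_deriv_eq_deriv_mul (a := 0) (b := 1)
    (u := fun x => g.eval x) (v := fun x => f.eval x) (fun x _ => g.hasDerivAt x)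
    (fun x _ => f.hasDerivAt x) ((Polynomial.continuous _).intervalIntegrable _ _)
    ((Polynomial.continuous _).intervalIntegrable _ _)
  simp only [mul_comm (f.derivative.eval _), mul_comm (f.eval _)]
  exact this

/-- Each integration by parts moves one derivative to `s`. No boundary terms arise, because `radau
n` has zeros of order `n` at `0` and `n + 1` at `1`. -/
lemma integral_radau_mul_eq_zero (n m : ℕ) (hm : m ≤ n) (s : ℝ[X])
    (hs : derivative^[m] s = 0) :
    ∫ x in (0 : ℝ)..1, (derivative^[m] (radau n)).eval x * s.eval x = 0 := by
  induction m generalizing s with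
  | zero => simp at hs; simp [hs]
  | succ m ih =>
    rw [Function.iterate_succ_apply', integral_derivative_mul, radau_eval_one n m (by omega),
      radau_eval_zero n m (by omega), ih (by omega) _ (by rwa [← Function.iterate_succ_apply])]
    simp

/-- The first integration by parts leaves the `n`-th derivative at `0` as the only boundary
contribution; the remaining integral is against `r'`, whose `n`-th derivative is zero. -/
lemma integral_radau_mul (n : ℕ) (r : ℝ[X]) (hr : r.natDegree ≤ n) :
    ∫ x in (0 : ℝ)..1, (derivative^[n + 1] (radau n)).eval x * r.eval x =
      - (n.factorial * r.eval 0) := by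
  rw [Function.iterate_succ_apply', integral_derivative_mul, radau_eval_one n n le_rfl,
    radau_eval_zero', integral_radau_mul_eq_zero n n le_rfl _ (by
      rw [← Function.iterate_succ_apply]; exact iterate_derivative_eq_zero (by omega))]
  simp

/-- The kernel has degree at most `n`, so the evaluation identity can be applied to the kernel
itself; this yields its norm. -/
lemma natDegree_radau (n : ℕ) : (derivative^[n + 1] (radau n)).natDegree ≤ n := by
  refine (natDegree_iterate_derivative _ _).trans ?_
  have h1 : (1 - X : ℝ[X]).natDegree ≤ 1 := by compute_degree
  have : (radau n).natDegree ≤ n + (n + 1) * 1 := by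
    refine (natDegree_mul_le).trans (add_le_add (natDegree_X_pow_le _) ?_)
    exact natDegree_pow_le_of_le _ h1
  omega

/-- The sharp inverse inequality for the value at an end point. -/
theorem eval_zero_sq_le (n : ℕ) (r : ℝ[X]) (hr : r.natDegree ≤ n) :
    r.eval 0 ^ 2 ≤ (n + 1) ^ 2 * ∫ x in (0 : ℝ)..1, r.eval x ^ 2 := by
  set K := derivative^[n + 1] (radau n) with hK
  have hf : (0 : ℝ) < n.factorial := by exact_mod_cast n.factorial_pos
  have h1 := integral_radau_mul n r hr
  have h2 := integral_radau_mul n K (natDegree_radau n)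
  rw [← hK] at h1 h2
  rw [radau_eval_zero''] at h2
  -- The minimiser of the quadratic `∫ (r + c K)²` in `c`: this is the Cauchy–Schwarz inequality for
  -- `r` and `K`.
  set c : ℝ := r.eval 0 / (n.factorial * (n + 1) ^ 2) with hc
  have h3 : 0 ≤ ∫ x in (0 : ℝ)..1, (r.eval x + c * K.eval x) ^ 2 :=
    intervalIntegral.integral_nonneg zero_le_one fun x _ => sq_nonneg _
  have h4 : ∫ x in (0 : ℝ)..1, (r.eval x + c * K.eval x) ^ 2 =
      (∫ x in (0 : ℝ)..1, r.eval x ^ 2) + 2 * c * (∫ x in (0 : ℝ)..1, K.eval x * r.eval x) +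
      c ^ 2 * ∫ x in (0 : ℝ)..1, K.eval x * K.eval x := by
    have ci : ∀ f : ℝ → ℝ, Continuous f → IntervalIntegrable f volume 0 1 :=
      fun f hf => hf.intervalIntegrable _ _
    rw [← intervalIntegral.integral_const_mul, ← intervalIntegral.integral_const_mul,
      ← intervalIntegral.integral_add, ← intervalIntegral.integral_add]
    · congr 1; ext x; ring
    all_goals apply ci; fun_prop
  rw [h4, h1, h2] at h3
  have h5 : 2 * c * -(n.factorial * r.eval 0) + c ^ 2 * -(n.factorial *
      -((n + 1) * (n + 1) * n.factorial)) = - (r.eval 0 ^ 2 / (n + 1) ^ 2) := by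
    rw [hc]; field_simp; ring
  have h6 : r.eval 0 ^ 2 / (n + 1) ^ 2 ≤ ∫ x in (0 : ℝ)..1, r.eval x ^ 2 := by linarith
  rw [div_le_iff₀ (by positivity)] at h6
  linarith

theorem eval_zero_sq_le_of_pos (n : ℕ) (r : ℝ[X]) (hr : r.natDegree ≤ n) {L : ℝ} (hL : 0 < L) :
    L * r.eval 0 ^ 2 ≤ (n + 1) ^ 2 * ∫ x in (0 : ℝ)..L, r.eval x ^ 2 := by
  have h := eval_zero_sq_le n (r.comp (C L * X)) (by
    refine natDegree_comp_le.trans ?_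
    have : (C L * X : ℝ[X]).natDegree ≤ 1 := by compute_degree
    nlinarith)
  simp only [eval_comp, eval_mul, eval_C, eval_X, mul_zero] at h
  have h2 := intervalIntegral.mul_integral_comp_mul_left (a := 0) (b := 1)
    (f := fun x => r.eval x ^ 2) L
  rw [mul_zero, mul_one] at h2
  rw [← h2]
  have h3 := mul_le_mul_of_nonneg_left h hL.le
  linarith

end OneDim

/-! ### Polynomials in two variables and their traces on triangles -/

/-- The function on the plane that a polynomial represents. -/
def pe (q : MvPolynomial (Fin 2) ℝ) (z : Plane) : ℝ := MvPolynomial.eval (fun k => z k) q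

lemma contDiff_pe (q : MvPolynomial (Fin 2) ℝ) : ContDiff ℝ ∞ (pe q) := by
  unfold pe
  induction q using MvPolynomial.induction_on with
  | C a => simpa using contDiff_const
  | add p q hp hq => simpa using hp.add hq
  | mul_X p i hp =>
    simp only [map_mul, MvPolynomial.eval_X]
    exact hp.mul (by fun_prop)

lemma continuous_pe (q : MvPolynomial (Fin 2) ℝ) : Continuous (pe q) := (contDiff_pe q).continuous

lemma differentiable_pe (q : MvPolynomial (Fin 2) ℝ) : Differentiable ℝ (pe q) :=
  (contDiff_pe q).differentiable (by simp)

lemma pd_mul {f g : Plane → ℝ} (hf : Differentiable ℝ f) (hg : Differentiable ℝ g) (j : Fin 2)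
    (z : Plane) : pd j (fun z => f z * g z) z = f z * pd j g z + pd j f z * g z := by
  unfold pd
  rw [fderiv_fun_mul (hf z) (hg z)]
  simp; ring

lemma pd_pe (j : Fin 2) (q : MvPolynomial (Fin 2) ℝ) (z : Plane) :
    pd j (pe q) z = pe (MvPolynomial.pderiv j q) z := by
  induction q using MvPolynomial.induction_on with
  | C a =>
    have : pe (MvPolynomial.C a) = fun _ => a := by ext; simp [pe]
    rw [this]; simp [pd, pe]
  | add p q hp hq =>
    have : pe (p + q) = pe p + pe q := by ext; simp [pe]
    rw [this]
    unfold pd at *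
    rw [fderiv_add (differentiable_pe p z) (differentiable_pe q z)]
    simp only [pe] at *
    simp [hp, hq]
  | mul_X p i hp =>
    have h1 : pe (p * MvPolynomial.X i) = fun z => pe p z * z i := by ext; simp [pe]
    have h2 : pd j (fun z : Plane => z i) z = if i = j then 1 else 0 := by
      have : fderiv ℝ (fun z : Plane => z i) z = EuclideanSpace.proj i :=
        (EuclideanSpace.proj (𝕜 := ℝ) i).fderiv
      unfold pd
      rw [this]
      simp
    rw [h1, pd_mul (differentiable_pe p) (by fun_prop), hp, h2]
    simp only [pe, Derivation.leibniz, smul_eq_mul, MvPolynomial.pderiv_X, map_add, map_mul,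
      MvPolynomial.eval_X, Pi.single_apply]
    by_cases hij : i = j <;> simp [hij, mul_comm]

/-- The restriction of a polynomial in two variables to a line. -/
lemma exists_line_polynomial (q : MvPolynomial (Fin 2) ℝ) (n : ℕ) (hq : q.totalDegree ≤ n)
    (a e : Plane) :
    ∃ r : Polynomial ℝ, r.natDegree ≤ n ∧ ∀ t : ℝ, r.eval t = pe q (a + t • e) := by
  refine ⟨MvPolynomial.aeval (fun i => Polynomial.C (a i) + Polynomial.C (e i) * Polynomial.X) q,
    ?_, fun t => ?_⟩
  · have := MvPolynomial.aeval_natDegree_le (n := 1) q hq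
      (fun i => Polynomial.C (a i) + Polynomial.C (e i) * Polynomial.X)
      (fun i => by compute_degree)
    simpa using this
  · rw [MvPolynomial.aeval_def, MvPolynomial.polynomial_eval_eval₂, pe, MvPolynomial.eval]
    simp only [MvPolynomial.coe_eval₂Hom]
    congr 1
    · ext x; simp
    · ext i; simp; ring

/-- One half of a side is controlled by the triangle spanned by the side and an inward direction. -/
lemma half_side_le (q : MvPolynomial (Fin 2) ℝ) (n : ℕ) (hq : q.totalDegree ≤ n)
    (a d e : Plane) :
    ∫ s in (0 : ℝ)..(1 / 2), pe q (a + s • d) ^ 2 ≤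
      2 * (n + 1) ^ 2 * ∫ s in (0 : ℝ)..1, ∫ t in (0 : ℝ)..(1 - s), pe q (a + s • d + t • e) ^ 2 := by
  have hc := continuous_pe q
  have hcont : Continuous fun s : ℝ => ∫ t in (0 : ℝ)..(1 - s), pe q (a + s • d + t • e) ^ 2 :=
    intervalIntegral.continuous_parametric_intervalIntegral_of_continuous
      (f := fun s t => pe q (a + s • d + t • e) ^ 2)
      ((hc.comp (by fun_prop : Continuous fun p : ℝ × ℝ => a + p.1 • d + p.2 • e)).pow 2)
      (by fun_prop)
  have h1 : ∫ s in (0 : ℝ)..(1 / 2), pe q (a + s • d) ^ 2 ≤ ∫ s in (0 : ℝ)..(1 / 2),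
      2 * (n + 1) ^ 2 * ∫ t in (0 : ℝ)..(1 - s), pe q (a + s • d + t • e) ^ 2 := by
    refine intervalIntegral.integral_mono_on (by norm_num)
      ((hc.comp (by fun_prop)).pow 2 |>.intervalIntegrable _ _)
      ((continuous_const.mul hcont).intervalIntegrable _ _) fun s hs => ?_
    obtain ⟨r, hr, hre⟩ := exists_line_polynomial q n hq (a + s • d) e
    -- The segment in direction `e` that starts at the parameter `s ≤ 1/2` has length `1 - s ≥ 1/2`,
    -- which costs a factor `2`.
    have h := eval_zero_sq_le_of_pos n r hr (L := 1 - s) (by linarith [hs.2])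
    simp only [hre, zero_smul, add_zero] at h
    nlinarith [hs.2, sq_nonneg (pe q (a + s • d))]
  refine h1.trans ?_
  rw [intervalIntegral.integral_const_mul]
  refine mul_le_mul_of_nonneg_left ?_ (by positivity)
  rw [← intervalIntegral.integral_add_adjacent_intervals (b := 1 / 2) (c := 1)
    (hcont.intervalIntegrable _ _) (hcont.intervalIntegrable _ _)]
  refine le_add_of_nonneg_right (intervalIntegral.integral_nonneg (by norm_num) fun s hs => ?_)
  exact intervalIntegral.integral_nonneg (by linarith [hs.2]) fun t _ => sq_nonneg _

/-- Each half of the side is swept into the triangle parallel to the side through the opposite end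
point, so that all segments have at least half of the full length. The two halves give `2 + 2 = 4`.
-/
lemma sideMean_sq_le {v : Fin 3 → Plane} (hv : AffineIndependent ℝ v) (m : Fin 3)
    (q : MvPolynomial (Fin 2) ℝ) (n : ℕ) (hq : q.totalDegree ≤ n) :
    |dtr v| * sideMean v m (fun z => pe q z ^ 2) ≤
      4 * (n + 1) ^ 2 * ∫ z in interior (convexHull ℝ (range v)), pe q z ^ 2 := by
  have hc := continuous_pe q
  have hc2 : Continuous fun z => pe q z ^ 2 := hc.pow 2
  have a1 : (m + 1 + 1 : Fin 3) = m + 2 := by rw [add_assoc]; rfl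
  have a2 : (m + 1 + 2 : Fin 3) = m := by rw [add_assoc]; exact add_zero m
  have a3 : (m + 2 + 1 : Fin 3) = m := by rw [add_assoc]; exact add_zero m
  have a4 : (m + 2 + 2 : Fin 3) = m + 1 := by rw [add_assoc]; rfl
  have i1 := integral_tri hv (m + 1) hc2
  have i2 := integral_tri' hv (m + 2) hc2
  rw [a1] at i1
  rw [a4] at i2
  have g1 := half_side_le q n hq (v (m + 2)) (v (m + 1) - v (m + 2)) (edge v (m + 1))
  have g2 := half_side_le q n hq (v (m + 1)) (v (m + 2) - v (m + 1)) (- edge v (m + 2))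
  have hm : sideMean v m (fun z => pe q z ^ 2) =
      (∫ s in (0 : ℝ)..(1 / 2), pe q (v (m + 1) + s • (v (m + 2) - v (m + 1))) ^ 2) +
      ∫ s in (0 : ℝ)..(1 / 2), pe q (v (m + 2) + s • (v (m + 1) - v (m + 2))) ^ 2 := by
    have hcc : Continuous fun t : ℝ => pe q (v (m + 1) + t • edge v m) ^ 2 :=
      (hc.comp (by fun_prop)).pow 2
    rw [sideMean, ← intervalIntegral.integral_add_adjacent_intervals (b := 1 / 2) (c := 1)
      (hcc.intervalIntegrable _ _) (hcc.intervalIntegrable _ _)]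
    congr 1
    have := intervalIntegral.integral_comp_sub_left (a := 0) (b := 1 / 2)
      (fun t : ℝ => pe q (v (m + 1) + t • edge v m) ^ 2) 1
    rw [show (1 : ℝ) - 1 / 2 = 1 / 2 by norm_num, sub_zero] at this
    rw [← this]
    congr 1
    ext s
    congr 2
    rw [edge]; module
  have hD := abs_pos.2 (dtr_ne_zero hv)
  rw [hm, mul_add]
  have k1 := mul_le_mul_of_nonneg_left g1 hD.le
  have k2 := mul_le_mul_of_nonneg_left g2 hD.le
  have k3 : |dtr v| * (2 * (n + 1) ^ 2 * ∫ s in (0 : ℝ)..1, ∫ t in (0 : ℝ)..(1 - s),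
      pe q (v (m + 2) + s • (v (m + 1) - v (m + 2)) + t • edge v (m + 1)) ^ 2) =
      2 * (n + 1) ^ 2 * ∫ z in interior (convexHull ℝ (range v)), pe q z ^ 2 := by
    rw [i1]; ring
  have k4 : |dtr v| * (2 * (n + 1) ^ 2 * ∫ s in (0 : ℝ)..1, ∫ t in (0 : ℝ)..(1 - s),
      pe q (v (m + 1) + s • (v (m + 2) - v (m + 1)) + t • (- edge v (m + 2))) ^ 2) =
      2 * (n + 1) ^ 2 * ∫ z in interior (convexHull ℝ (range v)), pe q z ^ 2 := by
    rw [i2]; ring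
  linarith

/-- A step of length `ρ / 2` along the outer normal stays in the disc and lowers `lam v k` by `‖edge
v k‖ / |dtr v| * (ρ / 2)`; this drop is at most `1`, as the coordinate lies between `0` and `1`. -/
lemma norm_edge_mul_le {v : Fin 3 → Plane} (hv : AffineIndependent ℝ v) (k : Fin 3) {c : Plane}
    {ρ : ℝ} (hρ : 0 < ρ) (hb : Metric.ball c ρ ⊆ interior (convexHull ℝ (range v))) :
    ρ * ‖edge v k‖ ≤ 2 * |dtr v| := by
  have hD := abs_pos.2 (dtr_ne_zero hv)
  have hw : c + (ρ / 2) • nrm v k ∈ Metric.ball c ρ := by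
    rw [Metric.mem_ball, dist_eq_norm, add_sub_cancel_left, norm_smul, norm_nrm hv,
      Real.norm_of_nonneg (by positivity)]
    linarith
  have h1 := (mem_tri hv).1 (hb hw) k
  have h2 : lam v k c ≤ 1 := by
    have h := (mem_tri hv).1 (hb (Metric.mem_ball_self hρ))
    have hs := sum_lam hv c
    have a0 := h 0
    have a1 := h 1
    have a2 := h 2
    fin_cases k <;> simp <;> linarith
  have h3 := lam_sub v hv k c (c + (ρ / 2) • nrm v k)
  rw [add_sub_cancel_left, inner_smul_left, real_inner_self_eq_norm_sq, norm_nrm hv] at h3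
  have h4 : ‖edge v k‖ / |dtr v| * (ρ / 2) ≤ 1 := by
    simp at h3; linarith
  rw [div_mul_eq_mul_div, div_le_one hD] at h4
  linarith

/-- The trace inverse inequality. -/
theorem integral_frontier_sq_le {v : Fin 3 → Plane} (hv : AffineIndependent ℝ v) {c : Plane}
    {ρ h σ : ℝ} (hρ : 0 < ρ) (hb : Metric.ball c ρ ⊆ interior (convexHull ℝ (range v)))
    (hh : 0 ≤ h) (hσ : h ≤ σ * ρ) (q : MvPolynomial (Fin 2) ℝ) (n : ℕ) (hq : q.totalDegree ≤ n) :
    h * ∫ z in frontier (interior (convexHull ℝ (range v))), pe q z ^ 2 ∂μH[1] ≤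
      24 * σ * (n + 1) ^ 2 * ∫ z in interior (convexHull ℝ (range v)), pe q z ^ 2 := by
  have hc2 : Continuous fun z => pe q z ^ 2 := (continuous_pe q).pow 2
  have hD := abs_pos.2 (dtr_ne_zero hv)
  rw [integral_frontier_tri hv (integrableOn_frontier_tri hv hc2), Finset.mul_sum]
  set I := ∫ z in interior (convexHull ℝ (range v)), pe q z ^ 2 with hI
  have hI0 : 0 ≤ I := integral_nonneg fun z => sq_nonneg _
  -- One side contributes `2 * 4 = 8`, from `norm_edge_mul_le` and `sideMean_sq_le`; the three sides
  -- give `24`.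
  have key : ∀ k, h * ∫ z in side v k, pe q z ^ 2 ∂μH[1] ≤ 8 * σ * (n + 1) ^ 2 * I := by
    intro k
    rw [integral_side hv]
    set m := sideMean v k (fun z => pe q z ^ 2)
    have hm : 0 ≤ m := intervalIntegral.integral_nonneg zero_le_one fun t _ => sq_nonneg _
    have h1 := sideMean_sq_le hv k q n hq
    have h2 := norm_edge_mul_le hv k hρ hb
    have hσ0 : 0 ≤ σ := nonneg_of_mul_nonneg_left (hh.trans hσ) hρ
    calc h * (‖edge v k‖ * m) ≤ σ * ρ * (‖edge v k‖ * m) :=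
          mul_le_mul_of_nonneg_right hσ (by positivity)
      _ = σ * m * (ρ * ‖edge v k‖) := by ring
      _ ≤ σ * m * (2 * |dtr v|) := mul_le_mul_of_nonneg_left h2 (by positivity)
      _ = 2 * σ * (|dtr v| * m) := by ring
      _ ≤ 2 * σ * (4 * (n + 1) ^ 2 * I) := mul_le_mul_of_nonneg_left h1 (by positivity)
      _ = _ := by ring
  rw [Fin.sum_univ_three]
  linarith [key 0, key 1, key 2]

/-! ### The mesh skeleton -/

lemma cr_sq_add_inner_sq (u v : Plane) : cr u v ^ 2 + inner ℝ u v ^ 2 = ‖u‖ ^ 2 * ‖v‖ ^ 2 := by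
  rw [inner_plane, norm_sq_plane, norm_sq_plane, cr]; ring

lemma eq_or_eq_neg_of_cr_eq_zero {n m : Plane} (hn : ‖n‖ = 1) (hm : ‖m‖ = 1) (h : cr n m = 0) :
    n = m ∨ n = -m := by
  have h1 := cr_sq_add_inner_sq n m
  rw [h, hn, hm] at h1
  have h2 : inner ℝ n m = 1 ∨ inner ℝ n m = -1 := by
    have h3 : (inner ℝ n m - 1) * (inner ℝ n m + 1) = 0 := by linarith
    rcases mul_eq_zero.1 h3 with h | h
    · left; linarith
    · right; linarith
  rcases h2 with h2 | h2
  · left; exact (inner_eq_one_iff_of_norm_eq_one (𝕜 := ℝ) hn hm).1 h2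
  · right
    exact (inner_eq_one_iff_of_norm_eq_one (𝕜 := ℝ) hn (by rwa [norm_neg])).1 (by rw [inner_neg_right, h2]; simp)

lemma inner_sub_eq_zero_of_mem_side {v : Fin 3 → Plane} (hv : AffineIndependent ℝ v) {k : Fin 3}
    {z w : Plane} (hz : z ∈ side v k) (hw : w ∈ side v k) : inner ℝ (w - z) (nrm v k) = 0 := by
  have h := lam_sub v hv k z w
  rw [hz.1, hw.1, sub_zero, eq_comm, neg_eq_zero] at h
  exact (mul_eq_zero.1 h).resolve_left (lam_rate_pos hv k).ne'

/-- Two lines with nonparallel normals meet in at most one point. With hanging nodes allowed, such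
crossings need not be vertices of every element that touches them. -/
lemma subsingleton_of_nonparallel {v v' : Fin 3 → Plane} (hv : AffineIndependent ℝ v)
    (hv' : AffineIndependent ℝ v') (k k' : Fin 3) :
    {z | z ∈ side v k ∧ z ∈ side v' k' ∧ nrm v k ≠ nrm v' k' ∧ nrm v k ≠ - nrm v' k'}.Subsingleton := by
  rintro z ⟨hz, hz', h1, h2⟩ w ⟨hw, hw', -, -⟩
  have e1 := inner_sub_eq_zero_of_mem_side hv hw hz
  have e2 := inner_sub_eq_zero_of_mem_side hv' hw' hz'
  have hc : cr (nrm v k) (nrm v' k') ≠ 0 := fun h => by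
    rcases eq_or_eq_neg_of_cr_eq_zero (norm_nrm hv k) (norm_nrm hv' k') h with h | h
    exacts [h1 h, h2 h]
  rw [inner_plane] at e1 e2
  simp only [PiLp.sub_apply] at e1 e2
  have k0 : cr (nrm v k) (nrm v' k') * (z 0 - w 0) = 0 := by
    unfold cr; linear_combination nrm v' k' 1 * e1 - nrm v k 1 * e2
  have k1 : cr (nrm v k) (nrm v' k') * (z 1 - w 1) = 0 := by
    unfold cr; linear_combination nrm v k 0 * e2 - nrm v' k' 0 * e1
  exact plane_ext (sub_eq_zero.1 ((mul_eq_zero.1 k0).resolve_left hc))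
    (sub_eq_zero.1 ((mul_eq_zero.1 k1).resolve_left hc))

namespace Triangulation

variable {Ω : Set Plane} (M : Triangulation Ω)

/-- The mesh skeleton `Γ`. -/
def skel : Set Plane := ⋃ i, frontier (M.elt i)

/-- The finitely many points at which the skeleton is not locally a line. -/
def exc : Set Plane :=
  (⋃ i, range (M.vert i)) ∪ ⋃ i, ⋃ k, ⋃ j, ⋃ l,
    {z | z ∈ side (M.vert i) k ∧ z ∈ side (M.vert j) l ∧
      nrm (M.vert i) k ≠ nrm (M.vert j) l ∧ nrm (M.vert i) k ≠ - nrm (M.vert j) l}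

lemma finite_exc : M.exc.Finite := by
  refine (finite_iUnion fun i => finite_range _).union ?_
  exact finite_iUnion fun i => finite_iUnion fun k => finite_iUnion fun j => finite_iUnion fun l =>
    (subsingleton_of_nonparallel (M.nondegenerate i) (M.nondegenerate j) k l).finite

lemma isOpen_elt (i : Fin M.N) : IsOpen (M.elt i) := isOpen_interior

lemma isClosed_skel : IsClosed M.skel := isClosed_iUnion_of_finite fun _ => isClosed_frontier

lemma measurableSet_skel : MeasurableSet M.skel := M.isClosed_skel.measurableSet

lemma hausdorff_skel_lt_top : μH[1] M.skel < ⊤ :=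
  (measure_iUnion_fintype_le _ _).trans_lt
    (ENNReal.sum_lt_top.2 fun i _ => hausdorff_frontier_tri_lt_top (M.nondegenerate i))

lemma elt_disjoint {i j : Fin M.N} (h : i ≠ j) : Disjoint (M.elt i) (M.elt j) := M.disjoint i j h

lemma closure_eq : closure Ω = ⋃ i, closure (M.elt i) := M.cover

lemma mem_around {i : Fin M.N} {z : Plane} : i ∈ M.around z ↔ z ∈ frontier (M.elt i) := by
  simp [around]

lemma closure_elt_subset (i : Fin M.N) : closure (M.elt i) ⊆ closure Ω := by
  rw [M.closure_eq]; exact subset_iUnion (fun i => closure (M.elt i)) i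

lemma elt_subset (hΩ : IsPolygonal Ω) (i : Fin M.N) : M.elt i ⊆ Ω := by
  exact (interior_maximal (subset_closure.trans (M.closure_elt_subset i)) (M.isOpen_elt i)).trans
    hΩ.regular.subset

lemma frontier_subset_skel (hΩ : IsPolygonal Ω) : frontier Ω ⊆ M.skel := by
  intro z hz
  have h1 : z ∈ closure Ω := frontier_subset_closure hz
  rw [M.closure_eq, mem_iUnion] at h1
  obtain ⟨i, hi⟩ := h1
  refine mem_iUnion.2 ⟨i, hi, fun h => hz.2 ?_⟩
  rw [interior_eq_iff_isOpen.2 (M.isOpen_elt i)] at h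
  rw [interior_eq_iff_isOpen.2 hΩ.isOpen]
  exact M.elt_subset hΩ i h

lemma notMem_elt_of_mem_closure {i j : Fin M.N} {z : Plane} (hz : z ∈ frontier (M.elt i)) :
    z ∉ M.elt j := by
  intro h
  by_cases hij : i = j
  · subst hij
    exact hz.2 (by rwa [interior_eq_iff_isOpen.2 (M.isOpen_elt i)])
  · obtain ⟨w, hw1, hw2⟩ := mem_closure_iff.1 (frontier_subset_closure hz) _ (M.isOpen_elt j) h
    exact (M.elt_disjoint hij).le_bot ⟨hw2, hw1⟩

/-- Away from the exceptional points, the elements are locally half-discs. -/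
lemma exists_half_disc {z : Plane} (hz : z ∉ M.exc) {i : Fin M.N} (hi : i ∈ M.around z) :
    ∃ k, z ∈ side (M.vert i) k ∧ IsOuterNormal (M.elt i) z (nrm (M.vert i) k) ∧
      ∃ r > 0, ∀ w ∈ Metric.ball z r,
      (w ∈ M.elt i ↔ inner ℝ (w - z) (nrm (M.vert i) k) < 0) ∧
      (w ∈ closure (M.elt i) ↔ inner ℝ (w - z) (nrm (M.vert i) k) ≤ 0) := by
  have h := M.mem_around.1 hi
  rw [elt, frontier_tri (M.nondegenerate i), mem_iUnion] at h
  obtain ⟨k, hk⟩ := h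
  have hr : z ∉ range (M.vert i) := fun h => hz (Or.inl (mem_iUnion.2 ⟨i, h⟩))
  exact ⟨k, hk, isOuterNormal_tri (M.nondegenerate i) hk hr,
    exists_ball_side (M.nondegenerate i) hk hr⟩

lemma nrm_eq_or {z : Plane} (hz : z ∉ M.exc) {i j : Fin M.N} {k l : Fin 3}
    (hi : z ∈ side (M.vert i) k) (hj : z ∈ side (M.vert j) l) :
    nrm (M.vert i) k = nrm (M.vert j) l ∨ nrm (M.vert i) k = - nrm (M.vert j) l := by
  by_contra h
  push Not at h
  exact hz (Or.inr (mem_iUnion.2 ⟨i, mem_iUnion.2 ⟨k, mem_iUnion.2 ⟨j, mem_iUnion.2 ⟨l,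
    hi, hj, h.1, h.2⟩⟩⟩⟩))

lemma smul_mem_ball {z n : Plane} (hn : ‖n‖ = 1) {r : ℝ} (hr : 0 < r) (c : ℝ) (hc : |c| ≤ 1) :
    z + (c * (r / 2)) • n ∈ Metric.ball z r := by
  rw [Metric.mem_ball, dist_eq_norm, add_sub_cancel_left, norm_smul, hn, mul_one, norm_mul,
    Real.norm_eq_abs, Real.norm_of_nonneg (by positivity)]
  nlinarith

/-- Two different elements at a regular point of the skeleton lie on opposite sides. -/
lemma outerNormal_neg {z : Plane} (hz : z ∉ M.exc) {i j : Fin M.N} (hij : i ≠ j)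
    (hi : i ∈ M.around z) (hj : j ∈ M.around z) :
    outerNormal (M.elt j) z = - outerNormal (M.elt i) z := by
  obtain ⟨k, hk, hn, r, hr, hb⟩ := M.exists_half_disc hz hi
  obtain ⟨l, hl, hm, r', hr', hb'⟩ := M.exists_half_disc hz hj
  rw [hn.outerNormal_eq, hm.outerNormal_eq]
  rcases M.nrm_eq_or hz hk hl with h | h
  -- With equal normals, a point slightly inside would lie in both of the disjoint elements.
  · exfalso
    have hmem := smul_mem_ball (z := z) hn.1 (lt_min hr hr') (-1) (by simp)
    set w := z + (-1 * (min r r' / 2)) • nrm (M.vert i) k with hw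
    have hin : inner ℝ (w - z) (nrm (M.vert i) k) < 0 := by
      rw [hw, add_sub_cancel_left, inner_smul_left, real_inner_self_eq_norm_sq, hn.1]
      have : 0 < min r r' := lt_min hr hr'
      simpa using this
    have h1 := (hb w (Metric.ball_subset_ball (min_le_left _ _) hmem)).1.2 hin
    have h2 := (hb' w (Metric.ball_subset_ball (min_le_right _ _) hmem)).1.2 (h ▸ hin)
    exact (M.elt_disjoint hij).le_bot ⟨h1, h2⟩
  · rw [h, neg_neg]

lemma norm_outerNormal_eq {z : Plane} (hz : z ∉ M.exc) {i : Fin M.N} (hi : i ∈ M.around z) :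
    ‖outerNormal (M.elt i) z‖ = 1 := by
  obtain ⟨k, hk, hn, -⟩ := M.exists_half_disc hz hi
  rw [hn.outerNormal_eq, hn.1]

/-- The structure of the skeleton at a regular point. -/
theorem skel_cases (hΩ : IsPolygonal Ω) {z : Plane} (hz : z ∈ M.skel) (hz' : z ∉ M.exc) :
    (∃ i, M.around z = {i} ∧ z ∈ frontier Ω ∧ outerNormal Ω z = outerNormal (M.elt i) z ∧
      ∃ k, outerNormal Ω z = nrm (M.vert i) k) ∨
    (∃ i j, i ≠ j ∧ M.around z = {i, j} ∧ z ∉ frontier Ω ∧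
      outerNormal (M.elt j) z = - outerNormal (M.elt i) z ∧
      (frontier (M.elt i) ∩ frontier (M.elt j)).Nontrivial ∧
      (frontier (M.elt j) ∩ frontier (M.elt i)).Nontrivial) := by
  obtain ⟨i, hi⟩ := mem_iUnion.1 hz
  have hia := M.mem_around.2 hi
  obtain ⟨k, hk, hn, r, hr, hb⟩ := M.exists_half_disc hz' hia
  by_cases hj : ∃ j ∈ M.around z, j ≠ i
  · right
    obtain ⟨j, hja, hji⟩ := hj
    obtain ⟨l, hl, hm, r', hr', hb'⟩ := M.exists_half_disc hz' hja
    have hnm := M.outerNormal_neg hz' hji.symm hia hja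
    have hnm' := hnm
    rw [hn.outerNormal_eq, hm.outerNormal_eq] at hnm'
    have hmin : 0 < min r r' := lt_min hr hr'
    -- A small tangential step from `z` gives a second common boundary point, so the two elements
    -- are adjacent in the sense of local quasi-uniformity.
    have hnt : (frontier (M.elt i) ∩ frontier (M.elt j)).Nontrivial := by
      set τ : Plane := !₂[- nrm (M.vert i) k 1, nrm (M.vert i) k 0] with hτ
      have hτn : ‖τ‖ = 1 := by
        rw [← sq_eq_sq₀ (norm_nonneg _) zero_le_one, ← hn.1, norm_sq_plane, norm_sq_plane, hτ]
        simp; ring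
      have hτi : inner ℝ τ (nrm (M.vert i) k) = 0 := by
        rw [inner_plane, hτ]; simp; ring
      have hmem := smul_mem_ball (z := z) hτn hmin 1 (by simp)
      set w := z + (1 * (min r r' / 2)) • τ with hw
      have hwi : inner ℝ (w - z) (nrm (M.vert i) k) = 0 := by
        rw [hw, add_sub_cancel_left, inner_smul_left, hτi]; simp
      have b1 := hb w (Metric.ball_subset_ball (min_le_left _ _) hmem)
      have b2 := hb' w (Metric.ball_subset_ball (min_le_right _ _) hmem)
      rw [hwi] at b1
      rw [hnm', inner_neg_right, hwi] at b2
      refine ⟨z, ⟨hi, M.mem_around.1 hja⟩, w, ⟨⟨b1.2.2 le_rfl, fun h => ?_⟩,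
        ⟨b2.2.2 (by simp), fun h => ?_⟩⟩, fun h => ?_⟩
      · exact lt_irrefl _ (b1.1.1 (interior_subset h))
      · simpa using b2.1.1 (interior_subset h)
      · have : (1 * (min r r' / 2)) • τ = 0 := by
          rw [hw] at h; exact left_eq_add.1 h
        rw [smul_eq_zero] at this
        rcases this with h | h
        · linarith
        · rw [h, norm_zero] at hτn; exact zero_ne_one hτn
    refine ⟨i, j, hji.symm, ?_, ?_, hnm, hnt, by rwa [inter_comm]⟩
    · ext a
      rw [Finset.mem_insert, Finset.mem_singleton]
      constructor
      · intro ha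
        by_contra hcon
        push Not at hcon
        -- A third element would have a normal opposite to both `n` and `-n`, which forces `n = 0`.
        have e1 := M.outerNormal_neg hz' hcon.1.symm hia ha
        have e2 := M.outerNormal_neg hz' hcon.2.symm hja ha
        rw [e1, hnm, neg_neg] at e2
        have e3 := M.norm_outerNormal_eq hz' hia
        have e4 : outerNormal (M.elt i) z = 0 := by
          rw [neg_eq_iff_add_eq_zero, ← two_smul ℝ, smul_eq_zero] at e2
          exact e2.resolve_left two_ne_zero
        rw [e4, norm_zero] at e3
        exact zero_ne_one e3
      · rintro (rfl | rfl) <;> assumption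
    · intro hf
      refine hf.2 ?_
      -- The two closed half-discs fill a disc inside the closure of `Ω`; as `Ω` is the interior of
      -- its closure, its centre is in `Ω`.
      rw [interior_eq_iff_isOpen.2 hΩ.isOpen, ← hΩ.regular, mem_interior_iff_mem_nhds]
      refine Filter.mem_of_superset (Metric.ball_mem_nhds z hmin) fun w hw => ?_
      have b1 := hb w (Metric.ball_subset_ball (min_le_left _ _) hw)
      have b2 := hb' w (Metric.ball_subset_ball (min_le_right _ _) hw)
      rw [hnm', inner_neg_right] at b2
      rcases le_total (inner ℝ (w - z) (nrm (M.vert i) k)) 0 with h | h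
      · exact M.closure_elt_subset i (b1.2.2 h)
      · exact M.closure_elt_subset j (b2.2.2 (by linarith))
  · left
    push Not at hj
    have har : M.around z = {i} := by
      ext a
      rw [Finset.mem_singleton]
      exact ⟨hj a, fun h => h ▸ hia⟩
    -- The other closed elements stay away from `z`, so near `z` the closure of `Ω` is that of the
    -- single element, a closed half-disc.
    have hfar : ∀ᶠ w in 𝓝 z, ∀ j, j ≠ i → w ∉ closure (M.elt j) := by
      rw [Filter.eventually_all]
      intro j
      by_cases hji : j = i
      · simp [hji]
      · have : z ∉ closure (M.elt j) := fun h =>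
          hji (hj j (M.mem_around.2 ⟨h, fun h' =>
            M.notMem_elt_of_mem_closure hi (interior_subset h')⟩))
        filter_upwards [isClosed_closure.isOpen_compl.mem_nhds this] with w hw _ using hw
    obtain ⟨r', hr', hb'⟩ := Metric.eventually_nhds_iff_ball.1 hfar
    have hmin : 0 < min r r' := lt_min hr hr'
    have hcl : ∀ w ∈ Metric.ball z (min r r'),
        (w ∈ closure Ω ↔ inner ℝ (w - z) (nrm (M.vert i) k) ≤ 0) := by
      intro w hw
      rw [← (hb w (Metric.ball_subset_ball (min_le_left _ _) hw)).2]
      constructor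
      · intro h
        rw [M.closure_eq, mem_iUnion] at h
        obtain ⟨j, hjw⟩ := h
        by_cases hji : j = i
        · exact hji ▸ hjw
        · exact absurd hjw (hb' w (Metric.ball_subset_ball (min_le_right _ _) hw) j hji)
      · exact fun h => M.closure_elt_subset i h
    have hΩn : IsOuterNormal Ω z (nrm (M.vert i) k) := by
      refine ⟨hn.1, min r r', hmin, fun w hw => ⟨fun h => ?_, fun h => ?_⟩⟩
      · have hle := (hcl w hw).1 (subset_closure h)
        refine lt_of_le_of_ne hle fun h0 => ?_
        -- A point of the open set `Ω` on the bounding line could be moved outwards within `Ω`,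
        -- hence out of the closed half-disc.
        have hopen : ∀ᶠ w' in 𝓝 w, w' ∈ Ω ∧ w' ∈ Metric.ball z (min r r') :=
          Filter.Eventually.and (hΩ.isOpen.mem_nhds h) (Metric.isOpen_ball.mem_nhds hw)
        have hc : Filter.Tendsto (fun ε : ℝ => w + ε • nrm (M.vert i) k) (𝓝[>] 0) (𝓝 w) := by
          have : Continuous fun ε : ℝ => w + ε • nrm (M.vert i) k := by fun_prop
          have := this.tendsto 0
          simp only [zero_smul, add_zero] at this
          exact this.mono_left nhdsWithin_le_nhds
        obtain ⟨ε, ⟨h1, h2⟩, hε⟩ := ((hc.eventually hopen).and self_mem_nhdsWithin).exists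
        have h3 := (hcl _ h2).1 (subset_closure h1)
        rw [add_sub_right_comm, inner_add_left, h0, inner_smul_left,
          real_inner_self_eq_norm_sq, hn.1] at h3
        simp at h3
        exact absurd hε (not_lt.2 h3)
      · exact M.elt_subset hΩ i ((hb w (Metric.ball_subset_ball (min_le_left _ _) hw)).1.2 h)
    exact ⟨i, har, hΩn.mem_frontier, by rw [hΩn.outerNormal_eq, hn.outerNormal_eq], k,
      hΩn.outerNormal_eq⟩

/-! ### Measurability and boundedness on the skeleton -/

/-- Off the vertices the normal is a finite sum of constants on the closed sides, and a countable
exceptional set does not affect measurability. -/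
lemma measurable_outerNormal_elt (i : Fin M.N) : Measurable (outerNormal (M.elt i)) := by
  have hv := M.nondegenerate i
  have hf : Measurable fun z : Plane =>
      ∑ k, (side (M.vert i) k).indicator (fun _ => nrm (M.vert i) k) z :=
    Finset.measurable_fun_sum _ fun k _ =>
      measurable_const.indicator (isClosed_side _ k).measurableSet
  refine hf.measurable_of_countable_ne ((finite_range (M.vert i)).countable.mono fun z hz => ?_)
  by_contra hr
  refine hz ?_
  by_cases hfr : z ∈ frontier (M.elt i)
  · have h := hfr
    rw [elt, frontier_tri hv, mem_iUnion] at h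
    obtain ⟨k, hk⟩ := h
    rw [elt, (isOuterNormal_tri hv hk hr).outerNormal_eq, Finset.sum_eq_single k]
    · rw [indicator_of_mem hk]
    · intro l _ hl
      exact indicator_of_notMem (fun h => hr (mem_range_of_mem_sides hv hl h hk)) _
    · simp
  · rw [outerNormal_of_notMem_frontier hfr]
    rw [elt, frontier_tri hv, mem_iUnion] at hfr
    push Not at hfr
    exact Finset.sum_eq_zero fun k _ => indicator_of_notMem (hfr k) _

lemma outerNormal_eq_zero_of_notMem_around {i : Fin M.N} {z : Plane} (h : i ∉ M.around z) :
    outerNormal (M.elt i) z = 0 :=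
  outerNormal_of_notMem_frontier (mt M.mem_around.2 h)

/-- At a regular point of `∂Ω` there is just one element, and its normal is that of `Ω`; hence the
sum of all element normals represents it. -/
lemma measurable_outerNormal {Ω : Set Plane} (M : Triangulation Ω) (hΩ : IsPolygonal Ω) : Measurable (outerNormal Ω) := by
  have hf : Measurable fun z : Plane =>
      (frontier Ω).indicator (fun z => ∑ i, outerNormal (M.elt i) z) z :=
    (Finset.measurable_fun_sum _ fun i _ => M.measurable_outerNormal_elt i).indicator
      isClosed_frontier.measurableSet
  refine hf.measurable_of_countable_ne (M.finite_exc.countable.mono fun z hz => ?_)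
  by_contra hr
  refine hz ?_
  by_cases hfr : z ∈ frontier Ω
  · rw [indicator_of_mem hfr]
    rcases M.skel_cases hΩ (M.frontier_subset_skel hΩ hfr) hr with ⟨i, ha, -, hn, -⟩ | ⟨i, j, -, -, h, -⟩
    · rw [hn, Finset.sum_eq_single i]
      · intro j _ hj
        exact M.outerNormal_eq_zero_of_notMem_around (by rw [ha]; simpa using hj)
      · simp
    · exact absurd hfr h
  · rw [indicator_of_notMem hfr, outerNormal_of_notMem_frontier hfr]

end Triangulation

lemma measurable_plane_apply (j : Fin 2) : Measurable fun z : Plane => z j :=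
  (by fun_prop : Continuous fun z : Plane => z j).measurable

/-! ### The parts of the boundary and the lower bound for `|n₁|` -/

section Boundary

variable {Ω : Set Plane}

lemma measurableSet_bdryEll (hΩ : IsPolygonal Ω) : MeasurableSet (bdryEll Ω) := by
  obtain ⟨M⟩ := hΩ.exists_triangulation
  have hn := fun j => (measurable_plane_apply j).comp (M.measurable_outerNormal hΩ)
  exact isClosed_frontier.measurableSet.inter ((hn 0) (measurableSet_singleton 0).compl)

lemma measurableSet_bdryIn (hΩ : IsPolygonal Ω) : MeasurableSet (bdryIn Ω) := by
  obtain ⟨M⟩ := hΩ.exists_triangulation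
  have hn := fun j => (measurable_plane_apply j).comp (M.measurable_outerNormal hΩ)
  exact isClosed_frontier.measurableSet.inter (((hn 0) (measurableSet_singleton 0)).inter
    (measurableSet_lt ((measurable_plane_apply 0).mul (hn 1)) measurable_const))

lemma measurableSet_bdryOut (hΩ : IsPolygonal Ω) : MeasurableSet (bdryOut Ω) := by
  obtain ⟨M⟩ := hΩ.exists_triangulation
  have hn := fun j => (measurable_plane_apply j).comp (M.measurable_outerNormal hΩ)
  exact isClosed_frontier.measurableSet.inter (((hn 0) (measurableSet_singleton 0)).inter
    (measurableSet_le measurable_const ((measurable_plane_apply 0).mul (hn 1))))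

lemma exists_pos_le_of_finite {s : Set ℝ} (hs : s.Finite) :
    ∃ ν > 0, ∀ x ∈ s, x ≠ 0 → ν ≤ |x| := by
  induction s, hs using Set.Finite.induction_on with
  | empty => exact ⟨1, one_pos, by simp⟩
  | @insert a s _ _ ih =>
    obtain ⟨ν, hν, h⟩ := ih
    by_cases ha : a = 0
    · refine ⟨ν, hν, fun x hx hx0 => ?_⟩
      rcases hx with rfl | hx
      · exact absurd ha hx0
      · exact h x hx hx0
    · refine ⟨min ν |a|, lt_min hν (abs_pos.2 ha), fun x hx hx0 => ?_⟩
      rcases hx with rfl | hx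
      · exact min_le_right _ _
      · exact (min_le_left _ _).trans (h x hx hx0)

/-- On the elliptic part of the boundary, `|n₁|` is bounded below. -/
lemma exists_lower_bound_normal (hΩ : IsPolygonal Ω) :
    ∃ ν > 0, ∀ᵐ z ∂(μH[1] : Measure Plane), z ∈ bdryEll Ω → ν ≤ |outerNormal Ω z 0| := by
  obtain ⟨M⟩ := hΩ.exists_triangulation
  -- The normals of one fixed triangulation have finitely many values, and every regular boundary
  -- normal is among them. Thus `ν` depends on `Ω` only and not on the mesh of the method.
  obtain ⟨ν, hν, h⟩ := exists_pos_le_of_finite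
    (finite_range fun p : Fin M.N × Fin 3 => nrm (M.vert p.1) p.2 0)
  refine ⟨ν, hν, ?_⟩
  filter_upwards [measure_eq_zero_iff_ae_notMem.1 (M.finite_exc.measure_zero μH[1])] with z hz hzb
  rcases M.skel_cases hΩ (M.frontier_subset_skel hΩ hzb.1) hz with
    ⟨i, -, -, -, k, hk⟩ | ⟨i, j, -, -, hf, -⟩
  · exact h _ ⟨(i, k), by rw [hk]⟩ hzb.2
  · exact absurd hzb.1 hf

end Boundary

namespace Triangulation

variable {Ω : Set Plane} (M : Triangulation Ω)

/-- Measurable functions that are bounded on the skeleton. -/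
def BddMeas (f : Plane → ℝ) : Prop := Measurable f ∧ ∃ C, ∀ z ∈ M.skel, |f z| ≤ C

variable {M}

namespace BddMeas

lemma const (c : ℝ) : M.BddMeas fun _ => c := ⟨measurable_const, |c|, fun _ _ => le_rfl⟩

lemma add {f g : Plane → ℝ} (hf : M.BddMeas f) (hg : M.BddMeas g) :
    M.BddMeas fun z => f z + g z := by
  obtain ⟨hf, C, hC⟩ := hf
  obtain ⟨hg, D, hD⟩ := hg
  exact ⟨hf.add hg, C + D, fun z hz => (abs_add_le _ _).trans (add_le_add (hC z hz) (hD z hz))⟩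

lemma mul {f g : Plane → ℝ} (hf : M.BddMeas f) (hg : M.BddMeas g) :
    M.BddMeas fun z => f z * g z := by
  obtain ⟨hf, C, hC⟩ := hf
  obtain ⟨hg, D, hD⟩ := hg
  refine ⟨hf.mul hg, C * D, fun z hz => ?_⟩
  rw [abs_mul]
  exact mul_le_mul (hC z hz) (hD z hz) (abs_nonneg _) ((abs_nonneg _).trans (hC z hz))

lemma neg {f : Plane → ℝ} (hf : M.BddMeas f) : M.BddMeas fun z => - f z := by
  obtain ⟨hf, C, hC⟩ := hf
  exact ⟨hf.neg, C, fun z hz => by rw [abs_neg]; exact hC z hz⟩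

lemma sub {f g : Plane → ℝ} (hf : M.BddMeas f) (hg : M.BddMeas g) :
    M.BddMeas fun z => f z - g z := by
  simpa [sub_eq_add_neg] using hf.add hg.neg

lemma abs {f : Plane → ℝ} (hf : M.BddMeas f) : M.BddMeas fun z => |f z| := by
  obtain ⟨hf, C, hC⟩ := hf
  exact ⟨hf.abs, C, fun z hz => by rw [abs_abs]; exact hC z hz⟩

lemma pow {f : Plane → ℝ} (hf : M.BddMeas f) (n : ℕ) : M.BddMeas fun z => f z ^ n := by
  induction n with
  | zero => simpa using const 1
  | succ n ih => simpa [pow_succ] using ih.mul hf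

lemma div_const {f : Plane → ℝ} (hf : M.BddMeas f) (c : ℝ) : M.BddMeas fun z => f z / c := by
  simpa [div_eq_mul_inv] using hf.mul (const c⁻¹)

lemma sum {ι : Type*} (s : Finset ι) {f : ι → Plane → ℝ} (hf : ∀ i, M.BddMeas (f i)) :
    M.BddMeas fun z => ∑ i ∈ s, f i z := by
  classical
  induction s using Finset.induction_on with
  | empty => simpa using const 0
  | insert a s ha ih => simpa [Finset.sum_insert ha] using (hf a).add ih

lemma indicator {f : Plane → ℝ} (hf : M.BddMeas f) {s : Set Plane} (hs : MeasurableSet s) :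
    M.BddMeas (s.indicator f) := by
  obtain ⟨hf, C, hC⟩ := hf
  refine ⟨hf.indicator hs, |C|, fun z hz => ?_⟩
  by_cases h : z ∈ s
  · rw [indicator_of_mem h]; exact (hC z hz).trans (le_abs_self _)
  · rw [indicator_of_notMem h, abs_zero]; exact abs_nonneg _

lemma integrableOn {f : Plane → ℝ} (hf : M.BddMeas f) {s : Set Plane} (hs : s ⊆ M.skel) :
    IntegrableOn f s μH[1] := by
  obtain ⟨hf, C, hC⟩ := hf
  have : IntegrableOn f M.skel μH[1] :=
    Measure.integrableOn_of_bounded M.hausdorff_skel_lt_top.ne hf.aestronglyMeasurable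
      ((ae_restrict_iff' M.measurableSet_skel).2 (Filter.Eventually.of_forall hC))
  exact this.mono_set hs

end BddMeas

lemma isCompact_skel : IsCompact M.skel :=
  isCompact_iUnion fun i => ((finite_range (M.vert i)).isCompact_convexHull ℝ).of_isClosed_subset
    isClosed_frontier (frontier_subset_closure.trans (closure_tri (M.nondegenerate i)).subset)

lemma bddMeas_of_continuous {f : Plane → ℝ} (hf : Continuous f) : M.BddMeas f := by
  obtain ⟨C, hC⟩ := M.isCompact_skel.exists_bound_of_continuousOn hf.continuousOn
  exact ⟨hf.measurable, C, hC⟩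

lemma bddMeas_pe (q : MvPolynomial (Fin 2) ℝ) : M.BddMeas (pe q) :=
  bddMeas_of_continuous (continuous_pe q)

lemma bddMeas_coord (j : Fin 2) : M.BddMeas fun z => z j := bddMeas_of_continuous (by fun_prop)

lemma abs_outerNormal_le (S : Set Plane) (z : Plane) (j : Fin 2) : |outerNormal S z j| ≤ 1 :=
  (PiLp.norm_apply_le (outerNormal S z) j).trans (norm_outerNormal_le S z)

lemma bddMeas_outerNormal_elt (i : Fin M.N) (j : Fin 2) :
    M.BddMeas fun z => outerNormal (M.elt i) z j :=
  ⟨(measurable_plane_apply j).comp (M.measurable_outerNormal_elt i), 1,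
    fun z _ => abs_outerNormal_le _ z j⟩

lemma bddMeas_outerNormal (hΩ : IsPolygonal Ω) (j : Fin 2) :
    M.BddMeas fun z => outerNormal Ω z j :=
  ⟨(measurable_plane_apply j).comp (M.measurable_outerNormal hΩ), 1,
    fun z _ => abs_outerNormal_le _ z j⟩

/-- The set of elements around a point takes finitely many values, each on a measurable set. This
covers cardinalities, mean mesh sizes and the penalty at once. -/
lemma bddMeas_around (Φ : Finset (Fin M.N) → ℝ) : M.BddMeas fun z => Φ (M.around z) := by
  constructor
  · let _ : MeasurableSpace (Finset (Fin M.N)) := ⊤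
    have h : Measurable M.around := by
      refine measurable_to_countable' fun S => ?_
      have : M.around ⁻¹' {S} = ⋂ i, {z | z ∈ frontier (M.elt i) ↔ i ∈ S} := by
        ext z
        simp [Finset.ext_iff, M.mem_around]
      rw [this]
      refine MeasurableSet.iInter fun i => ?_
      have hfr : MeasurableSet (frontier (M.elt i)) := isClosed_frontier.measurableSet
      by_cases hi : i ∈ S
      · simp only [hi, iff_true]; exact hfr
      · simp only [hi, iff_false]; exact hfr.compl
    exact measurable_from_top.comp h
  · exact ⟨∑ S, |Φ S|, fun z _ =>
      Finset.single_le_sum (f := fun S => |Φ S|) (fun _ _ => abs_nonneg _) (Finset.mem_univ _)⟩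

lemma bddMeas_sum_around {q : Fin M.N → Plane → ℝ} (hq : ∀ i, M.BddMeas (q i)) :
    M.BddMeas fun z => ∑ i ∈ M.around z, q i z := by
  classical
  have : (fun z => ∑ i ∈ M.around z, q i z) =
      fun z => ∑ i, (if i ∈ M.around z then (1 : ℝ) else 0) * q i z := by
    ext z
    simp
  rw [this]
  exact BddMeas.sum _ fun i => (bddMeas_around fun S => if i ∈ S then (1 : ℝ) else 0).mul (hq i)

lemma bddMeas_av {q : Fin M.N → Plane → ℝ} (hq : ∀ i, M.BddMeas (q i)) :
    M.BddMeas fun z => M.av (fun i => q i z) z := by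
  simp only [av, div_eq_mul_inv]
  exact (bddMeas_sum_around hq).mul (bddMeas_around fun S => ((S.card : ℝ))⁻¹)

lemma bddMeas_avg (w : M.Broken) : M.BddMeas (avg w) := bddMeas_av fun i => bddMeas_pe (w i)

lemma bddMeas_avgGrad (w : M.Broken) (j : Fin 2) : M.BddMeas fun z => avgGrad w z j :=
  bddMeas_avg (D j w)

lemma bddMeas_jump (w : M.Broken) (k : Fin 2) : M.BddMeas fun z => jump w z k :=
  bddMeas_sum_around fun i => (bddMeas_pe (w i)).mul (bddMeas_outerNormal_elt i k)

lemma bddMeas_jumpGrad₁ (w : M.Broken) (j : Fin 2) : M.BddMeas fun z => jumpGrad₁ w z j :=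
  bddMeas_jump (D j w) 0

lemma bddMeas_tau (Cτ : ℝ) (p : ℕ) : M.BddMeas (M.tau Cτ p) :=
  bddMeas_around fun S => Cτ * (p : ℝ) ^ 2 / ((∑ i ∈ S, M.h i) / S.card)

/-- Almost every point of the skeleton is regular. -/
lemma ae_regular : ∀ᵐ z ∂((μH[1] : Measure Plane).restrict M.skel), z ∈ M.skel ∧ z ∉ M.exc := by
  rw [ae_restrict_iff' M.measurableSet_skel]
  filter_upwards [measure_eq_zero_iff_ae_notMem.1 (M.finite_exc.measure_zero μH[1])] with z hz hzs
  exact ⟨hzs, hz⟩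

/-! ### Integrals of broken functions -/

/-- Elements not touching `z` contribute nothing, since their normal at `z` is `0` by default. The
sum thereby runs over a fixed index set and commutes with integration. -/
lemma sum_outerNormal (F : Fin M.N → ℝ) (z : Plane) (j : Fin 2) :
    ∑ i ∈ M.around z, F i * outerNormal (M.elt i) z j = ∑ i, F i * outerNormal (M.elt i) z j := by
  refine Finset.sum_subset (Finset.subset_univ _) fun i _ hi => ?_
  rw [M.outerNormal_eq_zero_of_notMem_around hi]; simp

/-- The elementwise divergence theorem. -/
theorem sum_integral_pd {F : Fin M.N → Plane → ℝ} (hF : ∀ i, ContDiff ℝ 1 (F i)) (j : Fin 2) :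
    ∑ i, ∫ z in M.elt i, pd j (F i) z =
      ∫ z in M.skel, ∑ i ∈ M.around z, F i z * outerNormal (M.elt i) z j ∂μH[1] := by
  have hb : ∀ i, M.BddMeas fun z => F i z * outerNormal (M.elt i) z j := fun i =>
    (bddMeas_of_continuous (hF i).continuous).mul (bddMeas_outerNormal_elt i j)
  simp only [fun z => sum_outerNormal (fun i => F i z) z j]
  rw [integral_finsetSum _ fun i _ => (hb i).integrableOn Subset.rfl]
  refine Finset.sum_congr rfl fun i _ => ?_
  have hsub : frontier (M.elt i) ⊆ M.skel := subset_iUnion (fun i => frontier (M.elt i)) i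
  rw [elt, integral_pd_tri (M.nondegenerate i) (hF i) j ((hb i).integrableOn hsub)]
  refine (setIntegral_eq_of_subset_of_forall_sdiff_eq_zero M.measurableSet_skel hsub
    fun z hz => ?_).symm
  have := outerNormal_of_notMem_frontier hz.2
  rw [elt] at this
  rw [this]; simp

lemma elt_ae_eq (hΩ : IsPolygonal Ω) : (Ω : Set Plane) =ᵐ[volume] ⋃ i, M.elt i := by
  have hnull : volume (⋃ i, frontier (M.elt i)) = 0 := by
    refine measure_iUnion_null fun i => ?_
    exact (Convex.interior (convex_convexHull ℝ _)).addHaar_frontier volume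
  refine Filter.EventuallyLE.antisymm ?_ ?_
  · filter_upwards [measure_eq_zero_iff_ae_notMem.1 hnull] with z hz hzΩ
    have h : z ∈ closure Ω := subset_closure hzΩ
    rw [M.closure_eq, mem_iUnion] at h
    obtain ⟨i, hi⟩ := h
    refine mem_iUnion.2 ⟨i, ?_⟩
    by_contra hcon
    exact hz (mem_iUnion.2 ⟨i, hi, fun h => hcon (interior_subset h)⟩)
  · exact Filter.Eventually.of_forall (iUnion_subset fun i => M.elt_subset hΩ i)

lemma integral_eq_sum (hΩ : IsPolygonal Ω) {f : Plane → ℝ}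
    (hf : ∀ i, IntegrableOn f (M.elt i)) : ∫ z in Ω, f z = ∑ i, ∫ z in M.elt i, f z := by
  rw [setIntegral_congr_set (M.elt_ae_eq hΩ)]
  exact integral_iUnion_fintype (fun i => (M.isOpen_elt i).measurableSet)
    (fun i j hij => M.elt_disjoint hij) hf

lemma toFun_of_mem (w : M.Broken) {i : Fin M.N} {z : Plane} (hz : z ∈ M.elt i) :
    toFun w z = pe (w i) z := by
  rw [toFun, Finset.sum_eq_single i]
  · rw [indicator_of_mem hz]; rfl
  · intro j _ hj
    exact indicator_of_notMem (fun h => (M.elt_disjoint hj).le_bot ⟨h, hz⟩) _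
  · simp

lemma toFun_of_notMem (w : M.Broken) {z : Plane} (hz : ∀ i, z ∉ M.elt i) : toFun w z = 0 :=
  Finset.sum_eq_zero fun i _ => indicator_of_notMem (hz i) _

lemma toFun_mul (w v : M.Broken) (z : Plane) : toFun (w * v) z = toFun w z * toFun v z := by
  by_cases h : ∃ i, z ∈ M.elt i
  · obtain ⟨i, hi⟩ := h
    rw [toFun_of_mem _ hi, toFun_of_mem _ hi, toFun_of_mem _ hi]; simp [pe]
  · push Not at h
    rw [toFun_of_notMem _ h, toFun_of_notMem _ h, zero_mul]

lemma toFun_add (w v : M.Broken) (z : Plane) : toFun (w + v) z = toFun w z + toFun v z := by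
  by_cases h : ∃ i, z ∈ M.elt i
  · obtain ⟨i, hi⟩ := h
    rw [toFun_of_mem _ hi, toFun_of_mem _ hi, toFun_of_mem _ hi]; simp [pe]
  · push Not at h
    rw [toFun_of_notMem _ h, toFun_of_notMem _ h, toFun_of_notMem _ h, add_zero]

lemma toFun_smul (c : ℝ) (w : M.Broken) (z : Plane) : toFun (c • w) z = c * toFun w z := by
  by_cases h : ∃ i, z ∈ M.elt i
  · obtain ⟨i, hi⟩ := h
    rw [toFun_of_mem _ hi, toFun_of_mem _ hi]; simp [pe]
  · push Not at h
    rw [toFun_of_notMem _ h, toFun_of_notMem _ h, mul_zero]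

lemma integrableOn_elt {f : Plane → ℝ} (hf : Continuous f) (i : Fin M.N) :
    IntegrableOn f (M.elt i) :=
  (hf.continuousOn.integrableOn_compact
    ((finite_range (M.vert i)).isCompact_convexHull ℝ)).mono_set interior_subset

/-- The integral over `Ω` of a broken polynomial. -/
def bint (w : M.Broken) : ℝ := ∑ i, ∫ z in M.elt i, pe (w i) z

lemma bint_add (w v : M.Broken) : bint (w + v) = bint w + bint v := by
  unfold bint
  rw [← Finset.sum_add_distrib]
  refine Finset.sum_congr rfl fun i _ => ?_
  rw [← integral_add (integrableOn_elt (continuous_pe _) i) (integrableOn_elt (continuous_pe _) i)]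
  simp [pe]

lemma bint_smul (c : ℝ) (w : M.Broken) : bint (c • w) = c * bint w := by
  unfold bint
  rw [Finset.mul_sum]
  refine Finset.sum_congr rfl fun i _ => ?_
  rw [← integral_const_mul]
  simp [pe]

lemma bint_nonneg {w : M.Broken} (hw : ∀ i z, 0 ≤ pe (w i) z) : 0 ≤ bint w :=
  Finset.sum_nonneg fun i _ => integral_nonneg fun z => hw i z

lemma integral_toFun (hΩ : IsPolygonal Ω) (w : M.Broken) : ∫ z in Ω, toFun w z = bint w := by
  have hc : ∀ i, ∀ z ∈ M.elt i, toFun w z = pe (w i) z := fun i z hz => toFun_of_mem w hz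
  rw [integral_eq_sum hΩ fun i => (integrableOn_elt (continuous_pe (w i)) i).congr_fun
    (fun z hz => (hc i z hz).symm) (M.isOpen_elt i).measurableSet]
  exact Finset.sum_congr rfl fun i _ => setIntegral_congr_fun (M.isOpen_elt i).measurableSet (hc i)

lemma bint_D (w : M.Broken) (j : Fin 2) : bint (D j w) = ∫ z in M.skel, jump w z j ∂μH[1] := by
  have := sum_integral_pd (F := fun i => pe (w i)) (fun i => (contDiff_pe (w i)).of_le (by simp)) j
  simp only [pd_pe] at this
  exact this

/-! ### Traces of broken polynomials -/

lemma volume_lt_top (hΩ : IsPolygonal Ω) : volume Ω < ⊤ := hΩ.isBounded.measure_lt_top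

lemma integrableOn_of_memLp (hΩ : IsPolygonal Ω) {f : Plane → ℝ}
    (hf : MemLp f 2 (volume.restrict Ω)) : IntegrableOn f Ω := by
  have : IsFiniteMeasure (volume.restrict Ω) := ⟨by simpa using volume_lt_top hΩ⟩
  exact hf.integrable (by norm_num)

lemma memLp_apply {μ : Measure Plane} {g : Plane → Fin 2 → ℝ} (hg : MemLp g 2 μ) (j : Fin 2) :
    MemLp (fun z => g z j) 2 μ := by
  refine hg.of_le ((measurable_pi_apply j).comp_aemeasurable hg.1.aemeasurable).aestronglyMeasurable
    (Filter.Eventually.of_forall fun z => norm_le_pi_norm (g z) j)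

lemma pd_eq_zero_of_notMem_tsupport {φ : Plane → ℝ} {z : Plane} (hz : z ∉ tsupport φ) (j : Fin 2) :
    pd j φ z = 0 := by
  have : z ∉ Function.support (fderiv ℝ φ) := fun h => hz (support_fderiv_subset ℝ h)
  rw [pd, Function.notMem_support.1 this]; simp

lemma continuous_pd {φ : Plane → ℝ} (hφ : ContDiff ℝ ∞ φ) (j : Fin 2) : Continuous (pd j φ) :=
  (hφ.continuous_fderiv (by simp)).clm_apply continuous_const

/-- The weak gradient of a broken polynomial in `H¹` is the elementwise gradient. -/
lemma weak_gradient_eq (hΩ : IsPolygonal Ω) {w : M.Broken} {g : Plane → Fin 2 → ℝ}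
    (hw : IsH1With Ω (toFun w) g) (i : Fin M.N) (j : Fin 2) :
    ∀ᵐ z, z ∈ M.elt i → g z j - pe (D j w i) z = 0 := by
  obtain ⟨h1, h2, h3⟩ := hw
  have hgi : IntegrableOn (fun z => g z j) (M.elt i) :=
    (integrableOn_of_memLp hΩ (memLp_apply h2 j)).mono_set (M.elt_subset hΩ i)
  refine (M.isOpen_elt i).ae_eq_zero_of_integral_contDiff_smul_eq_zero ?_ fun φ hφ hφc hφs => ?_
  · exact (hgi.sub (integrableOn_elt (continuous_pe _) i)).locallyIntegrableOn
  have hms := (M.isOpen_elt i).measurableSet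
  have hφ0 : ∀ z, z ∉ M.elt i → φ z = 0 := fun z hz =>
    image_eq_zero_of_notMem_tsupport fun h => hz (hφs h)
  have e1 := h3 φ hφ hφc (hφs.trans (M.elt_subset hΩ i)) j
  rw [setIntegral_eq_of_subset_of_forall_sdiff_eq_zero hΩ.isOpen.measurableSet (M.elt_subset hΩ i)
      (fun z hz => by rw [pd_eq_zero_of_notMem_tsupport fun h => hz.2 (hφs h), mul_zero]),
    setIntegral_eq_of_subset_of_forall_sdiff_eq_zero hΩ.isOpen.measurableSet (M.elt_subset hΩ i)
      (fun z hz => by rw [hφ0 z hz.2, mul_zero])] at e1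
  have hF : ContDiff ℝ 1 fun z => pe (w i) z * φ z :=
    ((contDiff_pe (w i)).mul hφ).of_le (by simp)
  have hfr0 : ∀ z ∈ frontier (M.elt i), φ z = 0 := fun z hz =>
    hφ0 z fun h => hz.2 (by rwa [interior_eq_iff_isOpen.2 (M.isOpen_elt i)])
  -- The test function vanishes on the boundary of the element, so the divergence theorem leaves no
  -- boundary term.
  have e2 : ∫ z in M.elt i, pd j (fun z => pe (w i) z * φ z) z = 0 := by
    have hb : M.BddMeas fun z => (pe (w i) z * φ z) * outerNormal (M.elt i) z j :=
      (bddMeas_of_continuous hF.continuous).mul (bddMeas_outerNormal_elt i j)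
    rw [elt, integral_pd_tri (M.nondegenerate i) hF j
      (hb.integrableOn (subset_iUnion (fun i => frontier (M.elt i)) i))]
    refine setIntegral_eq_zero_of_forall_eq_zero fun z hz => ?_
    rw [hfr0 z hz]; simp
  have hφi : Continuous φ := hφ.continuous
  simp only [pd_mul (differentiable_pe (w i)) (hφ.differentiable (by simp)), pd_pe] at e2
  have q1 : IntegrableOn (fun z => pe (w i) z * pd j φ z) (M.elt i) :=
    integrableOn_elt ((continuous_pe _).mul (continuous_pd hφ j)) i
  have q2 : IntegrableOn (fun z => pe (MvPolynomial.pderiv j (w i)) z * φ z) (M.elt i) :=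
    integrableOn_elt ((continuous_pe _).mul hφi) i
  rw [integral_add q1 q2] at e2
  have e3 : ∫ z in M.elt i, toFun w z * pd j φ z = ∫ z in M.elt i, pe (w i) z * pd j φ z :=
    setIntegral_congr_fun hms fun z hz => by rw [toFun_of_mem w hz]
  have e4 : ∫ z, φ z • (g z j - pe (D j w i) z) =
      ∫ z in M.elt i, φ z • (g z j - pe (D j w i) z) :=
    (setIntegral_eq_integral_of_forall_compl_eq_zero fun z hz => by
      rw [hφ0 z hz, zero_smul]).symm
  have hgφ : IntegrableOn (fun z => g z j * φ z) (M.elt i) := by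
    obtain ⟨C, hC⟩ := hφc.exists_bound_of_continuous hφi
    exact hgi.mul_bdd hφi.aestronglyMeasurable (Filter.Eventually.of_forall hC)
  rw [e4]
  have e5 : ∫ z in M.elt i, φ z • (g z j - pe (D j w i) z) =
      (∫ z in M.elt i, g z j * φ z) -
        ∫ z in M.elt i, pe (MvPolynomial.pderiv j (w i)) z * φ z := by
    rw [← integral_sub hgφ q2]
    congr 1
    ext z
    simp only [smul_eq_mul, D]; ring
  rw [e5]
  rw [e3] at e1
  linarith

/-- Broken polynomials in `H¹₋,₀` have no jumps in the interior and vanish on the inflow and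
elliptic parts of the boundary. -/
theorem trace_of_mem_H1zero (hΩ : IsPolygonal Ω) {w : M.Broken} (hw : toFun w ∈ H1zero Ω) :
    ∀ᵐ z ∂((μH[1] : Measure Plane).restrict M.skel),
      (z ∉ frontier Ω → ∀ j, jump w z j = 0) ∧ (z ∈ bdryIn Ω ∪ bdryEll Ω → avg w z = 0) := by
  obtain ⟨g, r, hH1, ⟨hr, htr⟩, hzero⟩ := hw
  have hfm : MeasurableSet (frontier Ω) := isClosed_frontier.measurableSet
  have : IsFiniteMeasure ((μH[1] : Measure Plane).restrict (frontier Ω)) := ⟨by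
    rw [Measure.restrict_apply_univ]
    exact (measure_mono (M.frontier_subset_skel hΩ)).trans_lt M.hausdorff_skel_lt_top⟩
  have hri : IntegrableOn r (frontier Ω) μH[1] := hr.integrable (by norm_num)
  have hrn : ∀ j, IntegrableOn (fun z => r z * outerNormal Ω z j) (frontier Ω) μH[1] := fun j =>
    hri.mul_bdd (c := 1)
      ((measurable_plane_apply j).comp (M.measurable_outerNormal hΩ)).aestronglyMeasurable
      (Filter.Eventually.of_forall fun z => abs_outerNormal_le Ω z j)
  -- Elementwise Green's formula, compared with the one that defines the trace, shows that this
  -- difference is orthogonal to every smooth test function on the skeleton.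
  have key : ∀ j, ∀ᵐ z ∂((μH[1] : Measure Plane).restrict M.skel),
      jump w z j - (frontier Ω).indicator (fun z => r z * outerNormal Ω z j) z = 0 := by
    intro j
    have hji : IntegrableOn (fun z => jump w z j) M.skel μH[1] :=
      (bddMeas_jump w j).integrableOn Subset.rfl
    have hii : IntegrableOn ((frontier Ω).indicator fun z => r z * outerNormal Ω z j)
        M.skel μH[1] := by
      refine IntegrableOn.integrable_indicator ?_ hfm
      rw [IntegrableOn, Measure.restrict_restrict hfm,
        inter_eq_left.2 (M.frontier_subset_skel hΩ)]
      exact hrn j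
    refine ae_eq_zero_of_integral_contDiff_smul_eq_zero (hji.sub hii).locallyIntegrable
      fun φ hφ hφc => ?_
    have hφi : Continuous φ := hφ.continuous
    obtain ⟨C, hC⟩ := hφc.exists_bound_of_continuous hφi
    have e1 := htr φ hφ hφc j
    have hF : ∀ i, ContDiff ℝ 1 fun z => pe (w i) z * φ z := fun i =>
      ((contDiff_pe (w i)).mul hφ).of_le (by simp)
    have e2 := sum_integral_pd (M := M) hF j
    have hms := fun i => (M.isOpen_elt i).measurableSet
    have c1 : ∀ i, ∀ z ∈ M.elt i, toFun w z * pd j φ z = pe (w i) z * pd j φ z :=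
      fun i z hz => by rw [toFun_of_mem w hz]
    have i1 : ∫ z in Ω, toFun w z * pd j φ z = ∑ i, ∫ z in M.elt i, pe (w i) z * pd j φ z := by
      rw [integral_eq_sum hΩ fun i => (integrableOn_elt ((continuous_pe (w i)).mul
        (continuous_pd hφ j)) i).congr_fun (fun z hz => (c1 i z hz).symm) (hms i)]
      exact Finset.sum_congr rfl fun i _ => setIntegral_congr_fun (hms i) (c1 i)
    have hgφ : IntegrableOn (fun z => g z j * φ z) Ω := by
      exact (integrableOn_of_memLp hΩ (memLp_apply hH1.2.1 j)).mul_bdd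
        hφi.aestronglyMeasurable (Filter.Eventually.of_forall hC)
    have i2 : ∫ z in Ω, g z j * φ z =
        ∑ i, ∫ z in M.elt i, pe (MvPolynomial.pderiv j (w i)) z * φ z := by
      rw [integral_eq_sum hΩ fun i => hgφ.mono_set (M.elt_subset hΩ i)]
      refine Finset.sum_congr rfl fun i _ => setIntegral_congr_ae (hms i) ?_
      filter_upwards [weak_gradient_eq hΩ hH1 i j] with z hz hzi
      rw [sub_eq_zero.1 (hz hzi)]; rfl
    have i3 : ∑ i, ∫ z in M.elt i, pd j (fun z => pe (w i) z * φ z) z =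
        (∫ z in Ω, toFun w z * pd j φ z) + ∫ z in Ω, g z j * φ z := by
      rw [i1, i2, ← Finset.sum_add_distrib]
      refine Finset.sum_congr rfl fun i _ => ?_
      have q1 : IntegrableOn (fun z => pe (w i) z * pd j φ z) (M.elt i) :=
        integrableOn_elt ((continuous_pe _).mul (continuous_pd hφ j)) i
      have q2 : IntegrableOn (fun z => pe (MvPolynomial.pderiv j (w i)) z * φ z) (M.elt i) :=
        integrableOn_elt ((continuous_pe _).mul hφi) i
      rw [← integral_add q1 q2]
      simp only [pd_mul (differentiable_pe (w i)) (hφ.differentiable (by simp)), pd_pe]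
    have i4 : ∫ z in frontier Ω, r z * φ z * outerNormal Ω z j ∂μH[1] =
        ∫ z in M.skel, φ z * (frontier Ω).indicator (fun z => r z * outerNormal Ω z j) z ∂μH[1] := by
      have : (fun z => φ z * (frontier Ω).indicator (fun z => r z * outerNormal Ω z j) z) =
          (frontier Ω).indicator fun z => r z * φ z * outerNormal Ω z j := by
        ext z
        by_cases hz : z ∈ frontier Ω
        · rw [indicator_of_mem hz, indicator_of_mem hz]; ring
        · rw [indicator_of_notMem hz, indicator_of_notMem hz, mul_zero]
      rw [this, setIntegral_indicator hfm, inter_eq_right.2 (M.frontier_subset_skel hΩ)]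
    have i5 : ∀ z, ∑ i ∈ M.around z, pe (w i) z * φ z * outerNormal (M.elt i) z j =
        φ z * jump w z j := fun z => by
      rw [jump, Finset.mul_sum]
      refine Finset.sum_congr rfl fun i _ => ?_
      simp only [pe]; ring
    simp only [i5] at e2
    simp only [smul_eq_mul, mul_sub]
    rw [integral_sub, ← e2, i3, e1, i4, sub_self]
    · exact hji.bdd_mul hφi.aestronglyMeasurable (Filter.Eventually.of_forall hC)
    · exact hii.bdd_mul hφi.aestronglyMeasurable (Filter.Eventually.of_forall hC)
  have hz' : ∀ᵐ z ∂((μH[1] : Measure Plane).restrict M.skel),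
      z ∈ bdryIn Ω ∪ bdryEll Ω → r z = 0 := by
    rw [ae_restrict_iff' ((measurableSet_bdryIn hΩ).union (measurableSet_bdryEll hΩ))] at hzero
    exact ae_restrict_of_ae hzero
  filter_upwards [key 0, key 1, ae_regular, hz'] with z h0 h1 ⟨hzs, hze⟩ hrz
  rcases M.skel_cases hΩ hzs hze with ⟨i, ha, hf, hn, -⟩ | ⟨i, j, -, -, hf, -⟩
  · refine ⟨fun h => absurd hf h, fun hb => ?_⟩
    have hnn : ‖outerNormal (M.elt i) z‖ = 1 := M.norm_outerNormal_eq hze (by rw [ha]; simp)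
    have hav : avg w z = pe (w i) z := by simp [avg, av, ha, pe]
    have hj : ∀ j, jump w z j = pe (w i) z * outerNormal (M.elt i) z j := fun j => by
      simp [jump, ha, pe]
    rw [hav]
    rw [indicator_of_mem hf, hrz hb, hj] at h0 h1
    simp only [zero_mul, sub_zero, mul_eq_zero] at h0 h1
    -- Both components of `w n` vanish while `n` is a unit vector, so `w = 0`.
    rcases h0 with h0 | h0
    · exact h0
    rcases h1 with h1 | h1
    · exact h1
    have : outerNormal (M.elt i) z = 0 := plane_ext h0 h1
    rw [this, norm_zero] at hnn
    exact absurd hnn zero_ne_one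
  · refine ⟨fun _ j => ?_, fun hb => ?_⟩
    · rw [indicator_of_notMem hf, sub_zero] at h0 h1
      fin_cases j <;> assumption
    · rcases hb with hb | hb <;> exact absurd hb.1 hf

end Triangulation

/-! ### Polynomial algebra -/

lemma totalDegree_pderiv_le (j : Fin 2) (q : MvPolynomial (Fin 2) ℝ) :
    (MvPolynomial.pderiv j q).totalDegree ≤ q.totalDegree := by
  refine Finset.sup_le fun m hm => ?_
  rw [MvPolynomial.mem_support_iff, MvPolynomial.coeff_pderiv] at hm
  have h := MvPolynomial.le_totalDegree (MvPolynomial.mem_support_iff.2 (left_ne_zero_of_mul hm))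
  refine le_trans ?_ h
  rw [Finsupp.sum_add_index' (fun _ => rfl) (fun _ _ _ => rfl)]
  exact Nat.le_add_right _ _

lemma pderiv_comm (q : MvPolynomial (Fin 2) ℝ) :
    MvPolynomial.pderiv 0 (MvPolynomial.pderiv 1 q) =
      MvPolynomial.pderiv 1 (MvPolynomial.pderiv 0 q) := by
  ext m
  rw [MvPolynomial.coeff_pderiv, MvPolynomial.coeff_pderiv, MvPolynomial.coeff_pderiv,
    MvPolynomial.coeff_pderiv, add_right_comm]
  simp only [Finsupp.add_apply, Finsupp.single_apply]
  norm_num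
  ring

/-! ### The quadratic form of the matrix -/

/-- The bilinear form of the matrix `matA α β γ`. -/
def qf (α β γ a₀ a₁ b₀ b₁ : ℝ) : ℝ := α * (a₀ * b₀) + β * (a₀ * b₁ + a₁ * b₀) + γ * (a₁ * b₁)

lemma dotProduct_matA (α β γ : ℝ) (a b : Fin 2 → ℝ) :
    a ⬝ᵥ (matA α β γ *ᵥ b) = qf α β γ (a 0) (a 1) (b 0) (b 1) := by
  simp [matA, qf, dotProduct, Matrix.mulVec, Fin.sum_univ_two]; ring

lemma matA_dotProduct (α β γ : ℝ) (a b : Fin 2 → ℝ) :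
    (matA α β γ *ᵥ a) ⬝ᵥ b = qf α β γ (a 0) (a 1) (b 0) (b 1) := by
  simp [matA, qf, dotProduct, Matrix.mulVec, Fin.sum_univ_two]; ring

/-- The square is completed; the determinant `αγ - β²` equals `α² / 8`. As a sum of two squares of
linear forms, the form of a polynomial gradient is accessible to scalar inverse inequalities. -/
lemma qf_self (α x y : ℝ) : qf α (α / 2) (3 * α / 8) x y x y =
    α * (x + y / 2) ^ 2 + α / 8 * y ^ 2 := by unfold qf; ring

lemma qf_self_nonneg {α : ℝ} (hα : 0 < α) (x y : ℝ) :
    0 ≤ qf α (α / 2) (3 * α / 8) x y x y := by rw [qf_self]; positivity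

lemma posSemidef_matA {α : ℝ} (hα : 0 < α) : (matA α (α / 2) (3 * α / 8)).PosSemidef := by
  refine Matrix.PosSemidef.of_dotProduct_mulVec_nonneg ?_ fun x => ?_
  · ext i j; fin_cases i <;> fin_cases j <;> simp [matA]
  · rw [star_trivial, dotProduct_matA]; exact qf_self_nonneg hα _ _

/-- Young's inequality for the quadratic form. -/
lemma four_mul_qf_le {α : ℝ} (hα : 0 < α) {τ : ℝ} (hτ : 0 < τ) (v₀ v₁ j₀ j₁ : ℝ) :
    4 * qf α (α / 2) (3 * α / 8) v₀ v₁ j₀ j₁ ≤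
      τ / 2 * qf α (α / 2) (3 * α / 8) j₀ j₁ j₀ j₁ +
        8 / τ * qf α (α / 2) (3 * α / 8) v₀ v₁ v₀ v₁ := by
  have h := qf_self_nonneg hα (τ * j₀ - 4 * v₀) (τ * j₁ - 4 * v₁)
  -- Expanding the form at `τ j - 4 v` and dividing by `2τ` gives exactly the weights `τ / 2` and `8
  -- / τ`.
  have h2 : qf α (α / 2) (3 * α / 8) (τ * j₀ - 4 * v₀) (τ * j₁ - 4 * v₁) (τ * j₀ - 4 * v₀)
      (τ * j₁ - 4 * v₁) = τ ^ 2 * qf α (α / 2) (3 * α / 8) j₀ j₁ j₀ j₁ -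
      8 * τ * qf α (α / 2) (3 * α / 8) v₀ v₁ j₀ j₁ + 16 * qf α (α / 2) (3 * α / 8) v₀ v₁ v₀ v₁ := by
    unfold qf; ring
  rw [h2] at h
  have h3 : τ / 2 * qf α (α / 2) (3 * α / 8) j₀ j₁ j₀ j₁ +
        8 / τ * qf α (α / 2) (3 * α / 8) v₀ v₁ v₀ v₁ - 4 * qf α (α / 2) (3 * α / 8) v₀ v₁ j₀ j₁ =
      (τ ^ 2 * qf α (α / 2) (3 * α / 8) j₀ j₁ j₀ j₁ -
      8 * τ * qf α (α / 2) (3 * α / 8) v₀ v₁ j₀ j₁ +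
      16 * qf α (α / 2) (3 * α / 8) v₀ v₁ v₀ v₁) / (2 * τ) := by
    field_simp; ring
  have h4 := div_nonneg h (by positivity : 0 ≤ 2 * τ)
  linarith

/-- Convexity of the nonnegative form: the defect is half of its value at the difference. -/
lemma qf_average_le {α : ℝ} (hα : 0 < α) (a₀ a₁ b₀ b₁ : ℝ) :
    2 * qf α (α / 2) (3 * α / 8) ((a₀ + b₀) / 2) ((a₁ + b₁) / 2) ((a₀ + b₀) / 2) ((a₁ + b₁) / 2) ≤
      qf α (α / 2) (3 * α / 8) a₀ a₁ a₀ a₁ + qf α (α / 2) (3 * α / 8) b₀ b₁ b₀ b₁ := by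
  have h := qf_self_nonneg hα (a₀ - b₀) (a₁ - b₁)
  unfold qf at *
  linarith

namespace Triangulation

variable {Ω : Set Plane} {M : Triangulation Ω}

/-! ### Inner products as integrals of broken polynomials -/

/-- The broken polynomial `∇w · A ∇v`. -/
def qA (α β γ : ℝ) (w v : M.Broken) : M.Broken :=
  α • (D 0 w * D 0 v) + β • (D 0 w * D 1 v + D 1 w * D 0 v) + γ • (D 1 w * D 1 v)

lemma pe_qA (α β γ : ℝ) (w v : M.Broken) (i : Fin M.N) (z : Plane) :
    pe (qA α β γ w v i) z = qf α β γ (pe (D 0 w i) z) (pe (D 1 w i) z) (pe (D 0 v i) z)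
      (pe (D 1 v i) z) := by
  simp [pe, qA, qf, mul_add]

lemma ip_eq (hΩ : IsPolygonal Ω) (w v : M.Broken) :
    ip Ω (toFun w) (toFun v) = bint (w * v) := by
  rw [ip, ← integral_toFun hΩ]; simp only [toFun_mul]

lemma ipA_eq (hΩ : IsPolygonal Ω) (α β γ : ℝ) (w v : M.Broken) :
    ipA Ω (matA α β γ) (grad w) (grad v) = bint (qA α β γ w v) := by
  rw [ipA, ← integral_toFun hΩ]
  simp only [dotProduct_matA, grad, qA, toFun_add, toFun_smul, toFun_mul, qf]

lemma bint_le {w v : M.Broken} (h : ∀ i, ∀ z ∈ M.elt i, pe (w i) z ≤ pe (v i) z) :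
    bint w ≤ bint v :=
  Finset.sum_le_sum fun i _ => setIntegral_mono_on (integrableOn_elt (continuous_pe _) i)
    (integrableOn_elt (continuous_pe _) i) (M.isOpen_elt i).measurableSet (h i)

/-! ### Interface values -/

lemma jump_pair {i j : Fin M.N} {z : Plane} (hij : i ≠ j) (ha : M.around z = {i, j})
    (hn : outerNormal (M.elt j) z = - outerNormal (M.elt i) z) (w : M.Broken) (k : Fin 2) :
    jump w z k = (pe (w i) z - pe (w j) z) * outerNormal (M.elt i) z k := by
  rw [jump, ha, Finset.sum_pair hij, hn]
  simp only [pe, PiLp.neg_apply]; ring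

lemma avg_pair {i j : Fin M.N} {z : Plane} (hij : i ≠ j) (ha : M.around z = {i, j})
    (w : M.Broken) : avg w z = (pe (w i) z + pe (w j) z) / 2 := by
  rw [avg, av, ha, Finset.sum_pair hij, Finset.card_pair hij]
  simp [pe]

lemma jump_single {i : Fin M.N} {z : Plane} (ha : M.around z = {i}) (w : M.Broken) (k : Fin 2) :
    jump w z k = pe (w i) z * outerNormal (M.elt i) z k := by
  simp [jump, ha, pe]

lemma avg_single {i : Fin M.N} {z : Plane} (ha : M.around z = {i}) (w : M.Broken) :
    avg w z = pe (w i) z := by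
  simp [avg, av, ha, pe]

lemma h_pos (i : Fin M.N) : 0 < M.h i := by
  obtain ⟨c, hc⟩ : (M.elt i).Nonempty := tri_nonempty (M.nondegenerate i)
  refine Metric.diam_pos (infinite_of_mem_nhds c ((M.isOpen_elt i).mem_nhds hc)).nontrivial ?_
  exact ((finite_range (M.vert i)).isCompact_convexHull ℝ).isBounded.subset interior_subset

lemma integrableOn_frontier_elt {f : Plane → ℝ} (hf : Continuous f) (i : Fin M.N) :
    IntegrableOn f (frontier (M.elt i)) μH[1] :=
  integrableOn_frontier_tri (M.nondegenerate i) hf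

/-! ### Bounding the averages in the consistency terms -/

/-- The mesh-dependent weight that bounds the averages in the consistency terms. -/
def traceWeight (K Cτ : ℝ) (p : ℕ) (w : M.Broken) (z : Plane) : ℝ :=
  8 * K / (Cτ * p ^ 2) * ∑ i ∈ M.around z, M.h i * pe (w i) z

lemma bddMeas_traceWeight (K Cτ : ℝ) (p : ℕ) (w : M.Broken) :
    M.BddMeas (traceWeight K Cτ p w) :=
  (BddMeas.const _).mul (bddMeas_sum_around fun i => (BddMeas.const (M.h i)).mul (bddMeas_pe (w i)))

lemma setIntegral_eq_indicator {s : Set Plane} (hs : MeasurableSet s) (hsub : s ⊆ M.skel)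
    (f : Plane → ℝ) : ∫ z in s, f z ∂μH[1] = ∫ z in M.skel, s.indicator f z ∂μH[1] := by
  rw [setIntegral_indicator hs, inter_eq_right.2 hsub]

lemma bdryIn_subset (hΩ : IsPolygonal Ω) : bdryIn Ω ⊆ M.skel :=
  (sep_subset _ _).trans (M.frontier_subset_skel hΩ)

lemma bdryEll_subset (hΩ : IsPolygonal Ω) : bdryEll Ω ⊆ M.skel :=
  (sep_subset _ _).trans (M.frontier_subset_skel hΩ)

lemma bdryOut_subset (hΩ : IsPolygonal Ω) : bdryOut Ω ⊆ M.skel :=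
  (sep_subset _ _).trans (M.frontier_subset_skel hΩ)

lemma skelInt_subset : M.skelInt ⊆ M.skel := sdiff_subset

lemma measurableSet_skelInt : MeasurableSet M.skelInt :=
  M.measurableSet_skel.diff isClosed_frontier.measurableSet

/-- The trace inverse inequality, summed over the elements. -/
lemma integral_traceWeight_le {α : ℝ} (hα : 0 < α) {σ : ℝ} (hσ : M.ShapeRegular σ) {K Cτ : ℝ}
    (hK : 1 ≤ K) (hC : 0 < Cτ) (hCK : 768 * K * |σ| ≤ Cτ) {p : ℕ} (hp : 2 ≤ p) (w : M.Broken)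
    (hw : ∀ i, (w i).totalDegree ≤ p) :
    ∫ z in M.skel, traceWeight K Cτ p (qA α (α / 2) (3 * α / 8) w w) z ∂μH[1] ≤
      bint (qA α (α / 2) (3 * α / 8) w w) := by
  have hp0 : (2 : ℝ) ≤ p := by exact_mod_cast hp
  simp only [traceWeight]
  rw [integral_const_mul]
  set q := qA α (α / 2) (3 * α / 8) w w with hq
  have h1 : ∫ z in M.skel, ∑ i ∈ M.around z, M.h i * pe (q i) z ∂μH[1] =
      ∑ i, M.h i * ∫ z in frontier (M.elt i), pe (q i) z ∂μH[1] := by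
    classical
    have h2 : ∀ z, ∑ i ∈ M.around z, M.h i * pe (q i) z =
        ∑ i, (frontier (M.elt i)).indicator (fun z => M.h i * pe (q i) z) z := fun z => by
      simp only [indicator_apply, ← M.mem_around, Finset.sum_ite_mem, Finset.univ_inter]
    simp only [h2]
    rw [integral_finsetSum]
    · refine Finset.sum_congr rfl fun i _ => ?_
      rw [← setIntegral_eq_indicator isClosed_frontier.measurableSet
        (subset_iUnion (fun i => frontier (M.elt i)) i), integral_const_mul]
    · intro i _
      exact (((BddMeas.const (M.h i)).mul (bddMeas_pe (q i))).indicator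
        isClosed_frontier.measurableSet).integrableOn Subset.rfl
  have hloc : ∀ i, M.h i * ∫ z in frontier (M.elt i), pe (q i) z ∂μH[1] ≤
      24 * |σ| * (p + 1) ^ 2 * ∫ z in M.elt i, pe (q i) z := by
    intro i
    obtain ⟨c, ρ, hρ, hb, hh⟩ := hσ i
    have hσ' : M.h i ≤ |σ| * ρ := hh.trans (mul_le_mul_of_nonneg_right (le_abs_self σ) hρ.le)
    -- The form is `α a² + (α/8) b²`, so the inverse inequality applies to `a` and `b`, both of
    -- degree at most `p`.
    set a : MvPolynomial (Fin 2) ℝ := D 0 w i + MvPolynomial.C (1 / 2) * D 1 w i with ha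
    set b : MvPolynomial (Fin 2) ℝ := D 1 w i with hb'
    have hd0 : (D 0 w i).totalDegree ≤ p := (totalDegree_pderiv_le 0 _).trans (hw i)
    have hd1 : (D 1 w i).totalDegree ≤ p := (totalDegree_pderiv_le 1 _).trans (hw i)
    have hda : a.totalDegree ≤ p := by
      refine (MvPolynomial.totalDegree_add _ _).trans (max_le hd0 ?_)
      refine (MvPolynomial.totalDegree_mul _ _).trans ?_
      rw [MvPolynomial.totalDegree_C, zero_add]; exact hd1
    have hqe : ∀ z, pe (q i) z = α * pe a z ^ 2 + α / 8 * pe b z ^ 2 := fun z => by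
      rw [hq, pe_qA, qf_self, ha]
      simp only [pe, map_add, map_mul, MvPolynomial.eval_C]
      ring
    have ga := integral_frontier_sq_le (M.nondegenerate i) hρ hb (h_pos i).le hσ' a p hda
    have gb := integral_frontier_sq_le (M.nondegenerate i) hρ hb (h_pos i).le hσ' b p hd1
    have ia : ∀ c : ℝ, ∀ r : MvPolynomial (Fin 2) ℝ, Continuous fun z => c * pe r z ^ 2 :=
      fun c r => continuous_const.mul ((continuous_pe r).pow 2)
    simp only [hqe]
    rw [integral_add (integrableOn_frontier_elt (ia _ _) i) (integrableOn_frontier_elt (ia _ _) i),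
      integral_add (integrableOn_elt (ia _ _) i) (integrableOn_elt (ia _ _) i),
      integral_const_mul, integral_const_mul, integral_const_mul, integral_const_mul]
    have ka := mul_le_mul_of_nonneg_left ga hα.le
    have kb := mul_le_mul_of_nonneg_left gb (by positivity : 0 ≤ α / 8)
    unfold elt
    linarith
  rw [h1]
  have hI : 0 ≤ bint q := bint_nonneg fun i z => by
    rw [hq, pe_qA]; exact qf_self_nonneg hα _ _
  have hsum : ∑ i, M.h i * ∫ z in frontier (M.elt i), pe (q i) z ∂μH[1] ≤
      24 * |σ| * (p + 1) ^ 2 * bint q := by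
    rw [bint, Finset.mul_sum]
    exact Finset.sum_le_sum fun i _ => hloc i
  calc 8 * K / (Cτ * p ^ 2) * ∑ i, M.h i * ∫ z in frontier (M.elt i), pe (q i) z ∂μH[1]
      ≤ 8 * K / (Cτ * p ^ 2) * (24 * |σ| * (p + 1) ^ 2 * bint q) :=
        mul_le_mul_of_nonneg_left hsum (by positivity)
    _ = (192 * K * |σ| * (p + 1) ^ 2) / (Cτ * p ^ 2) * bint q := by ring
    _ ≤ 1 * bint q := by
        refine mul_le_mul_of_nonneg_right ?_ hI
        rw [div_le_one (by positivity)]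
        -- This is where `768 = 8 * 24 * 4` comes from.
        have h4 : ((p : ℝ) + 1) ^ 2 ≤ 4 * p ^ 2 := by nlinarith
        calc 192 * K * |σ| * ((p : ℝ) + 1) ^ 2 ≤ 192 * K * |σ| * (4 * p ^ 2) :=
              mul_le_mul_of_nonneg_left h4 (by positivity)
          _ = 768 * K * |σ| * p ^ 2 := by ring
          _ ≤ Cτ * p ^ 2 := mul_le_mul_of_nonneg_right hCK (by positivity)
    _ = bint q := one_mul _

lemma traceWeight_nonneg {α : ℝ} (hα : 0 < α) {K Cτ : ℝ} (hK : 1 ≤ K) (hC : 0 < Cτ) (p : ℕ)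
    (w : M.Broken) (z : Plane) :
    0 ≤ traceWeight K Cτ p (qA α (α / 2) (3 * α / 8) w w) z := by
  refine mul_nonneg (by positivity) (Finset.sum_nonneg fun i _ => mul_nonneg (h_pos i).le ?_)
  rw [pe_qA]; exact qf_self_nonneg hα _ _

/-- The pointwise bound of the average of the gradient by the element values. -/
lemma avgGrad_le_traceWeight (hΩ : IsPolygonal Ω) {α : ℝ} (hα : 0 < α) {θ : ℝ}
    (hθ : M.LocallyQuasiUniform θ) {K Cτ : ℝ} (hK : 1 ≤ K) (hKθ : θ ≤ K) (hC : 0 < Cτ) {p : ℕ}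
    (hp : 2 ≤ p) (w : M.Broken) {z : Plane} (hz : z ∈ M.skel) (hz' : z ∉ M.exc) :
    0 < M.tau Cτ p z ∧ 8 / M.tau Cτ p z * qf α (α / 2) (3 * α / 8) (avgGrad w z 0) (avgGrad w z 1)
      (avgGrad w z 0) (avgGrad w z 1) ≤ traceWeight K Cτ p (qA α (α / 2) (3 * α / 8) w w) z := by
  have hp0 : (0 : ℝ) < p := by exact_mod_cast (by omega : 0 < p)
  have hq : ∀ i, 0 ≤ pe (qA α (α / 2) (3 * α / 8) w w i) z := fun i => by
    rw [pe_qA]; exact qf_self_nonneg hα _ _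
  rcases M.skel_cases hΩ hz hz' with ⟨i, ha, -⟩ | ⟨i, j, hij, ha, -, -, hn1, hn2⟩
  · have hh := h_pos i
    have ht : M.tau Cτ p z = Cτ * p ^ 2 / M.h i := by simp [tau, av, ha]
    rw [ht]
    refine ⟨by positivity, ?_⟩
    rw [traceWeight, ha, Finset.sum_singleton, pe_qA, avgGrad, avgGrad, avg_single ha,
      avg_single ha]
    have h1 := qf_self_nonneg hα (pe (D 0 w i) z) (pe (D 1 w i) z)
    set Q := qf α (α / 2) (3 * α / 8) (pe (D 0 w i) z) (pe (D 1 w i) z) (pe (D 0 w i) z)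
      (pe (D 1 w i) z)
    have h2 : 8 / (Cτ * p ^ 2 / M.h i) * Q = 8 * 1 / (Cτ * p ^ 2) * (M.h i * Q) := by
      field_simp
    rw [h2]
    gcongr
  · have hhi := h_pos i
    have hhj := h_pos j
    have ht : M.tau Cτ p z = Cτ * p ^ 2 / ((M.h i + M.h j) / 2) := by
      rw [tau, av, ha, Finset.sum_pair hij, Finset.card_pair hij]; norm_num
    rw [ht]
    refine ⟨by positivity, ?_⟩
    rw [traceWeight, ha, Finset.sum_pair hij, pe_qA, pe_qA, avgGrad, avgGrad, avg_pair hij ha,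
      avg_pair hij ha]
    have h1 := qf_self_nonneg hα (pe (D 0 w i) z) (pe (D 1 w i) z)
    have h2 := qf_self_nonneg hα (pe (D 0 w j) z) (pe (D 1 w j) z)
    have h3 := qf_average_le hα (pe (D 0 w i) z) (pe (D 1 w i) z) (pe (D 0 w j) z) (pe (D 1 w j) z)
    set Qi := qf α (α / 2) (3 * α / 8) (pe (D 0 w i) z) (pe (D 1 w i) z) (pe (D 0 w i) z)
      (pe (D 1 w i) z)
    set Qj := qf α (α / 2) (3 * α / 8) (pe (D 0 w j) z) (pe (D 1 w j) z) (pe (D 0 w j) z)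
      (pe (D 1 w j) z)
    set Qa := qf α (α / 2) (3 * α / 8) ((pe (D 0 w i) z + pe (D 0 w j) z) / 2)
      ((pe (D 1 w i) z + pe (D 1 w j) z) / 2) ((pe (D 0 w i) z + pe (D 0 w j) z) / 2)
      ((pe (D 1 w i) z + pe (D 1 w j) z) / 2)
    -- The mean mesh size in `τ` pairs `h` of one element with the values from the other;
    -- quasi-uniformity restores the matching `h`.
    have hle1 : M.h i ≤ K * M.h j :=
      (hθ i j hij hn1).trans (mul_le_mul_of_nonneg_right hKθ hhj.le)
    have hle2 : M.h j ≤ K * M.h i :=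
      (hθ j i hij.symm hn2).trans (mul_le_mul_of_nonneg_right hKθ hhi.le)
    have e1 : 8 / (Cτ * p ^ 2 / ((M.h i + M.h j) / 2)) * Qa =
        8 / (Cτ * p ^ 2) * ((M.h i + M.h j) / 2 * Qa) := by
      field_simp
    have e2 : 8 * K / (Cτ * p ^ 2) * (M.h i * Qi + M.h j * Qj) =
        8 / (Cτ * p ^ 2) * (K * (M.h i * Qi + M.h j * Qj)) := by ring
    rw [e1, e2]
    refine mul_le_mul_of_nonneg_left ?_ (by positivity)
    have f1 : (M.h i + M.h j) / 2 * Qa ≤ (M.h i + M.h j) / 2 * ((Qi + Qj) / 2) :=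
      mul_le_mul_of_nonneg_left (by linarith) (by positivity)
    have f2 : M.h j * Qi ≤ K * M.h i * Qi := mul_le_mul_of_nonneg_right hle2 h1
    have f3 : M.h i * Qj ≤ K * M.h j * Qj := mul_le_mul_of_nonneg_right hle1 h2
    have f4 : M.h i * Qi ≤ K * (M.h i * Qi) := le_mul_of_one_le_left (by positivity) hK
    have f5 : M.h j * Qj ≤ K * (M.h j * Qj) := le_mul_of_one_le_left (by positivity) hK
    nlinarith [f1, f2, f3, f4, f5]

end Triangulation

namespace Triangulation

variable {Ω : Set Plane} {M : Triangulation Ω}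

/-! ### Coercivity -/

/-- The coordinate `x` as a broken polynomial. -/
def bX : M.Broken := fun _ => MvPolynomial.X 0

lemma pe_bX (i : Fin M.N) (z : Plane) : pe (bX (M := M) i) z = z 0 := by simp [pe, bX]

lemma pe_mul (q r : MvPolynomial (Fin 2) ℝ) (z : Plane) : pe (q * r) z = pe q z * pe r z := by
  simp [pe]

/-- Since `x` does not depend on `y`, the integrand `2 x w_y w` is `∂_y (x w²)` on each element. -/
lemma two_mul_ip_transport (hΩ : IsPolygonal Ω) (w : M.Broken) :
    2 * ip Ω (toFun (xDy w)) (toFun w) = ∫ z in M.skel, jump (bX * (w * w)) z 1 ∂μH[1] := by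
  have h : D 1 (bX * (w * w)) = xDy w * w + xDy w * w := by
    funext i
    simp only [D, bX, xDy, Pi.mul_apply, Pi.add_apply, MvPolynomial.pderiv_mul,
      MvPolynomial.pderiv_X_of_ne (zero_ne_one : (0 : Fin 2) ≠ 1)]
    ring
  rw [← bint_D, h, bint_add, ip_eq hΩ]; ring

/-- The gradient of `x w_y` is `x ∂_y ∇w + (w_y, 0)`. The first part gives the `y`-derivative of `x
∇w · A∇w`, hence a skeleton term; the second gives the volume terms with `β ‖w_y‖²` that drive the
coercivity. -/
lemma two_mul_ipA_transport (hΩ : IsPolygonal Ω) (α β γ : ℝ) (w : M.Broken) :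
    2 * ipA Ω (matA α β γ) (grad (xDy w)) (grad w) =
      2 * (α * bint (D 0 w * D 1 w) + β * bint (D 1 w * D 1 w)) +
      ∫ z in M.skel, jump (bX * qA α β γ w w) z 1 ∂μH[1] := by
  have h : qA α β γ (xDy w) w + qA α β γ (xDy w) w =
      ((2 * α) • (D 0 w * D 1 w) + (2 * β) • (D 1 w * D 1 w)) + D 1 (bX * qA α β γ w w) := by
    funext i
    have hc := pderiv_comm (w i)
    simp only [qA, D, bX, xDy, Pi.mul_apply, Pi.add_apply, Pi.smul_apply, MvPolynomial.pderiv_mul,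
      MvPolynomial.pderiv_X_of_ne (zero_ne_one : (0 : Fin 2) ≠ 1), MvPolynomial.pderiv_X_self,
      map_add, hc, MvPolynomial.smul_eq_C_mul, MvPolynomial.pderiv_C, map_mul, map_ofNat]
    ring
  rw [← bint_D, ipA_eq hΩ]
  have h2 := congrArg bint h
  rw [bint_add, bint_add, bint_add, bint_smul, bint_smul] at h2
  linarith

/-- The Poincaré inequality in the `x`-direction. -/
lemma poincare (hΩ : IsPolygonal Ω) {R : ℝ} (hR : ∀ z ∈ Ω, |z 0| ≤ R) {w : M.Broken}
    (hw : toFun w ∈ H1zero Ω) : bint (w * w) ≤ 4 * R ^ 2 * bint (D 0 w * D 0 w) := by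
  have h : D 0 (bX * (w * w)) = w * w + (2 : ℝ) • (bX * (w * D 0 w)) := by
    funext i
    simp only [D, bX, Pi.mul_apply, Pi.add_apply, MvPolynomial.pderiv_mul, Pi.smul_apply,
      MvPolynomial.pderiv_X_self, MvPolynomial.smul_eq_C_mul, map_ofNat]
    ring
  -- The flux of `x w²` in the direction `x` vanishes: `w` has no interior jumps and is zero on the
  -- elliptic boundary, and `n₁ = 0` on the rest.
  have h0 : bint (D 0 (bX * (w * w))) = 0 := by
    rw [bint_D]
    refine integral_eq_zero_of_ae ?_
    filter_upwards [trace_of_mem_H1zero hΩ hw, ae_regular] with z ⟨h1, h2⟩ ⟨hzs, hze⟩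
    rcases M.skel_cases hΩ hzs hze with ⟨i, ha, hf, hn, -⟩ | ⟨i, j, hij, ha, hf, hn, -⟩
    · rw [jump_single ha]
      by_cases hb : z ∈ bdryIn Ω ∪ bdryEll Ω
      · have := h2 hb
        rw [avg_single ha] at this
        simp [pe_mul, this]
      · have : outerNormal Ω z 0 = 0 := by
          by_contra hne
          exact hb (Or.inr ⟨hf, hne⟩)
        rw [← hn, this]; simp
    · have h3 := h1 hf 0
      rw [jump_pair hij ha hn] at h3 ⊢
      simp only [Pi.mul_apply, pe_mul, pe_bX, Pi.zero_apply]
      linear_combination (z 0 * (pe (w i) z + pe (w j) z)) * h3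
  rw [h, bint_add, bint_smul] at h0
  -- Young's inequality `-2 x w w_x ≤ w²/2 + 2R² w_x²`; the first term is absorbed, which gives the
  -- constant `4R²`.
  have h1 : bint ((-2 : ℝ) • (bX * (w * D 0 w))) ≤
      bint ((1 / 2 : ℝ) • (w * w) + (2 * R ^ 2) • (D 0 w * D 0 w)) := by
    refine bint_le fun i z hz => ?_
    have hx := sq_le_sq' (abs_le.1 (hR z (M.elt_subset hΩ i hz))).1
      (abs_le.1 (hR z (M.elt_subset hΩ i hz))).2
    have e1 : pe (((-2 : ℝ) • (bX * (w * D 0 w)) : M.Broken) i) z =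
        -2 * (z 0 * (pe (w i) z * pe (D 0 w i) z)) := by simp [pe, bX]
    have e2 : pe (((1 / 2 : ℝ) • (w * w) + (2 * R ^ 2) • (D 0 w * D 0 w)) i) z =
        1 / 2 * (pe (w i) z * pe (w i) z) + 2 * R ^ 2 * (pe (D 0 w i) z * pe (D 0 w i) z) := by
      simp [pe]
    rw [e1, e2]
    nlinarith [sq_nonneg (pe (w i) z + 2 * z 0 * pe (D 0 w i) z),
      mul_le_mul_of_nonneg_right hx (sq_nonneg (pe (D 0 w i) z))]
  rw [bint_smul, bint_add, bint_smul, bint_smul] at h1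
  linarith

/-- The flux terms of the stabilisation. -/
def fluxTerm (α β γ : ℝ) (w : M.Broken) (z : Plane) : ℝ :=
  z 0 * (α * jump (D 0 w) z 1 * avg (D 0 w) z + β * jump (D 0 w) z 1 * avg (D 1 w) z +
        β * jump (D 1 w) z 1 * avg (D 0 w) z + γ * jump (D 1 w) z 1 * avg (D 1 w) z)

/-- The consistency and penalty terms of the stabilisation. -/
def penaltyTerm (α β γ Cτ : ℝ) (p : ℕ) (w : M.Broken) (z : Plane) : ℝ :=
  (matA α β γ *ᵥ avgGrad (D 0 w) z) ⬝ᵥ jumpGrad₁ w z +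
        (matA α β γ *ᵥ avgGrad (D 0 w) z) ⬝ᵥ jumpGrad₁ w z -
        M.tau Cτ p z * (jumpGrad₁ w z ⬝ᵥ (matA α β γ *ᵥ jumpGrad₁ w z))

/-- The boundary dissipation on the outflow boundary. -/
def outTerm (α β γ : ℝ) (w : M.Broken) (z : Plane) : ℝ :=
  z 0 * outerNormal Ω z 1 * avg w z ^ 2 +
    z 0 * outerNormal Ω z 1 * (avgGrad w z ⬝ᵥ (matA α β γ *ᵥ avgGrad w z))

/-- The penalty density. -/
def jumpTerm (α β γ Cτ : ℝ) (p : ℕ) (w : M.Broken) (z : Plane) : ℝ :=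
  M.tau Cτ p z * (jumpGrad₁ w z ⬝ᵥ (matA α β γ *ᵥ jumpGrad₁ w z))

lemma bddMeas_fluxTerm (α β γ : ℝ) (w : M.Broken) : M.BddMeas (fluxTerm α β γ w) := by
  refine (bddMeas_coord 0).mul (((BddMeas.add ?_ ?_).add ?_).add ?_) <;>
  exact ((BddMeas.const _).mul (bddMeas_jump _ _)).mul (bddMeas_avg _)

lemma bddMeas_qf {a₀ a₁ b₀ b₁ : Plane → ℝ} (α β γ : ℝ) (h1 : M.BddMeas a₀) (h2 : M.BddMeas a₁)
    (h3 : M.BddMeas b₀) (h4 : M.BddMeas b₁) :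
    M.BddMeas fun z => qf α β γ (a₀ z) (a₁ z) (b₀ z) (b₁ z) :=
  (((BddMeas.const α).mul (h1.mul h3)).add
    ((BddMeas.const β).mul ((h1.mul h4).add (h2.mul h3)))).add ((BddMeas.const γ).mul (h2.mul h4))

lemma bddMeas_jumpTerm (α β γ Cτ : ℝ) (p : ℕ) (w : M.Broken) :
    M.BddMeas (jumpTerm α β γ Cτ p w) := by
  unfold jumpTerm
  simp only [dotProduct_matA]
  exact (bddMeas_tau Cτ p).mul (bddMeas_qf α β γ (bddMeas_jumpGrad₁ w 0) (bddMeas_jumpGrad₁ w 1)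
    (bddMeas_jumpGrad₁ w 0) (bddMeas_jumpGrad₁ w 1))

lemma bddMeas_penaltyTerm (α β γ Cτ : ℝ) (p : ℕ) (w : M.Broken) :
    M.BddMeas (penaltyTerm α β γ Cτ p w) := by
  have h : M.BddMeas fun z => (matA α β γ *ᵥ avgGrad (D 0 w) z) ⬝ᵥ jumpGrad₁ w z := by
    simp only [matA_dotProduct]
    exact bddMeas_qf α β γ (bddMeas_avgGrad _ 0) (bddMeas_avgGrad _ 1) (bddMeas_jumpGrad₁ w 0)
      (bddMeas_jumpGrad₁ w 1)
  exact (h.add h).sub (bddMeas_jumpTerm α β γ Cτ p w)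

lemma bddMeas_outTerm (hΩ : IsPolygonal Ω) (α β γ : ℝ) (w : M.Broken) :
    M.BddMeas (outTerm α β γ w) := by
  unfold outTerm
  simp only [dotProduct_matA]
  have h := (bddMeas_coord (M := M) 0).mul (bddMeas_outerNormal hΩ 1)
  exact (h.mul ((bddMeas_avg w).pow 2)).add (h.mul (bddMeas_qf α β γ (bddMeas_avgGrad _ 0)
    (bddMeas_avgGrad _ 1) (bddMeas_avgGrad _ 0) (bddMeas_avgGrad _ 1)))

/-- The pointwise balance of the skeleton terms. -/
lemma skeleton_balance (hΩ : IsPolygonal Ω) {α : ℝ} (hα : 0 < α) {θ : ℝ}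
    (hθ : M.LocallyQuasiUniform θ) {K Cτ R ν : ℝ} (hK : 1 ≤ K) (hKθ : θ ≤ K) (hC : 0 < Cτ)
    (hR : 0 < R) (hΩR : closure Ω ⊆ Metric.closedBall 0 R) (hν : 0 < ν) (hCν : R ^ 2 / ν ^ 2 ≤ Cτ)
    {p : ℕ} (hp : 2 ≤ p) (w : M.Broken) {z : Plane} (hz : z ∈ M.skel) (hz' : z ∉ M.exc)
    (hjump : z ∉ frontier Ω → ∀ j, jump w z j = 0)
    (htrace : z ∈ bdryIn Ω ∪ bdryEll Ω → avg w z = 0)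
    (hell : z ∈ bdryEll Ω → ν ≤ |outerNormal Ω z 0|) :
    (bdryOut Ω).indicator (outTerm α (α / 2) (3 * α / 8) w) z +
      (M.skelInt ∪ bdryEll Ω).indicator (jumpTerm α (α / 2) (3 * α / 8) Cτ p w) z -
      traceWeight K Cτ p (qA α (α / 2) (3 * α / 8) (D 0 w) (D 0 w)) z ≤
    jump (bX * (w * w)) z 1 + jump (bX * qA α (α / 2) (3 * α / 8) w w) z 1 -
      2 * (M.skelInt ∪ bdryIn Ω).indicator (fluxTerm α (α / 2) (3 * α / 8) w) z -
      2 * (M.skelInt ∪ bdryEll Ω).indicator (penaltyTerm α (α / 2) (3 * α / 8) Cτ p w) z := by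
  have hTW := traceWeight_nonneg hα hK hC p (D 0 w) z
  obtain ⟨hτ, hTWτ⟩ := avgGrad_le_traceWeight hΩ hα hθ hK hKθ hC hp (D 0 w) hz hz'
  -- Of the penalty, available twice, one copy is the dissipation to be kept, one half goes to the
  -- consistency terms, and the last half is left for the elliptic boundary.
  have hyoung := four_mul_qf_le hα hτ (avgGrad (D 0 w) z 0) (avgGrad (D 0 w) z 1)
    (jumpGrad₁ w z 0) (jumpGrad₁ w z 1)
  have hJ := qf_self_nonneg hα (jumpGrad₁ w z 0) (jumpGrad₁ w z 1)
  have hτJ := mul_nonneg hτ.le hJ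
  have hpen : penaltyTerm α (α / 2) (3 * α / 8) Cτ p w z =
      2 * qf α (α / 2) (3 * α / 8) (avgGrad (D 0 w) z 0) (avgGrad (D 0 w) z 1)
        (jumpGrad₁ w z 0) (jumpGrad₁ w z 1) - jumpTerm α (α / 2) (3 * α / 8) Cτ p w z := by
    rw [penaltyTerm, jumpTerm, matA_dotProduct]; ring
  have hjt : jumpTerm α (α / 2) (3 * α / 8) Cτ p w z = M.tau Cτ p z *
      qf α (α / 2) (3 * α / 8) (jumpGrad₁ w z 0) (jumpGrad₁ w z 1) (jumpGrad₁ w z 0)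
        (jumpGrad₁ w z 1) := by
    rw [jumpTerm, dotProduct_matA]
  rcases M.skel_cases hΩ hz hz' with ⟨i, ha, hf, hn, -⟩ | ⟨i, j, hij, ha, hf, hn, -⟩
  · have hni : z ∉ M.skelInt := fun h => h.2 hf
    have hG := qf_self_nonneg hα (pe (D 0 w i) z) (pe (D 1 w i) z)
    have hj1 : jump (bX * (w * w)) z 1 = z 0 * outerNormal Ω z 1 * avg w z ^ 2 := by
      rw [jump_single ha, avg_single ha, hn]; simp only [Pi.mul_apply, pe_mul, pe_bX]; ring
    have hj2 : jump (bX * qA α (α / 2) (3 * α / 8) w w) z 1 = z 0 * outerNormal Ω z 1 *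
        qf α (α / 2) (3 * α / 8) (pe (D 0 w i) z) (pe (D 1 w i) z) (pe (D 0 w i) z)
          (pe (D 1 w i) z) := by
      rw [jump_single ha, hn]; simp only [Pi.mul_apply, pe_mul, pe_bX, pe_qA]; ring
    rw [hj1, hj2]
    by_cases hn0 : outerNormal Ω z 0 = 0
    · have hnE : z ∉ M.skelInt ∪ bdryEll Ω := by
        rintro (h | h)
        exacts [hni h, h.2 hn0]
      rw [indicator_of_notMem hnE, indicator_of_notMem hnE]
      by_cases hx : z 0 * outerNormal Ω z 1 < 0
      · have hin : z ∈ bdryIn Ω := ⟨hf, hn0, hx⟩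
        have hout : z ∉ bdryOut Ω := fun h => absurd h.2.2 (not_le.2 hx)
        have hm : z ∈ M.skelInt ∪ bdryIn Ω := Or.inr hin
        rw [indicator_of_notMem hout, indicator_of_mem hm, htrace (Or.inl hin)]
        -- On the inflow boundary, twice the flux term is subtracted from one copy of `x n₂ ∇w ·
        -- A∇w`; what remains is its negative, which is nonnegative.
        have hfl : fluxTerm α (α / 2) (3 * α / 8) w z = z 0 * outerNormal Ω z 1 *
            qf α (α / 2) (3 * α / 8) (pe (D 0 w i) z) (pe (D 1 w i) z) (pe (D 0 w i) z)
              (pe (D 1 w i) z) := by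
          rw [fluxTerm, jump_single ha, jump_single ha, avg_single ha, avg_single ha, hn, qf]; ring
        rw [hfl]
        have := mul_nonpos_of_nonpos_of_nonneg hx.le hG
        linarith
      · have hout : z ∈ bdryOut Ω := ⟨hf, hn0, not_lt.1 hx⟩
        have hin : z ∉ M.skelInt ∪ bdryIn Ω := by
          rintro (h | h)
          exacts [hni h, hx h.2.2]
        rw [indicator_of_mem hout, indicator_of_notMem hin, outTerm, dotProduct_matA]
        simp only [avgGrad, avg_single ha]
        linarith
    · have hE : z ∈ bdryEll Ω := ⟨hf, hn0⟩
      have hout : z ∉ bdryOut Ω := fun h => hn0 h.2.1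
      have hin : z ∉ M.skelInt ∪ bdryIn Ω := by
        rintro (h | h)
        exacts [hni h, hn0 h.2.1]
      have hm : z ∈ M.skelInt ∪ bdryEll Ω := Or.inr hE
      rw [indicator_of_notMem hout, indicator_of_notMem hin, indicator_of_mem hm,
        indicator_of_mem hm, htrace (Or.inr hE), hpen, hjt]
      have hJG : qf α (α / 2) (3 * α / 8) (jumpGrad₁ w z 0) (jumpGrad₁ w z 1) (jumpGrad₁ w z 0)
          (jumpGrad₁ w z 1) = outerNormal Ω z 0 ^ 2 * qf α (α / 2) (3 * α / 8) (pe (D 0 w i) z)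
            (pe (D 1 w i) z) (pe (D 0 w i) z) (pe (D 1 w i) z) := by
        simp only [jumpGrad₁, jump_single ha, hn, qf]; ring
      have hxn : |z 0 * outerNormal Ω z 1| ≤ R := by
        have h1 : |z 0| ≤ R := by
          have := hΩR (frontier_subset_closure hf)
          rw [Metric.mem_closedBall, dist_zero_right] at this
          exact (PiLp.norm_apply_le z 0).trans this
        rw [abs_mul]
        calc |z 0| * |outerNormal Ω z 1| ≤ R * 1 :=
              mul_le_mul h1 (abs_outerNormal_le Ω z 1) (abs_nonneg _) hR.le
          _ = R := mul_one R
      -- Half of the penalty equals `τ n₁² G / 2 ≥ R G`, which absorbs the unsigned term `x n₂ G`.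
      -- The bound uses `h ≤ 2R`, `p² ≥ 4`, `|n₁| ≥ ν` and `R² ≤ Cτ ν²`.
      have hτn : 2 * R ≤ M.tau Cτ p z * outerNormal Ω z 0 ^ 2 := by
        have ht : M.tau Cτ p z = Cτ * p ^ 2 / M.h i := by simp [tau, av, ha]
        have hhi : M.h i ≤ 2 * R := Metric.diam_le_of_subset_closedBall hR.le
          ((subset_closure.trans (M.closure_elt_subset i)).trans hΩR)
        have hhp := h_pos i
        have hp2 : (4 : ℝ) ≤ p ^ 2 := by
          have : (2 : ℝ) ≤ p := by exact_mod_cast hp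
          nlinarith
        have hν2 : ν ^ 2 ≤ outerNormal Ω z 0 ^ 2 := by
          rw [← sq_abs (outerNormal Ω z 0)]
          exact pow_le_pow_left₀ hν.le (hell hE) 2
        rw [div_le_iff₀ (by positivity)] at hCν
        rw [ht, div_mul_eq_mul_div, le_div_iff₀ hhp]
        calc 2 * R * M.h i ≤ 2 * R * (2 * R) := mul_le_mul_of_nonneg_left hhi (by positivity)
          _ = R ^ 2 * 4 := by ring
          _ ≤ Cτ * ν ^ 2 * p ^ 2 := mul_le_mul hCν hp2 (by norm_num) (by positivity)
          _ = Cτ * p ^ 2 * ν ^ 2 := by ring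
          _ ≤ Cτ * p ^ 2 * outerNormal Ω z 0 ^ 2 := mul_le_mul_of_nonneg_left hν2 (by positivity)
      rw [hJG] at hyoung hτJ ⊢
      set G := qf α (α / 2) (3 * α / 8) (pe (D 0 w i) z) (pe (D 1 w i) z) (pe (D 0 w i) z)
            (pe (D 1 w i) z)
      have h1 : 2 * R * G ≤ M.tau Cτ p z * (outerNormal Ω z 0 ^ 2 * G) := by
        rw [← mul_assoc]; exact mul_le_mul_of_nonneg_right hτn hG
      have h2 : -(R * G) ≤ z 0 * outerNormal Ω z 1 * G := by
        rw [← neg_mul]; exact mul_le_mul_of_nonneg_right (abs_le.1 hxn).1 hG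
      linarith
  · have hsi : z ∈ M.skelInt := ⟨hz, hf⟩
    have hout : z ∉ bdryOut Ω := fun h => hf h.1
    have hm : z ∈ M.skelInt ∪ bdryIn Ω := Or.inl hsi
    have hm' : z ∈ M.skelInt ∪ bdryEll Ω := Or.inl hsi
    rw [indicator_of_notMem hout, indicator_of_mem hm', indicator_of_mem hm,
      indicator_of_mem hm', hpen, hjt]
    have hj1 : jump (bX * (w * w)) z 1 = 0 := by
      have h3 := hjump hf 1
      rw [jump_pair hij ha hn] at h3 ⊢
      simp only [Pi.mul_apply, pe_mul, pe_bX]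
      linear_combination (z 0 * (pe (w i) z + pe (w j) z)) * h3
    -- The polarised identity `a² - b² = 2 (a - b) (a + b)/2` for the form of `A`: on interfaces the
    -- fluxes cancel exactly.
    have hj2 : jump (bX * qA α (α / 2) (3 * α / 8) w w) z 1 =
        2 * fluxTerm α (α / 2) (3 * α / 8) w z := by
      rw [fluxTerm, jump_pair hij ha hn, jump_pair hij ha hn, jump_pair hij ha hn,
        avg_pair hij ha, avg_pair hij ha]
      simp only [Pi.mul_apply, pe_mul, pe_bX, pe_qA, qf]
      ring
    rw [hj1, hj2]
    linarith

lemma s₁_nonneg {κ lam : ℝ} (hκ : 0 ≤ κ) (hlam : 0 ≤ lam) (w : M.Broken) : 0 ≤ s₁ κ lam w w := by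
  unfold s₁
  refine integral_nonneg fun z => ?_
  have h1 : ∀ v : Fin 2 → ℝ, 0 ≤ v ⬝ᵥ v := fun v => by
    simp only [dotProduct, Fin.sum_univ_two]; nlinarith [mul_self_nonneg (v 0), mul_self_nonneg (v 1)]
  have h2 : 0 ≤ M.av (fun i => |z 0 * outerNormal (M.elt i) z 1|) z :=
    div_nonneg (Finset.sum_nonneg fun i _ => abs_nonneg _) (Nat.cast_nonneg _)
  exact mul_nonneg (div_nonneg h2 zero_le_two)
    (add_nonneg (mul_nonneg hκ (h1 _)) (mul_nonneg hlam (h1 _)))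

/-- Coercivity of the discrete bilinear form. -/
theorem coercivity (hΩ : IsPolygonal Ω) {α : ℝ} (hα : 0 < α) (hα2 : α < 1 / 2) {σ θ : ℝ}
    (hσ : M.ShapeRegular σ)
    (hθ : M.LocallyQuasiUniform θ) {K Cτ R ν : ℝ} (hK : 1 ≤ K) (hKθ : θ ≤ K) (hC : 0 < Cτ)
    (hR : 0 < R) (hΩR : closure Ω ⊆ Metric.closedBall 0 R) (hν : 0 < ν)
    (hell : ∀ᵐ z ∂(μH[1] : Measure Plane), z ∈ bdryEll Ω → ν ≤ |outerNormal Ω z 0|)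
    (hCν : R ^ 2 / ν ^ 2 ≤ Cτ) (hCK : 768 * K * |σ| ≤ Cτ) {κ lam : ℝ} (hκ : 0 ≤ κ)
    (hlam : 0 ≤ lam) {p : ℕ} (hp : 2 ≤ p) {w : M.Broken} (hw : w ∈ M.Vh p) :
    1 / (8 * R ^ 2) * ip Ω (toFun w) (toFun w) +
      ipA Ω (matA α (α / 2) (3 * α / 8)) (grad w) (grad w) +
      dissipation (matA α (α / 2) (3 * α / 8)) κ lam Cτ p w ≤
    2 * (ip Ω (toFun (D 0 w)) (toFun (D 0 w)) + ip Ω (toFun (xDy w)) (toFun w) +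
        ipA Ω (matA α (α / 2) (3 * α / 8)) (grad (D 0 w)) (grad (D 0 w)) +
        ipA Ω (matA α (α / 2) (3 * α / 8)) (grad (xDy w)) (grad w) +
        sh α (α / 2) (3 * α / 8) κ lam Cτ p w w) := by
  obtain ⟨hdeg, hH1⟩ := hw
  have hin := (measurableSet_skelInt (M := M)).union (measurableSet_bdryIn hΩ)
  have hell' := (measurableSet_skelInt (M := M)).union (measurableSet_bdryEll hΩ)
  have hins : M.skelInt ∪ bdryIn Ω ⊆ M.skel := union_subset skelInt_subset (bdryIn_subset hΩ)
  have hells : M.skelInt ∪ bdryEll Ω ⊆ M.skel := union_subset skelInt_subset (bdryEll_subset hΩ)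
  have hΩx : ∀ z ∈ Ω, |z 0| ≤ R := fun z hz => by
    have := hΩR (subset_closure hz)
    rw [Metric.mem_closedBall, dist_zero_right] at this
    exact (PiLp.norm_apply_le z 0).trans this
  -- skeleton terms
  have hTW := integral_traceWeight_le (M := M) hα hσ hK hC hCK hp (D 0 w)
    fun i => (totalDegree_pderiv_le 0 _).trans (hdeg i)
  have b1 := (bddMeas_outTerm (M := M) hΩ α (α / 2) (3 * α / 8) w).indicator
    (measurableSet_bdryOut hΩ)
  have b2 := (bddMeas_jumpTerm (M := M) α (α / 2) (3 * α / 8) Cτ p w).indicator hell'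
  have b3 := bddMeas_traceWeight (M := M) K Cτ p (qA α (α / 2) (3 * α / 8) (D 0 w) (D 0 w))
  have b4 := bddMeas_jump (M := M) (bX * (w * w)) 1
  have b5 := bddMeas_jump (M := M) (bX * qA α (α / 2) (3 * α / 8) w w) 1
  have b6 := (bddMeas_fluxTerm (M := M) α (α / 2) (3 * α / 8) w).indicator hin
  have b7 := (bddMeas_penaltyTerm (M := M) α (α / 2) (3 * α / 8) Cτ p w).indicator hell'
  have i1 := b1.integrableOn (Subset.refl M.skel)
  have i2 := b2.integrableOn (Subset.refl M.skel)
  have i3 := b3.integrableOn (Subset.refl M.skel)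
  have i4 := b4.integrableOn (Subset.refl M.skel)
  have i5 := b5.integrableOn (Subset.refl M.skel)
  have i6 := (b6.integrableOn (Subset.refl M.skel)).const_mul 2
  have i7 := (b7.integrableOn (Subset.refl M.skel)).const_mul 2
  have hskel := integral_mono_ae ((i1.add i2).sub i3) (((i4.add i5).sub i6).sub i7) (by
    filter_upwards [trace_of_mem_H1zero hΩ hH1, ae_regular, ae_restrict_of_ae hell]
      with z ⟨h1, h2⟩ ⟨hzs, hze⟩ h3
    exact skeleton_balance hΩ hα hθ hK hKθ hC hR hΩR hν hCν hp w hzs hze h1 h2 h3)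
  have s1 := integral_sub (i1.add i2) i3
  have s2 := integral_add i1 i2
  have s3 := integral_sub ((i4.add i5).sub i6) i7
  have s4 := integral_sub (i4.add i5) i6
  have s5 := integral_add i4 i5
  simp only [Pi.add_apply, Pi.sub_apply] at hskel s1 s2 s3 s4 s5
  rw [s1, s2, s3, s4, s5, integral_const_mul, integral_const_mul] at hskel
  have hsh : sh α (α / 2) (3 * α / 8) κ lam Cτ p w w =
      - (∫ z in M.skel, (M.skelInt ∪ bdryIn Ω).indicator (fluxTerm α (α / 2) (3 * α / 8) w) z ∂μH[1])
      + s₁ κ lam w w -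
      ∫ z in M.skel, (M.skelInt ∪ bdryEll Ω).indicator
        (penaltyTerm α (α / 2) (3 * α / 8) Cτ p w) z ∂μH[1] := by
    rw [← setIntegral_eq_indicator hin hins, ← setIntegral_eq_indicator hell' hells]; rfl
  have hdis : dissipation (matA α (α / 2) (3 * α / 8)) κ lam Cτ p w =
      (∫ z in M.skel, (bdryOut Ω).indicator (outTerm α (α / 2) (3 * α / 8) w) z ∂μH[1]) +
      bint (qA α (α / 2) (3 * α / 8) (D 0 w) (D 0 w)) + s₁ κ lam w w +
      ∫ z in M.skel, (M.skelInt ∪ bdryEll Ω).indicator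
        (jumpTerm α (α / 2) (3 * α / 8) Cτ p w) z ∂μH[1] := by
    have hn := (bddMeas_coord (M := M) 0).mul (bddMeas_outerNormal hΩ 1)
    have g1 := (hn.mul ((bddMeas_avg w).pow 2)).integrableOn (bdryOut_subset hΩ)
    have g2 := (hn.mul (bddMeas_qf α (α / 2) (3 * α / 8) (bddMeas_avgGrad w 0)
      (bddMeas_avgGrad w 1) (bddMeas_avgGrad w 0) (bddMeas_avgGrad w 1))).integrableOn
      (bdryOut_subset hΩ)
    have g3 := integral_add g1 g2
    rw [← setIntegral_eq_indicator (measurableSet_bdryOut hΩ) (bdryOut_subset hΩ),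
      ← setIntegral_eq_indicator hell' hells]
    unfold outTerm jumpTerm dissipation
    simp only [dotProduct_matA]
    rw [g3, ipA_eq hΩ]
  have hs1 := s₁_nonneg (M := M) hκ hlam w
  -- bulk terms
  have t1 := two_mul_ip_transport hΩ w
  have t2 := two_mul_ipA_transport hΩ α (α / 2) (3 * α / 8) w
  have hpo := poincare hΩ hΩx hH1
  -- The volume terms after `‖√A ∇w‖²` and the Poincaré share `‖w_x‖²/2` are removed. Completing the
  -- square gives nonnegative coefficients, by `α < 1/2`.
  have hbulk : 0 ≤ bint ((3 / 2 - α) • (D 0 w * D 0 w) + α • (D 0 w * D 1 w) +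
      (5 * α / 8) • (D 1 w * D 1 w)) := by
    refine bint_nonneg fun i z => ?_
    have : pe (((3 / 2 - α) • (D 0 w * D 0 w) + α • (D 0 w * D 1 w) +
        (5 * α / 8) • (D 1 w * D 1 w)) i) z =
        (1 / 2 - α) * pe (D 0 w i) z ^ 2 + (pe (D 0 w i) z + α / 2 * pe (D 1 w i) z) ^ 2 +
        α * (5 / 8 - α / 4) * pe (D 1 w i) z ^ 2 := by
      simp [pe]; ring
    rw [this]
    have h1 : 0 ≤ 1 / 2 - α := by linarith
    have h2 : 0 ≤ 5 / 8 - α / 4 := by linarith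
    positivity
  have hq : bint (qA α (α / 2) (3 * α / 8) w w) = α * bint (D 0 w * D 0 w) +
      α / 2 * (bint (D 0 w * D 1 w) + bint (D 0 w * D 1 w)) +
      3 * α / 8 * bint (D 1 w * D 1 w) := by
    rw [qA, bint_add, bint_add, bint_smul, bint_smul, bint_smul, bint_add, mul_comm (D 1 w) (D 0 w)]
  rw [bint_add, bint_add, bint_smul, bint_smul, bint_smul] at hbulk
  have hpo' : 1 / (8 * R ^ 2) * bint (w * w) ≤ 1 / 2 * bint (D 0 w * D 0 w) := by
    calc 1 / (8 * R ^ 2) * bint (w * w) ≤ 1 / (8 * R ^ 2) * (4 * R ^ 2 * bint (D 0 w * D 0 w)) :=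
          mul_le_mul_of_nonneg_left hpo (by positivity)
      _ = 1 / 2 * bint (D 0 w * D 0 w) := by field_simp; ring
  rw [hsh, hdis, ip_eq hΩ w w, ip_eq hΩ (D 0 w), ipA_eq hΩ _ _ _ w w, hq,
    ipA_eq hΩ _ _ _ (D 0 w) (D 0 w)]
  linarith

end Triangulation

namespace Triangulation

variable {Ω : Set Plane} {M : Triangulation Ω}

/-! ### Bilinear forms of broken polynomials -/

/-- The index set of the broken monomials with exponent `m ≤ (p, p)`. -/
def basisIndex (M : Triangulation Ω) (p : ℕ) : Finset (Fin M.N × (Fin 2 →₀ ℕ)) :=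
  Finset.univ ×ˢ Finset.Icc 0 (Finsupp.equivFunOnFinite.symm fun _ => p)

/-- The coefficient functionals. -/
def coef (x : Fin M.N × (Fin 2 →₀ ℕ)) (w : M.Broken) : ℝ := MvPolynomial.coeff x.2 (w x.1)

lemma coef_eq_zero {p : ℕ} {w : M.Broken} (hw : ∀ i, (w i).totalDegree ≤ p)
    {x : Fin M.N × (Fin 2 →₀ ℕ)} (hx : x ∉ basisIndex M p) : coef x w = 0 := by
  by_contra hne
  refine hx (Finset.mem_product.2 ⟨Finset.mem_univ _, Finset.mem_Icc.2 ⟨bot_le, fun k => ?_⟩⟩)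
  refine le_trans ?_ ((MvPolynomial.le_totalDegree (MvPolynomial.mem_support_iff.2 hne)).trans
    (hw x.1))
  by_cases hk : k ∈ x.2.support
  · exact Finset.single_le_sum (f := fun k => x.2 k) (fun _ _ => Nat.zero_le _) hk
  · simp [Finsupp.notMem_support_iff.1 hk]

/-- The basis of broken monomials. -/
def mono (x : Fin M.N × (Fin 2 →₀ ℕ)) : M.Broken := Pi.single x.1 (MvPolynomial.monomial x.2 1)

lemma eq_sum_mono {p : ℕ} {w : M.Broken} (hw : ∀ x ∉ basisIndex M p, coef x w = 0) :
    w = ∑ x ∈ basisIndex M p, coef x w • mono x := by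
  funext i
  ext m
  rw [Finset.sum_apply, MvPolynomial.coeff_sum]
  simp only [Pi.smul_apply, MvPolynomial.coeff_smul, smul_eq_mul, mono]
  rw [Finset.sum_eq_single (i, m)]
  · simp [coef]
  · rintro ⟨j, n⟩ - hne
    by_cases hj : i = j
    · subst hj
      have : n ≠ m := fun h => hne (by rw [h])
      simp [MvPolynomial.coeff_monomial, this]
    · simp [Pi.single_eq_of_ne hj]
  · intro h
    rw [hw _ h, zero_mul]

lemma bilin_eq_sum {p : ℕ} (B : M.Broken →ₗ[ℝ] M.Broken →ₗ[ℝ] ℝ) {w v : M.Broken}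
    (hw : ∀ x ∉ basisIndex M p, coef x w = 0) (hv : ∀ x ∉ basisIndex M p, coef x v = 0) :
    B w v = ∑ x ∈ basisIndex M p, ∑ y ∈ basisIndex M p,
      B (mono x) (mono y) * (coef x w * coef y v) := by
  conv_lhs => rw [eq_sum_mono hw, eq_sum_mono hv]
  simp only [map_sum, LinearMap.sum_apply, map_smul, LinearMap.smul_apply, smul_eq_mul]
  rw [Finset.sum_comm]
  refine Finset.sum_congr rfl fun x _ => ?_
  rw [Finset.mul_sum]
  exact Finset.sum_congr rfl fun y _ => by ring

/-- Quadratic functionals of broken polynomials. -/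
def IsQuad (Q : M.Broken → ℝ) : Prop :=
  ∃ B : M.Broken →ₗ[ℝ] M.Broken →ₗ[ℝ] ℝ, ∀ w, Q w = B w w

namespace IsQuad

lemma add {Q Q' : M.Broken → ℝ} (h : IsQuad Q) (h' : IsQuad Q') :
    IsQuad fun w => Q w + Q' w := by
  obtain ⟨B, hB⟩ := h
  obtain ⟨B', hB'⟩ := h'
  exact ⟨B + B', fun w => congrArg₂ (· + ·) (hB w) (hB' w)⟩

lemma const_mul (c : ℝ) {Q : M.Broken → ℝ} (h : IsQuad Q) : IsQuad fun w => c * Q w := by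
  obtain ⟨B, hB⟩ := h
  exact ⟨c • B, fun w => congrArg (c * ·) (hB w)⟩

/-- In the coefficients of `U` the functional is a finite quadratic polynomial. This supplies the
integrability in time of the terms to be integrated. -/
lemma continuousOn {Q : M.Broken → ℝ} (h : IsQuad Q) {p : ℕ} {U : ℝ → M.Broken} {s : Set ℝ}
    (hU : ∀ i m, ContinuousOn (fun t => MvPolynomial.coeff m (U t i)) s)
    (hd : ∀ t ∈ s, ∀ i, (U t i).totalDegree ≤ p) : ContinuousOn (fun t => Q (U t)) s := by
  obtain ⟨B, hB⟩ := h
  refine ContinuousOn.congr (f := fun t => ∑ x ∈ basisIndex M p, ∑ y ∈ basisIndex M p,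
    B (mono x) (mono y) * (coef x (U t) * coef y (U t))) ?_ fun t ht => ?_
  · exact continuousOn_finsetSum _ fun x _ => continuousOn_finsetSum _ fun y _ =>
      continuousOn_const.mul ((hU x.1 x.2).mul (hU y.1 y.2))
  · rw [hB]
    exact bilin_eq_sum B (fun x => coef_eq_zero (hd t ht)) (fun x => coef_eq_zero (hd t ht))

end IsQuad

/-- A linear functional of broken polynomials at each point of the skeleton. -/
def IsLin (L : M.Broken → Plane → ℝ) : Prop :=
  (∀ w v z, L (w + v) z = L w z + L v z) ∧ (∀ (c : ℝ) w z, L (c • w) z = c * L w z) ∧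
    ∀ w, M.BddMeas (L w)

lemma D_add (j : Fin 2) (w v : M.Broken) : D j (w + v) = D j w + D j v := by
  funext i; simp [D]

lemma D_smul (j : Fin 2) (c : ℝ) (w : M.Broken) : D j (c • w) = c • D j w := by
  funext i; simp [D]

lemma IsLin.comp_D {L : M.Broken → Plane → ℝ} (h : IsLin L) (j : Fin 2) :
    IsLin fun w => L (D j w) :=
  ⟨fun w v z => by simp only [D_add, h.1], fun c w z => by simp only [D_smul, h.2.1],
    fun w => h.2.2 _⟩

lemma isLin_jump (k : Fin 2) : IsLin fun (w : M.Broken) z => jump w z k := by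
  refine ⟨fun w v z => ?_, fun c w z => ?_, fun w => bddMeas_jump w k⟩
  · simp [jump, add_mul, Finset.sum_add_distrib]
  · simp [jump, mul_assoc, Finset.mul_sum]

lemma isLin_avg : IsLin (avg : M.Broken → Plane → ℝ) := by
  refine ⟨fun w v z => ?_, fun c w z => ?_, fun w => bddMeas_avg w⟩
  · simp [avg, av, add_div, Finset.sum_add_distrib]
  · simp [avg, av, ← mul_div_assoc, Finset.mul_sum]

lemma isQuad_setIntegral {L L' : M.Broken → Plane → ℝ} (h : IsLin L) (h' : IsLin L')
    {K : Plane → ℝ} (hK : M.BddMeas K) {s : Set Plane} (hs : s ⊆ M.skel) :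
    IsQuad fun w => ∫ z in s, K z * (L w z * L' w z) ∂μH[1] := by
  have hi : ∀ w v, IntegrableOn (fun z => K z * (L w z * L' v z)) s μH[1] := fun w v =>
    (hK.mul ((h.2.2 w).mul (h'.2.2 v))).integrableOn hs
  refine ⟨LinearMap.mk₂ ℝ (fun w v => ∫ z in s, K z * (L w z * L' v z) ∂μH[1]) ?_ ?_ ?_ ?_,
    fun w => rfl⟩
  · intro w₁ w₂ v
    rw [← integral_add (hi _ _) (hi _ _)]
    simp only [h.1, add_mul, mul_add]
  · intro c w v
    rw [smul_eq_mul, ← integral_const_mul]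
    refine integral_congr_ae (Filter.Eventually.of_forall fun z => ?_)
    simp only [h.2.1]; ring
  · intro w v₁ v₂
    rw [← integral_add (hi _ _) (hi _ _)]
    simp only [h'.1, mul_add]
  · intro c w v
    rw [smul_eq_mul, ← integral_const_mul]
    refine integral_congr_ae (Filter.Eventually.of_forall fun z => ?_)
    simp only [h'.2.1]; ring

lemma isQuad_setIntegral_qf (α β γ : ℝ) {L L' : M.Broken → Plane → ℝ} (h : IsLin L)
    (h' : IsLin L') {K : Plane → ℝ} (hK : M.BddMeas K) {s : Set Plane} (hs : s ⊆ M.skel) :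
    IsQuad fun w => ∫ z in s, K z * qf α β γ (L w z) (L' w z) (L w z) (L' w z) ∂μH[1] := by
  have e : ∀ w, ∫ z in s, K z * qf α β γ (L w z) (L' w z) (L w z) (L' w z) ∂μH[1] =
      α * (∫ z in s, K z * (L w z * L w z) ∂μH[1]) +
      2 * β * (∫ z in s, K z * (L w z * L' w z) ∂μH[1]) +
      γ * ∫ z in s, K z * (L' w z * L' w z) ∂μH[1] := fun w => by
    have i1 := ((hK.mul ((h.2.2 w).mul (h.2.2 w))).integrableOn hs).const_mul α
    have i2 := ((hK.mul ((h.2.2 w).mul (h'.2.2 w))).integrableOn hs).const_mul (2 * β)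
    have i3 := ((hK.mul ((h'.2.2 w).mul (h'.2.2 w))).integrableOn hs).const_mul γ
    rw [← integral_const_mul, ← integral_const_mul, ← integral_const_mul, ← integral_add i1 i2]
    refine Eq.trans (integral_congr_ae ?_) (integral_add (i1.add i2) i3)
    refine (Filter.Eventually.of_forall fun z => ?_)
    simp only [qf]; ring
  simp only [e]
  exact (((isQuad_setIntegral h h hK hs).const_mul α).add
    ((isQuad_setIntegral h h' hK hs).const_mul (2 * β))).add
    ((isQuad_setIntegral h' h' hK hs).const_mul γ)

/-- The bilinear form `(w, v) + (∇w, A ∇v)`, weighted. -/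
def energyForm (M : Triangulation Ω) (c α β γ : ℝ) : M.Broken →ₗ[ℝ] M.Broken →ₗ[ℝ] ℝ :=
  LinearMap.mk₂ ℝ (fun w v => c * bint (w * v) + bint (qA α β γ w v))
    (fun w₁ w₂ v => by
      have : qA α β γ (w₁ + w₂) v = qA α β γ w₁ v + qA α β γ w₂ v := by
        simp only [qA, D_add, add_mul, smul_add]; abel
      rw [this, add_mul, bint_add, bint_add]; ring)
    (fun c w v => by
      have : qA α β γ (c • w) v = c • qA α β γ w v := by
        simp only [qA, D_smul, smul_mul_assoc, smul_add, smul_comm c]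
      rw [this, smul_mul_assoc, bint_smul, bint_smul, smul_eq_mul]; ring)
    (fun w v₁ v₂ => by
      have : qA α β γ w (v₁ + v₂) = qA α β γ w v₁ + qA α β γ w v₂ := by
        simp only [qA, D_add, mul_add, smul_add]; abel
      rw [this, mul_add, bint_add, bint_add]; ring)
    (fun c w v => by
      have : qA α β γ w (c • v) = c • qA α β γ w v := by
        simp only [qA, D_smul, mul_smul_comm, smul_add, smul_comm c]
      rw [this, mul_smul_comm, bint_smul, bint_smul, smul_eq_mul]; ring)

lemma energyForm_apply (hΩ : IsPolygonal Ω) (c α β γ : ℝ) (w v : M.Broken) :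
    energyForm M c α β γ w v =
      c * ip Ω (toFun w) (toFun v) + ipA Ω (matA α β γ) (grad w) (grad v) := by
  rw [ip_eq hΩ, ipA_eq hΩ]; rfl

lemma isQuad_weighted (hΩ : IsPolygonal Ω) (c α β γ : ℝ) : IsQuad fun w : M.Broken =>
    c * ip Ω (toFun w) (toFun w) + ipA Ω (matA α β γ) (grad w) (grad w) :=
  ⟨energyForm M c α β γ, fun w => (energyForm_apply hΩ c α β γ w w).symm⟩

lemma isQuad_s₁ (κ lam : ℝ) : IsQuad fun w : M.Broken => s₁ κ lam w w := by
  have hK : M.BddMeas fun z => M.av (fun i => |z 0 * outerNormal (M.elt i) z 1|) z / 2 :=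
    (bddMeas_av fun i => ((bddMeas_coord 0).mul (bddMeas_outerNormal_elt i 1)).abs).div_const 2
  have hL : ∀ j k : Fin 2, IsLin fun (w : M.Broken) z => jump (D j w) z k := fun j k =>
    (isLin_jump k).comp_D j
  -- The multiple `κ` of the Euclidean product is the form `qf κ 0 κ`.
  have e : ∀ w : M.Broken, s₁ κ lam w w =
      (∫ z in M.skelInt, (M.av (fun i => |z 0 * outerNormal (M.elt i) z 1|) z / 2) *
        qf κ 0 κ (jump (D 0 w) z 0) (jump (D 0 w) z 1) (jump (D 0 w) z 0) (jump (D 0 w) z 1)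
          ∂μH[1]) +
      ∫ z in M.skelInt, (M.av (fun i => |z 0 * outerNormal (M.elt i) z 1|) z / 2) *
        qf lam 0 lam (jump (D 1 w) z 0) (jump (D 1 w) z 1) (jump (D 1 w) z 0) (jump (D 1 w) z 1)
          ∂μH[1] := fun w => by
    rw [← integral_add]
    · refine integral_congr_ae (Filter.Eventually.of_forall fun z => ?_)
      simp only [qf, dotProduct, Fin.sum_univ_two]; ring
    · exact (hK.mul (bddMeas_qf κ 0 κ (bddMeas_jump _ _) (bddMeas_jump _ _) (bddMeas_jump _ _)
        (bddMeas_jump _ _))).integrableOn skelInt_subset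
    · exact (hK.mul (bddMeas_qf lam 0 lam (bddMeas_jump _ _) (bddMeas_jump _ _) (bddMeas_jump _ _)
        (bddMeas_jump _ _))).integrableOn skelInt_subset
  simp only [e]
  exact (isQuad_setIntegral_qf κ 0 κ (hL 0 0) (hL 0 1) hK skelInt_subset).add
    (isQuad_setIntegral_qf lam 0 lam (hL 1 0) (hL 1 1) hK skelInt_subset)

lemma isQuad_dissipation (hΩ : IsPolygonal Ω) (α β γ κ lam Cτ : ℝ) (p : ℕ) :
    IsQuad fun w : M.Broken => dissipation (matA α β γ) κ lam Cτ p w := by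
  have hK := (bddMeas_coord (M := M) 0).mul (bddMeas_outerNormal hΩ 1)
  unfold dissipation
  simp only [dotProduct_matA, pow_two]
  have h3 : IsQuad fun w : M.Broken => ipA Ω (matA α β γ) (grad (D 0 w)) (grad (D 0 w)) := by
    -- The weight `0` removes the `L²` part, and both arguments are composed with the derivative in
    -- `x`.
    refine ⟨(energyForm M 0 α β γ).compl₁₂ ?_ ?_, fun w => ?_⟩
    iterate 2 exact { toFun := D 0, map_add' := D_add 0, map_smul' := D_smul 0 }
    simpa using (energyForm_apply hΩ 0 α β γ (D 0 w) (D 0 w)).symm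
  exact ((((isQuad_setIntegral isLin_avg isLin_avg hK (bdryOut_subset hΩ)).add
    (isQuad_setIntegral_qf α β γ (isLin_avg.comp_D 0) (isLin_avg.comp_D 1) hK
      (bdryOut_subset hΩ))).add h3).add (isQuad_s₁ κ lam)).add
    (isQuad_setIntegral_qf α β γ ((isLin_jump 0).comp_D 0) ((isLin_jump 0).comp_D 1)
      (bddMeas_tau Cτ p) (union_subset skelInt_subset (bdryEll_subset hΩ)))

end Triangulation

/-! ### The energy balance in time -/

lemma absolutelyContinuousOnInterval_sum {ι : Type*} (s : Finset ι) {f : ι → ℝ → ℝ} {a b : ℝ}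
    (hf : ∀ i, AbsolutelyContinuousOnInterval (f i) a b) :
    AbsolutelyContinuousOnInterval (fun t => ∑ i ∈ s, f i t) a b := by
  classical
  induction s using Finset.induction_on with
  | empty =>
    simpa using ((LipschitzWith.const (0 : ℝ)).lipschitzOnWith
      (s := uIcc a b)).absolutelyContinuousOnInterval
  | insert i s hi ih => simpa [Finset.sum_insert hi] using (hf i).fun_add ih

namespace Triangulation

variable {Ω : Set Plane} {M : Triangulation Ω}

/-- The value `B(U, U)` in terms of the coefficients. -/
def quadCoef (p : ℕ) (B : M.Broken →ₗ[ℝ] M.Broken →ₗ[ℝ] ℝ) (U : ℝ → M.Broken) (t : ℝ) : ℝ :=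
  ∑ x ∈ basisIndex M p, ∑ y ∈ basisIndex M p,
    B (mono x) (mono y) * (coef x (U t) * coef y (U t))

lemma quadCoef_eq {p : ℕ} (B : M.Broken →ₗ[ℝ] M.Broken →ₗ[ℝ] ℝ) {U : ℝ → M.Broken} {t : ℝ}
    (hd : ∀ i, (U t i).totalDegree ≤ p) : quadCoef p B U t = B (U t) (U t) :=
  (bilin_eq_sum B (fun _ => coef_eq_zero hd) (fun _ => coef_eq_zero hd)).symm

/-- Sums and products of absolutely continuous coefficients. The coefficient sum is used because it
agrees with `B(U, U)` where the degree bound holds and involves only scalar functions of time. -/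
lemma absolutelyContinuous_quadCoef (p : ℕ) (B : M.Broken →ₗ[ℝ] M.Broken →ₗ[ℝ] ℝ)
    {U : ℝ → M.Broken} {a b : ℝ}
    (hU : ∀ i m, AbsolutelyContinuousOnInterval (fun t => MvPolynomial.coeff m (U t i)) a b) :
    AbsolutelyContinuousOnInterval (quadCoef p B U) a b :=
  absolutelyContinuousOnInterval_sum _ fun x => absolutelyContinuousOnInterval_sum _ fun y =>
    ((hU x.1 x.2).fun_mul (hU y.1 y.2)).const_mul _

lemma hasDerivAt_quadCoef {p : ℕ} (B : M.Broken →ₗ[ℝ] M.Broken →ₗ[ℝ] ℝ) {U : ℝ → M.Broken}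
    {Ut : M.Broken} {s : Set ℝ} (hs : IsOpen s) {t : ℝ} (ht : t ∈ s)
    (hd : ∀ r ∈ s, ∀ i, (U r i).totalDegree ≤ p)
    (hU : ∀ i m, HasDerivAt (fun r => MvPolynomial.coeff m (U r i))
      (MvPolynomial.coeff m (Ut i)) t) :
    HasDerivAt (quadCoef p B U) (B Ut (U t) + B (U t) Ut) t := by
  have h1 : ∀ x ∉ basisIndex M p, coef x (U t) = 0 := fun x => coef_eq_zero (hd t ht)
  -- Coefficients of too high degree vanish on a neighbourhood of `t`, hence so do their
  -- derivatives. This is why `s` must be open.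
  have h2 : ∀ x ∉ basisIndex M p, coef x Ut = 0 := fun x hx => by
    refine (hU x.1 x.2).unique ((hasDerivAt_const t (0 : ℝ)).congr_of_eventuallyEq ?_)
    filter_upwards [hs.mem_nhds ht] with r hr using coef_eq_zero (hd r hr) hx
  rw [bilin_eq_sum B h2 h1, bilin_eq_sum B h1 h2, ← Finset.sum_add_distrib]
  simp only [← Finset.sum_add_distrib, ← mul_add]
  exact HasDerivAt.fun_sum fun x _ => HasDerivAt.fun_sum fun y _ =>
    ((hU x.1 x.2).mul (hU y.1 y.2)).const_mul _

/-- The energy estimate for a forcing that is controlled by `F`. -/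
theorem stabLHS_le (hΩ : IsPolygonal Ω) {α β γ κ lam Cτ tf c₀ ζ : ℝ} {p : ℕ} (htf : 0 < tf)
    (hco : ∀ w ∈ M.Vh p, c₀ * ip Ω (toFun w) (toFun w) + ipA Ω (matA α β γ) (grad w) (grad w) +
      dissipation (matA α β γ) κ lam Cτ p w ≤
      2 * (ip Ω (toFun (D 0 w)) (toFun (D 0 w)) + ip Ω (toFun (xDy w)) (toFun w) +
        ipA Ω (matA α β γ) (grad (D 0 w)) (grad (D 0 w)) +
        ipA Ω (matA α β γ) (grad (xDy w)) (grad w) + sh α β γ κ lam Cτ p w w))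
    {u₀ : Plane → ℝ} {f : ℝ → Plane → ℝ} {g : ℝ → Plane → Fin 2 → ℝ} {U : ℝ → M.Broken}
    (hU : M.IsFESolution p α β γ κ lam Cτ tf u₀ f g U) {F : ℝ → ℝ}
    (hF : IntervalIntegrable F volume 0 tf)
    (hfF : ∀ᵐ t ∂(volume.restrict (Ioc 0 tf)), 2 * (ip Ω (f t) (toFun (U t)) +
      ipA Ω (matA α β γ) (g t) (grad (U t))) ≤ ζ * (c₀ * ip Ω (toFun (U t)) (toFun (U t)) +
        ipA Ω (matA α β γ) (grad (U t)) (grad (U t))) + F t) :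
    stabLHS (matA α β γ) κ lam Cτ p c₀ ζ tf U ≤
      (∫ t in (0 : ℝ)..tf, F t) + energy (matA α β γ) (U 0) := by
  set B := energyForm M 1 α β γ
  have hB : ∀ w v, B w v = ip Ω (toFun w) (toFun v) + ipA Ω (matA α β γ) (grad w) (grad v) :=
    fun w v => by rw [energyForm_apply hΩ, one_mul]
  have hdeg : ∀ t ∈ Icc 0 tf, ∀ i, (U t i).totalDegree ≤ p := fun t ht => (hU.mem t ht).1
  have hcont : ∀ i m, ContinuousOn (fun t => MvPolynomial.coeff m (U t i)) (uIcc 0 tf) :=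
    fun i m => (hU.absolutelyContinuous i m).continuousOn
  rw [← uIcc_of_le htf.le] at hdeg
  have hmid : IntervalIntegrable (fun t => c₀ * ip Ω (toFun (U t)) (toFun (U t)) +
      ipA Ω (matA α β γ) (grad (U t)) (grad (U t))) volume 0 tf :=
    ((isQuad_weighted hΩ c₀ α β γ).continuousOn hcont hdeg).intervalIntegrable
  have hdis : IntervalIntegrable (fun t => dissipation (matA α β γ) κ lam Cτ p (U t)) volume 0 tf :=
    ((isQuad_dissipation hΩ α β γ κ lam Cτ p).continuousOn hcont hdeg).intervalIntegrable
  rw [uIcc_of_le htf.le] at hdeg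
  have hac := absolutelyContinuous_quadCoef p B hU.absolutelyContinuous
  have hE : ∀ t ∈ Icc 0 tf, quadCoef p B U t = energy (matA α β γ) (U t) := fun t ht => by
    rw [quadCoef_eq B (hdeg t ht), hB, energy]
  -- By absolute continuity the energy difference is the integral of the almost everywhere
  -- derivative.
  have hint := hac.integral_deriv_eq_sub
  rw [hE 0 (left_mem_Icc.2 htf.le), hE tf (right_mem_Icc.2 htf.le)] at hint
  have hmono : ∫ t in (0 : ℝ)..tf, deriv (quadCoef p B U) t ≤
      ∫ t in (0 : ℝ)..tf, (F t - (1 - ζ) * (c₀ * ip Ω (toFun (U t)) (toFun (U t)) +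
        ipA Ω (matA α β γ) (grad (U t)) (grad (U t))) -
        dissipation (matA α β γ) κ lam Cτ p (U t)) := by
    refine intervalIntegral.integral_mono_ae_restrict htf.le hac.intervalIntegrable_deriv
      ((hF.sub (hmid.const_mul _)).sub hdis) ?_
    -- The end points are dropped so that the two-sided derivative sees the degree bound on both
    -- sides.
    rw [← Measure.restrict_congr_set (Ioo_ae_eq_Icc (μ := volume) (a := (0 : ℝ)) (b := tf))]
    have hsub : (volume : Measure ℝ).restrict (Ioo 0 tf) ≤ volume.restrict (Ioc 0 tf) :=
      Measure.restrict_mono Ioo_subset_Ioc_self le_rfl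
    filter_upwards [ae_mono hsub hU.equation, ae_mono hsub hfF,
      ae_restrict_mem measurableSet_Ioo] with t ⟨Ut, hUt, heq⟩ hft ht
    have htI := Ioo_subset_Icc_self ht
    have hder := (hasDerivAt_quadCoef B isOpen_Ioo ht
      (fun r hr => hdeg r (Ioo_subset_Icc_self hr)) hUt).deriv
    have hsymm : B (U t) Ut = B Ut (U t) := by
      have h1 : qA α β γ (U t) Ut = qA α β γ Ut (U t) := by
        simp only [qA, mul_comm, add_comm]
      rw [hB, hB, ip_eq hΩ, ip_eq hΩ, ipA_eq hΩ, ipA_eq hΩ, h1, mul_comm]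
    rw [hder, hsymm, hB]
    -- The discrete equation is tested with `V = U(t)`.
    have h1 := heq (U t) (hU.mem t htI)
    have h2 := hco (U t) (hU.mem t htI)
    linarith
  rw [hint, intervalIntegral.integral_sub (hF.sub (hmid.const_mul _)) hdis,
    intervalIntegral.integral_sub hF (hmid.const_mul _), intervalIntegral.integral_const_mul]
    at hmono
  unfold stabLHS
  linarith

/-! ### The forcing -/

lemma memLp_toFun (hΩ : IsPolygonal Ω) (w : M.Broken) :
    MemLp (toFun w) 2 (volume.restrict Ω) := by
  have : IsFiniteMeasure (volume.restrict Ω) := ⟨by simpa using volume_lt_top hΩ⟩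
  refine memLp_finsetSum _ fun i _ => MemLp.indicator (M.isOpen_elt i).measurableSet ?_
  obtain ⟨C, hC⟩ := hΩ.isBounded.isCompact_closure.exists_bound_of_continuousOn
    (continuous_pe (w i)).continuousOn
  exact MemLp.of_bound (continuous_pe (w i)).aestronglyMeasurable C
    ((ae_restrict_iff' hΩ.isOpen.measurableSet).2
      (Filter.Eventually.of_forall fun z hz => hC z (subset_closure hz)))

lemma integrable_qf {X : Type*} [MeasurableSpace X] {μ : Measure X} (α β γ : ℝ)
    {G H : X → Fin 2 → ℝ} (hG : ∀ j, MemLp (fun z => G z j) 2 μ)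
    (hH : ∀ j, MemLp (fun z => H z j) 2 μ) :
    Integrable (fun z => qf α β γ (G z 0) (G z 1) (H z 0) (H z 1)) μ :=
  ((((hG 0).integrable_mul (hH 0)).const_mul α).add
    ((((hG 0).integrable_mul (hH 1)).add ((hG 1).integrable_mul (hH 0))).const_mul β)).add
    (((hG 1).integrable_mul (hH 1)).const_mul γ)

/-- Young's inequality in `L²`. -/
lemma two_mul_ip_le {u v : Plane → ℝ} (hu : MemLp u 2 (volume.restrict Ω))
    (hv : MemLp v 2 (volume.restrict Ω)) {s : ℝ} (hs : 0 < s) :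
    2 * ip Ω u v ≤ s * ip Ω v v + s⁻¹ * ip Ω u u := by
  unfold ip
  have i1 : Integrable (fun z => 2 * (u z * v z)) (volume.restrict Ω) :=
    (hu.integrable_mul hv).const_mul 2
  have i2 : Integrable (fun z => s * (v z * v z)) (volume.restrict Ω) :=
    (hv.integrable_mul hv).const_mul s
  have i3 : Integrable (fun z => s⁻¹ * (u z * u z)) (volume.restrict Ω) :=
    (hu.integrable_mul hu).const_mul s⁻¹
  rw [← integral_const_mul, ← integral_const_mul, ← integral_const_mul, ← integral_add i2 i3]
  refine integral_mono i1 (i2.add i3) fun z => ?_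
  have h : s * (v z * v z) + s⁻¹ * (u z * u z) - 2 * (u z * v z) = s⁻¹ * (s * v z - u z) ^ 2 := by
    field_simp; ring
  have h2 : 0 ≤ s⁻¹ * (s * v z - u z) ^ 2 := by positivity
  simp only
  linarith

lemma two_mul_ipA_le {α : ℝ} (hα : 0 < α) {G H : Plane → Fin 2 → ℝ}
    (hG : ∀ j, MemLp (fun z => G z j) 2 (volume.restrict Ω))
    (hH : ∀ j, MemLp (fun z => H z j) 2 (volume.restrict Ω)) {s : ℝ} (hs : 0 < s) :
    2 * ipA Ω (matA α (α / 2) (3 * α / 8)) G H ≤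
      s * ipA Ω (matA α (α / 2) (3 * α / 8)) H H +
        s⁻¹ * ipA Ω (matA α (α / 2) (3 * α / 8)) G G := by
  unfold ipA
  simp only [dotProduct_matA]
  have i1 := (integrable_qf α (α / 2) (3 * α / 8) hG hH).const_mul 2
  have i2 := (integrable_qf α (α / 2) (3 * α / 8) hH hH).const_mul s
  have i3 := (integrable_qf α (α / 2) (3 * α / 8) hG hG).const_mul s⁻¹
  rw [← integral_const_mul, ← integral_const_mul, ← integral_const_mul, ← integral_add i2 i3]
  refine integral_mono i1 (i2.add i3) fun z => ?_
  have h := mul_nonneg (inv_nonneg.2 hs.le)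
    (qf_self_nonneg hα (s * H z 0 - G z 0) (s * H z 1 - G z 1))
  have e : s⁻¹ * qf α (α / 2) (3 * α / 8) (s * H z 0 - G z 0) (s * H z 1 - G z 1)
      (s * H z 0 - G z 0) (s * H z 1 - G z 1) =
      s * qf α (α / 2) (3 * α / 8) (H z 0) (H z 1) (H z 0) (H z 1) +
        s⁻¹ * qf α (α / 2) (3 * α / 8) (G z 0) (G z 1) (G z 0) (G z 1) -
        2 * qf α (α / 2) (3 * α / 8) (G z 0) (G z 1) (H z 0) (H z 1) := by
    unfold qf; field_simp; ring
  simp only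
  linarith

lemma ip_self_nonneg (u : Plane → ℝ) : 0 ≤ ip Ω u u := integral_nonneg fun _ => mul_self_nonneg _

lemma ipA_self_nonneg {α : ℝ} (hα : 0 < α) (G : Plane → Fin 2 → ℝ) :
    0 ≤ ipA Ω (matA α (α / 2) (3 * α / 8)) G G := by
  unfold ipA
  simp only [dotProduct_matA]
  exact integral_nonneg fun _ => qf_self_nonneg hα _ _

/-- The weak gradient of a function that vanishes almost everywhere. -/
lemma gradient_ae_eq_zero (hΩ : IsPolygonal Ω) {v : Plane → ℝ} {g : Plane → Fin 2 → ℝ}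
    (h : IsH1With Ω v g) (hv : v =ᵐ[volume.restrict Ω] 0) (j : Fin 2) :
    (fun z => g z j) =ᵐ[volume.restrict Ω] 0 := by
  obtain ⟨-, h2, h3⟩ := h
  refine (ae_restrict_iff' hΩ.isOpen.measurableSet).2
    (hΩ.isOpen.ae_eq_zero_of_integral_contDiff_smul_eq_zero
      (integrableOn_of_memLp hΩ (memLp_apply h2 j)).locallyIntegrableOn fun φ hφ hφc hφs => ?_)
  have h4 := h3 φ hφ hφc hφs j
  have h5 : ∫ z in Ω, v z * pd j φ z = 0 := integral_eq_zero_of_ae (by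
    filter_upwards [hv] with z hz
    simp [hz])
  rw [h5, zero_eq_neg] at h4
  rw [← setIntegral_eq_integral_of_forall_compl_eq_zero (s := Ω)]
  · simpa only [smul_eq_mul, mul_comm] using h4
  · intro z hz
    have : φ z = 0 := by
      by_contra hne
      exact hz (hφs (subset_tsupport φ hne))
    simp [this]

end Triangulation

namespace Triangulation

variable {Ω : Set Plane} {M : Triangulation Ω}

lemma intervalIntegrable_forcing {tf : ℝ} (htf : 0 < tf) (c α β γ : ℝ) {f : ℝ → Plane → ℝ}
    {g : ℝ → Plane → Fin 2 → ℝ}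
    (hf : MemLp (Function.uncurry f) 2
      ((volume.restrict (Ioc 0 tf)).prod (volume.restrict Ω)))
    (hg : MemLp (Function.uncurry g) 2
      ((volume.restrict (Ioc 0 tf)).prod (volume.restrict Ω))) :
    IntervalIntegrable (fun t => c * ip Ω (f t) (f t) + ipA Ω (matA α β γ) (g t) (g t))
      volume 0 tf := by
  rw [intervalIntegrable_iff_integrableOn_Ioc_of_le htf.le]
  have hgj : ∀ j, MemLp (fun z => Function.uncurry g z j) 2
      ((volume.restrict (Ioc 0 tf)).prod (volume.restrict Ω)) := fun j =>
    hg.of_le ((measurable_pi_apply j).comp_aemeasurable hg.1.aemeasurable).aestronglyMeasurable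
      (Filter.Eventually.of_forall fun z => norm_le_pi_norm (Function.uncurry g z) j)
  have h1 := (hf.integrable_mul hf).integral_prod_left
  have h2 := (integrable_qf α β γ hgj hgj).integral_prod_left
  unfold ip ipA
  simp only [dotProduct_matA]
  exact (h1.const_mul c).add h2

end Triangulation

end Kolmogorov

end

/-! ### The stability bound -/

open Kolmogorov Kolmogorov.Triangulation in
theorem lemma1 (Ω : Set Plane) (hΩ : IsPolygonal Ω) (σ θ : ℝ) :
    ∃ C₀ : ℝ, 0 < C₀ ∧ ∀ α : ℝ, 0 < α → α < 1 / 2 →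
      ∃ β γ c₀ : ℝ, 0 < γ ∧ γ < β ∧ β < 1 ∧ (matA α β γ).PosSemidef ∧ 0 < c₀ ∧
        ∀ M : Triangulation Ω, M.ShapeRegular σ → M.LocallyQuasiUniform θ →
        ∀ p : ℕ, 2 ≤ p → ∀ Cτ : ℝ, C₀ ≤ Cτ → ∀ κ lam : ℝ, 0 ≤ κ → 0 ≤ lam →
        ∀ tf : ℝ, 0 < tf →
        ∀ u₀ : Plane → ℝ, MemLp u₀ 2 (volume.restrict Ω) →
        ∀ (f : ℝ → Plane → ℝ) (g : ℝ → Plane → Fin 2 → ℝ),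
          MemLp (Function.uncurry f) 2
            ((volume.restrict (Ioc 0 tf)).prod (volume.restrict Ω)) →
          MemLp (Function.uncurry g) 2
            ((volume.restrict (Ioc 0 tf)).prod (volume.restrict Ω)) →
          (∀ᵐ t ∂(volume.restrict (Ioc 0 tf)), IsH1With Ω (f t) (g t)) →
        ∀ U : ℝ → M.Broken, M.IsFESolution p α β γ κ lam Cτ tf u₀ f g U →
          (∀ ζ : ℝ, 0 < ζ → ζ < 1 →
            stabLHS (matA α β γ) κ lam Cτ p c₀ ζ tf U ≤
              4 / ζ * (∫ t in (0 : ℝ)..tf,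
                (c₀⁻¹ * ip Ω (f t) (f t) + ipA Ω (matA α β γ) (g t) (g t))) +
              energy (matA α β γ) (U 0)) ∧
          ((∀ᵐ t ∂(volume.restrict (Ioc 0 tf)), f t =ᵐ[volume.restrict Ω] 0) →
            stabLHS (matA α β γ) κ lam Cτ p c₀ 0 tf U ≤ energy (matA α β γ) (U 0)) := by
  obtain ⟨R₀, hR₀⟩ := hΩ.isBounded.closure.subset_closedBall 0
  set R := max R₀ 1
  have hR : 0 < R := zero_lt_one.trans_le (le_max_right _ _)
  have hΩR : closure Ω ⊆ Metric.closedBall 0 R :=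
    hR₀.trans (Metric.closedBall_subset_closedBall (le_max_left _ _))
  obtain ⟨ν, hν, hell⟩ := exists_lower_bound_normal hΩ
  -- The bound `R²/ν²` serves the elliptic boundary and `768 max(1, θ) |σ|` the consistency terms;
  -- neither involves `α` or the mesh.
  refine ⟨max 1 (max (R ^ 2 / ν ^ 2) (768 * max 1 θ * |σ|)), by positivity,
    fun α hα hα2 => ⟨α / 2, 3 * α / 8, 1 / (8 * R ^ 2), by positivity, by linarith, by linarith,
      posSemidef_matA hα, by positivity, ?_⟩⟩
  intro M hσ hθ p hp Cτ hC κ lam hκ hlam tf htf u₀ _ f g hf hg hH1 U hU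
  obtain ⟨hC1, hC⟩ := max_le_iff.1 hC
  obtain ⟨hCν, hCK⟩ := max_le_iff.1 hC
  have hco := fun w (hw : w ∈ M.Vh p) => coercivity hΩ hα hα2 hσ hθ (le_max_left 1 θ)
    (le_max_right 1 θ) (zero_lt_one.trans_le hC1) hR hΩR hν hell hCν hCK hκ hlam hp hw
  set c₀ := 1 / (8 * R ^ 2)
  have hc₀ : 0 < c₀ := by positivity
  have hgrad : ∀ w : M.Broken, ∀ j, MemLp (fun z => grad w z j) 2 (volume.restrict Ω) :=
    fun w j => memLp_toFun hΩ (D j w)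
  constructor
  · intro ζ hζ hζ1
    have hF := (intervalIntegrable_forcing htf c₀⁻¹ α (α / 2) (3 * α / 8) hf hg).const_mul (4 / ζ)
    have h := stabLHS_le (ζ := ζ) hΩ htf hco hU hF ?_
    · rwa [intervalIntegral.integral_const_mul] at h
    · filter_upwards [hH1] with t ht
      -- Young's inequality with the weights `ζ c₀` here and `ζ` for the gradients produces exactly
      -- the share `ζ` of the coercive terms.
      have h1 := two_mul_ip_le ht.1 (memLp_toFun hΩ (U t)) (mul_pos hζ hc₀)
      have h2 := two_mul_ipA_le hα (memLp_apply ht.2.1) (hgrad (U t)) hζ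
      have h3 : 0 ≤ c₀⁻¹ * ip Ω (f t) (f t) + ipA Ω (matA α (α / 2) (3 * α / 8)) (g t) (g t) :=
        add_nonneg (mul_nonneg (inv_nonneg.2 hc₀.le) (ip_self_nonneg _)) (ipA_self_nonneg hα _)
      -- The argument yields the factor `1/ζ`, which is stronger than needed.
      have h4 : ζ⁻¹ ≤ 4 / ζ := by
        rw [inv_eq_one_div]; gcongr; norm_num
      have h5 := mul_le_mul_of_nonneg_right h4 h3
      rw [mul_inv] at h1
      linarith
  · intro hf0
    have h := stabLHS_le (ζ := 0) hΩ htf hco hU (F := fun _ => 0) (by simp) ?_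
    · simpa using h
    · filter_upwards [hH1, hf0] with t ht ht0
      have h1 : ip Ω (f t) (toFun (U t)) = 0 := integral_eq_zero_of_ae (by
        filter_upwards [ht0] with z hz
        simp [hz])
      -- If `f(t)` vanishes almost everywhere, so does its weak gradient, and the forcing disappears
      -- altogether.
      have h2 : ipA Ω (matA α (α / 2) (3 * α / 8)) (g t) (grad (U t)) = 0 :=
        integral_eq_zero_of_ae (by
          filter_upwards [gradient_ae_eq_zero hΩ ht ht0 0, gradient_ae_eq_zero hΩ ht ht0 1]
            with z hz0 hz1
          simp only [Pi.zero_apply] at hz0 hz1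
          rw [dotProduct_matA, qf, hz0, hz1]
          simp)
      simp [h1, h2]
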